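/- Let $n\ge 1$ and let $\mathbb H_n=\mathbb C^n\times\mathbb R$ carry Lebesgue measure $dz\,dt$; write $z=x+iy$ and $|z|^2=\sum_j|z_j|^2$. For $\lambda\in\mathbb R\setminus\{0\}$ let $\pi_\lambda$ be the Schrödinger representation on $L^2(\mathbb R^n)$, $$\pi_\lambda(x+iy,t)\varphi(\xi)=e^{i\lambda\left(t+y\cdot\xi+\frac12 x\cdot y\right)}\varphi(\xi+x),$$ and for $\beta\in\mathbb N_0^n$ let $h^\lambda_\beta(\xi)=|\lambda|^{n/4}\prod_{j}h_{\beta_j}(|\lambda|^{1/2}\xi_j)$, where $h_m(s)=(2^m m!\sqrt\pi)^{-1/2}H_m(s)e^{-s^2/2}$ are the normalized Hermite functions ($H_m$ the physicists' Hermite polynomials). For $k\in\mathbb N_0$ define the spherical functions $$\varphi_{\lambda,k}(z,t)=\sum_{|\beta|=k}\langle \pi_\lambda(z,t)h^\lambda_\beta,h^\lambda_\beta\rangle .$$ For $f\in\mathcal S(\mathbb H_n)$ write $\langle\varphi_{\lambda,k},f\rangle=\int_{\mathbb H_n}\varphi_{\lambda,k}(z,t)f(z,t)\,dz\,dt$.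 Let $\alpha\in\mathbb R$ with $\alpha\ne 2k+n$ for all $k\in\mathbb N_0$, and set $$\langle\Phi_\alpha,f\rangle=\sum_{k\ge0}\int_{-\infty}^{\infty}\frac{1}{-|\lambda|(2k+n-\alpha)}\,\langle\varphi_{\lambda,k},f\rangle\,|\lambda|^n\,d\lambda ,\qquad f\in\mathcal S(\mathbb H_n).$$ **Theorem.** $\Phi_\alpha$ is a well-defined tempered distribution on $\mathbb H_n$: for every $f\in\mathcal S(\mathbb H_n)$ the integrals $\langle\varphi_{\lambda,k},f\rangle$ ($\lambda\ne0$) and the integrals over $\lambda$ converge absolutely, one has $$\sum_{k\ge0}\int_{-\infty}^{\infty}\left|\frac{1}{-|\lambda|(2k+n-\alpha)}\langle\varphi_{\lambda,k},f\rangle\right||\lambda|^n\,d\lambda<\infty ,$$ and $f\mapsto\langle\Phi_\alpha,f\rangle$ is linear and continuous on $\mathcal S(\mathbb H_n)$. Moreover, for every $f\in\mathcal S(\mathbb H_n)$, $$\langle\Phi_\alpha,f\rangle=\frac{-2\cdot4^n(n-1)!}{n-\alpha}\int_{\mathbb H_n}\mathfrak{Re}\left(\left(\frac{|z|^2+4it}{|z|^4+16t^2}\right)^{n}{}_2F_1\left(n,\tfrac{n-\alpha}{2},\tfrac{n-\alpha}{2}+1;-\frac{(|z|^2+4it)^2}{|z|^4+16t^2}\right)\right)f(z,t)\,dz\,dt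 ,$$ the integral being absolutely convergent. Here ${}_2F_1(a,b,c;\zeta)$ is the Gauss hypergeometric function, given by $\sum_{k\ge0}\frac{(a)_k(b)_k}{(c)_k}\frac{\zeta^k}{k!}$ for $|\zeta|<1$ and by analytic continuation on $\mathbb C\setminus[1,\infty)$. -/

import Mathlib

open MeasureTheory
open scoped SchwartzMap

noncomputable section

/-- The underlying space `ℂⁿ × ℝ` of the Heisenberg group, with coordinates `(z, t)`, `z = x + i y`.
Its Haar measure is the Lebesgue measure `volume`. The Euclidean length of `z` is written out
explicitly below (`zNormSq`); the norm of the type is only used through its topology and its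
Schwartz space, which do not depend on the choice of the norm. -/
abbrev Heis (n : ℕ) : Type := (Fin n → ℂ) × ℝ

/-- `|z|² = ∑ |z_j|²`. -/
def zNormSq {n : ℕ} (p : Heis n) : ℝ := ∑ j, Complex.normSq (p.1 j)

/-- The Schrödinger representation `π_l` (here `l ≠ 0` real) on functions of `ξ ∈ ℝⁿ`:
`π_l(x + i y, t) φ (ξ) = exp (i l (t + y · ξ + x · y / 2)) φ (ξ + x)`. Its differential sends
`X_j`, `Y_j`, `T` to `∂/∂ξ_j`, `i l ξ_j`, `i l`. -/
def schrodingerRep {n : ℕ} (l : ℝ) (p : Heis n) (φ : (Fin n → ℝ) → ℂ) : (Fin n → ℝ) → ℂ :=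
  fun ξ =>
    Complex.exp (Complex.I *
      ((l * (p.2 + ∑ j, (p.1 j).im * ξ j + (∑ j, (p.1 j).re * (p.1 j).im) / 2) : ℝ) : ℂ)) *
      φ (fun j => ξ j + (p.1 j).re)

/-- The `L²(ℝ)`-normalized Hermite function of degree `m`,
`(2^m m! √π)^(-1/2) H_m(x) exp (-x²/2)` with `H_m` the physicists' Hermite polynomial, written with
Mathlib's (probabilists') Hermite polynomial `He_m` through `H_m(x) = 2^(m/2) He_m(√2 x)`. -/
def hermiteFun (m : ℕ) (x : ℝ) : ℝ :=
  Polynomial.aeval (Real.sqrt 2 * x) (Polynomial.hermite m) * Real.exp (-x ^ 2 / 2) /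
    Real.sqrt (m.factorial * Real.sqrt Real.pi)

/-- The scaled Hermite function on `ℝⁿ`,
`h_β^l (ξ) = |l|^(n/4) ∏ j, h_{β j} (|l|^(1/2) ξ_j)`. -/
def scaledHermite {n : ℕ} (l : ℝ) (β : Fin n → ℕ) (ξ : Fin n → ℝ) : ℂ :=
  ((∏ j, |l| ^ (1 / 4 : ℝ) * hermiteFun (β j) (Real.sqrt |l| * ξ j) : ℝ) : ℂ)

/-- The diagonal matrix entry `E_l (h_β, h_β) (z, t) = ⟨π_l(z, t) h_β, h_β⟩` in `L²(ℝⁿ)`. -/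
def diagEntry {n : ℕ} (l : ℝ) (β : Fin n → ℕ) (p : Heis n) : ℂ :=
  ∫ ξ : Fin n → ℝ,
    schrodingerRep l p (scaledHermite l β) ξ * (starRingEnd ℂ) (scaledHermite l β ξ)

/-- The spherical function `φ_{l,k} = ∑_{|β| = k} E_l (h_β, h_β)`, where `β` runs over the
multi-indices in `ℕⁿ` of length `β_1 + ⋯ + β_n = k`. -/
def sphericalFun {n : ℕ} (l : ℝ) (k : ℕ) (p : Heis n) : ℂ :=
  ∑ β ∈ Finset.piAntidiag (Finset.univ : Finset (Fin n)) k, diagEntry l β p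

/-- The pairing `⟨φ_{l,k}, f⟩ = ∫ φ_{l,k}(z, t) f(z, t) dz dt`. -/
def sphericalPairing {n : ℕ} (l : ℝ) (k : ℕ) (f : 𝓢(Heis n, ℂ)) : ℂ :=
  ∫ p : Heis n, sphericalFun l k p * f p

/-- The integrand `(-|l| (2k + n - α))⁻¹ ⟨φ_{l,k}, f⟩ |l|ⁿ` of the spherical expansion. -/
def phiIntegrand {n : ℕ} (α : ℝ) (k : ℕ) (f : 𝓢(Heis n, ℂ)) (l : ℝ) : ℂ :=
  ((1 / (-|l| * (2 * k + n - α)) : ℝ) : ℂ) * sphericalPairing l k f * ((|l| ^ n : ℝ) : ℂ)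

/-- The functional `⟨Φ_α, f⟩ = ∑_k ∫_ℝ (-|l| (2k + n - α))⁻¹ ⟨φ_{l,k}, f⟩ |l|ⁿ dl`. -/
def phiFunctional {n : ℕ} (α : ℝ) (f : 𝓢(Heis n, ℂ)) : ℂ :=
  ∑' k : ℕ, ∫ l : ℝ, phiIntegrand α k f l

/-- `F` is the analytic continuation to `ℂ ∖ [1, ∞)` of the Gauss hypergeometric series
`∑ (a)_k (b)_k / (c)_k ζ^k / k!` (`₂F₁` is the sum of that series, used here for `|ζ| < 1`).
By the identity theorem such an `F` is unique on `ℂ ∖ [1, ∞)`. -/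
def IsGaussContinuation (a b c : ℂ) (F : ℂ → ℂ) : Prop :=
  AnalyticOnNhd ℂ F {ζ : ℂ | 1 - ζ ∈ Complex.slitPlane} ∧ ∀ ζ : ℂ, ‖ζ‖ < 1 → F ζ = ₂F₁ a b c ζ

open Classical in
/-- The Gauss hypergeometric function on `ℂ ∖ [1, ∞)`, by analytic continuation of its series;
the continuation exists whenever `c` is not a nonpositive integer. -/
def gaussHyp (a b c ζ : ℂ) : ℂ :=
  if h : ∃ F : ℂ → ℂ, IsGaussContinuation a b c F then h.choose ζ else 0

/-- The kernel, without its constant: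
`Re (((|z|² + 4it) / (|z|⁴ + 16t²))ⁿ
  · ₂F₁ (n, (n - α)/2, (n - α)/2 + 1; -(|z|² + 4it)² / (|z|⁴ + 16t²)))`. -/
def kernelRe {n : ℕ} (α : ℝ) (p : Heis n) : ℝ :=
  let w : ℂ := (zNormSq p : ℂ) + 4 * Complex.I * (p.2 : ℂ)
  let d : ℂ := ((zNormSq p ^ 2 + 16 * p.2 ^ 2 : ℝ) : ℂ)
  let b : ℂ := (((n : ℝ) - α) / 2 : ℝ)
  ((w / d) ^ n * gaussHyp (n : ℂ) b (b + 1) (-(w ^ 2 / d))).re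

end

/-! ### Laguerre polynomials and their addition formula -/

noncomputable section

/-! Write w = |z|² + 4it and a = n - 1. The diagonal Hermite entries are products of Laguerre
functions, and the addition formula collapses the sum over |β| = k to φ_{λ,k} = e^{iλt}
e^{-|λ||z|²/4} L_k^a(|λ||z|²/2) (`sphericalFun_eq`).

Absolute convergence. By the Laguerre equation φ_{λ,k} is an eigenfunction of Δ_z + (|z|²/4)∂_t²
with eigenvalue -|λ|(2k+n). Each transfer of I minus this operator onto f gains a factor
(1+|λ|(2k+n))⁻¹. Unitarity gives |φ_{λ,k}| ≤ (2k+n)^a, so n+1 transfers make the k-th integral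
O(k⁻²) (`exists_norm_phiIntegrand_le`, `summable_integral_norm_phiIntegrand`).

Each term as an integral over the group. After insertion of e^{-ε|λ|}, Fubini and the Laplace
transform of L_k^a apply; as ε → 0 the k-th term becomes the integral of f against a constant
multiple of C(k+a,a)/(2k+n-α) · Re(w̄^{-n} ζ^k), where ζ = -w/w̄ = -w²/|w|²
(`integral_phiIntegrand`, `abelKernel_zero`).

Summation over k. Formally this is the hypergeometric series with b = (n-α)/2, because (b)_k/(b+1)_k
= b/(b+k). But |ζ| = 1, so sum and integral cannot be exchanged by absolute convergence, and Abel
means with weights r^k are used (`hasSum_abel`). As r → 1 the spectral side is dominated by the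
absolutely convergent sum. On the kernel side the continuation is O(|1-rζ|^{-a-1/2})
(`exists_norm_gaussHyp_le`), while |1-rζ| ≥ |z|²/|w| uniformly in r. This yields the integrable
majorant |z|^{-(2a+1)}|t|^{-1/2}, which also bounds the limit functional by a Schwartz seminorm. -/

open Finset in
-- Sort the (u+v+a+1)-subsets of k+a+1 points by the position p.1 + a of the element that has
-- exactly u+a chosen elements before it; v chosen elements then lie among the p.2 later points. The
-- induction on k uses Pascal's rule instead, lowering v.
theorem sum_antidiagonal_choose_mul_choose (a u v k : ℕ) :
    ∑ p ∈ antidiagonal k, (p.1 + a).choose (u + a) * p.2.choose v =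
      (k + a + 1).choose (u + v + a + 1) := by
  induction k generalizing v with
  | zero =>
    rcases v with _ | v
    · rcases u with _ | u
      · simp
      · have h : a + 1 < u + 1 + a + 1 := by omega
        have h' : a < u + 1 + a := by omega
        simp [Nat.choose_eq_zero_of_lt h, Nat.choose_eq_zero_of_lt h']
    · have h : a + 1 < u + (v + 1) + a + 1 := by omega
      simp [Nat.choose_eq_zero_of_lt h]
  | succ k ih =>
    rw [Nat.antidiagonal_succ', sum_cons, sum_map]
    rcases v with _ | v
    · have h := ih 0
      simp only [Nat.choose_zero_right, mul_one] at h ⊢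
      simp only [Function.Embedding.prodMap, Function.Embedding.coeFn_mk, Prod.map,
        Function.Embedding.refl_apply]
      rw [h, show k + 1 + a = k + a + 1 by ring, show u + 0 + a + 1 = (u + a) + 1 by ring,
        ← Nat.choose_succ_succ' (k + a + 1) (u + a)]
    · simp only [Function.Embedding.prodMap, Function.Embedding.coeFn_mk, Prod.map,
        Function.Embedding.refl_apply, Nat.succ_eq_add_one, Nat.choose_succ_succ' _ v, mul_add,
        sum_add_distrib, Nat.choose_zero_succ, mul_zero, zero_add]
      rw [ih v, ih (v + 1), show k + 1 + a + 1 = (k + a + 1) + 1 by ring,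
        show u + (v + 1) + a + 1 = (u + v + a + 1) + 1 by ring,
        Nat.choose_succ_succ' (k + a + 1)]

/-- The coefficient of `x ^ i` in the Laguerre polynomial `L_k^a`. -/
def laguerreCoeff (a k i : ℕ) : ℝ := (-1) ^ i * (k + a).choose (i + a) / i.factorial

/-- The Laguerre polynomial `L_k^a`. -/
def laguerre (a k : ℕ) : Polynomial ℝ :=
  ∑ i ∈ Finset.range (k + 1), Polynomial.monomial i (laguerreCoeff a k i)

theorem laguerreCoeff_eq_zero {a k i : ℕ} (h : k < i) : laguerreCoeff a k i = 0 := by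
  have h' : k + a < i + a := by omega
  simp [laguerreCoeff, Nat.choose_eq_zero_of_lt h']

theorem coeff_laguerre (a k i : ℕ) : (laguerre a k).coeff i = laguerreCoeff a k i := by
  simp only [laguerre, Polynomial.finsetSum_coeff, Polynomial.coeff_monomial]
  rw [Finset.sum_ite_eq' (Finset.range (k + 1)) i]
  split_ifs with h
  · rfl
  · rw [laguerreCoeff_eq_zero]; simpa [Nat.lt_succ_iff] using h

theorem eval_laguerre {a k N : ℕ} (h : k < N) (x : ℝ) :
    (laguerre a k).eval x = ∑ i ∈ Finset.range N, laguerreCoeff a k i * x ^ i := by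
  rw [laguerre, Polynomial.eval_finsetSum]
  simp only [Polynomial.eval_monomial]
  refine Finset.sum_subset (Finset.range_subset_range.2 h) fun i _ hi => ?_
  rw [laguerreCoeff_eq_zero (by simpa [Nat.lt_succ_iff] using hi), zero_mul]

theorem eval_zero_laguerre (m : ℕ) : (laguerre 0 m).eval 0 = 1 := by
  rw [← Polynomial.coeff_zero_eq_eval_zero, coeff_laguerre]
  simp [laguerreCoeff]

/-- The differential equation `x y'' + (a + 1 - x) y' + k y = 0` of the Laguerre polynomials. -/
theorem laguerre_ode (a k : ℕ) :
    Polynomial.X * Polynomial.derivative (Polynomial.derivative (laguerre a k)) +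
      (Polynomial.C ((a : ℝ) + 1) - Polynomial.X) * Polynomial.derivative (laguerre a k) +
      Polynomial.C (k : ℝ) * laguerre a k = 0 := by
  -- The coefficient of `x ^ i` in the equation is exactly this two-term recursion.
  have key (i : ℕ) : ((i : ℝ) + 1) * (i + a + 1) * laguerreCoeff a k (i + 1) =
      -((k : ℝ) - i) * laguerreCoeff a k i := by
    rcases lt_or_ge k i with h | h
    · rw [laguerreCoeff_eq_zero h, laguerreCoeff_eq_zero (by omega)]; simp
    · have h1 := Nat.choose_succ_right_eq (k + a) (i + a)
      rw [show k + a - (i + a) = k - i by omega] at h1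
      have h2 : ((k + a).choose (i + a + 1) : ℝ) * (i + a + 1) =
          (k + a).choose (i + a) * (k - i) := by
        rw [← Nat.cast_sub h]; exact_mod_cast h1
      simp only [laguerreCoeff]
      rw [show i + 1 + a = i + a + 1 by ring, Nat.factorial_succ]
      push_cast
      have : (i.factorial : ℝ) ≠ 0 := by positivity
      field_simp
      rw [pow_succ]
      linear_combination (-1) ^ i * (-1 : ℝ) * h2
  ext i
  rcases i with _ | i
  · have := key 0
    simp [sub_mul, add_mul, Polynomial.coeff_derivative, coeff_laguerre] at this ⊢
    linarith
  · have := key (i + 1)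
    simp [sub_mul, add_mul, Polynomial.coeff_derivative, coeff_laguerre] at this ⊢
    linarith

open Finset in
-- The generating functions (1-w)^{-a-1} exp(-xw/(1-w)) multiply in this way. Here the identity is
-- checked on the coefficient of x^u y^v, where it is the binomial convolution above.
theorem sum_antidiagonal_laguerre (a k : ℕ) (x y : ℝ) :
    ∑ p ∈ antidiagonal k, (laguerre a p.1).eval x * (laguerre 0 p.2).eval y =
      (laguerre (a + 1) k).eval (x + y) := by
  obtain ⟨F, hF⟩ : ∃ F : ℕ → ℕ → ℝ, ∀ u v, F u v = x ^ u * y ^ v * ((-1) ^ (u + v) *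
        (k + a + 1).choose (u + v + a + 1) / (u.factorial * v.factorial)) := ⟨_, fun _ _ => rfl⟩
  have h1 : ∑ p ∈ antidiagonal k, (laguerre a p.1).eval x * (laguerre 0 p.2).eval y =
      ∑ u ∈ range (k + 1), ∑ v ∈ range (k + 1), F u v := by
    have : ∀ p ∈ antidiagonal k, (laguerre a p.1).eval x * (laguerre 0 p.2).eval y =
        ∑ u ∈ range (k + 1), ∑ v ∈ range (k + 1), x ^ u * y ^ v * ((-1) ^ (u + v) /
        (u.factorial * v.factorial)) * (((p.1 + a).choose (u + a) * p.2.choose v : ℕ) : ℝ) := by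
      intro p hp
      have hp := mem_antidiagonal.1 hp
      rw [eval_laguerre (show p.1 < k + 1 by omega), eval_laguerre (show p.2 < k + 1 by omega),
        sum_mul_sum]
      refine sum_congr rfl fun u _ => sum_congr rfl fun v _ => ?_
      simp only [laguerreCoeff, add_zero]
      push_cast
      ring
    rw [sum_congr rfl this, sum_comm]
    refine sum_congr rfl fun u _ => ?_
    rw [sum_comm]
    refine sum_congr rfl fun v _ => ?_
    rw [hF, ← mul_sum, ← Nat.cast_sum, sum_antidiagonal_choose_mul_choose]
    ring
  rw [h1, eval_laguerre (Nat.lt_succ_self k)]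
  -- The binomial theorem groups the square of pairs (u, v) by w = u + v; pairs with u + v > k
  -- contribute zero because their binomial coefficient vanishes.
  have h2 : ∀ w ∈ range (k + 1), laguerreCoeff (a + 1) k w * (x + y) ^ w =
      ∑ u ∈ range (w + 1), F u (w - u) := by
    intro w _
    rw [add_pow, mul_sum]
    refine sum_congr rfl fun u hu => ?_
    have hu : u ≤ w := by simpa [Nat.lt_succ_iff] using hu
    simp only [laguerreCoeff, ← Nat.add_assoc]
    rw [hF, Nat.cast_choose ℝ hu, show u + (w - u) = w by omega]
    have : (w.factorial : ℝ) ≠ 0 := by positivity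
    field_simp
  rw [sum_congr rfl h2, sum_range_diag_flip]
  refine sum_congr rfl fun u hu => ?_
  symm
  refine sum_subset (range_subset_range.2 (by omega)) fun v _ hv => ?_
  have : k + a + 1 < u + v + a + 1 := by
    simp only [mem_range, not_lt] at hv; omega
  simp [hF, Nat.choose_eq_zero_of_lt this]

theorem prod_mk_laguerre (n : ℕ) (x : Fin (n + 1) → ℝ) :
    ∏ j, PowerSeries.mk (fun m => (laguerre 0 m).eval (x j)) =
      PowerSeries.mk fun m => (laguerre n m).eval (∑ j, x j) := by
  induction n with
  | zero => simp
  | succ n ih =>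
    rw [Fin.prod_univ_castSucc, Fin.sum_univ_castSucc, ih]
    ext k
    rw [PowerSeries.coeff_mul]
    simp only [PowerSeries.coeff_mk]
    exact sum_antidiagonal_laguerre n k _ _

theorem sum_piAntidiag_prod_laguerre {n : ℕ} (hn : 1 ≤ n) (k : ℕ) (x : Fin n → ℝ) :
    ∑ β ∈ Finset.piAntidiag (Finset.univ : Finset (Fin n)) k, ∏ j, (laguerre 0 (β j)).eval (x j) =
      (laguerre (n - 1) k).eval (∑ j, x j) := by
  obtain ⟨n, rfl⟩ : ∃ m, n = m + 1 := ⟨n - 1, by omega⟩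
  have h := congrArg (PowerSeries.coeff k) (prod_mk_laguerre n x)
  rw [PowerSeries.coeff_prod, PowerSeries.coeff_mk] at h
  simp only [PowerSeries.coeff_mk] at h
  rw [Nat.add_sub_cancel, ← h]
  refine (Finset.sum_bij (fun (l : Fin (n + 1) →₀ ℕ) _ => (l : Fin (n + 1) → ℕ)) ?_ ?_ ?_ ?_).symm
  · intro l hl
    simpa using (Finset.mem_finsuppAntidiag.1 hl).1
  · intro l _ l' _ hll
    exact DFunLike.coe_injective hll
  · intro β hβ
    refine ⟨Finsupp.equivFunOnFinite.symm β, ?_, rfl⟩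
    simpa [Finset.mem_finsuppAntidiag] using hβ
  · intro l _
    rfl

/-- At x = 0 every L_m equals 1, so the addition formula counts the multi-indices: there are
C(k+n-1, n-1) of them. -/
theorem card_piAntidiag_le {n : ℕ} (hn : 1 ≤ n) (k : ℕ) :
    (Finset.piAntidiag (Finset.univ : Finset (Fin n)) k).card ≤ (2 * k + n) ^ (n - 1) := by
  have h := sum_piAntidiag_prod_laguerre hn k (fun _ => 0)
  simp only [eval_zero_laguerre, Finset.prod_const_one, Finset.sum_const, nsmul_eq_mul, mul_one,
    mul_zero] at h
  rw [← Polynomial.coeff_zero_eq_eval_zero, coeff_laguerre] at h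
  simp only [laguerreCoeff, pow_zero, one_mul, zero_add, Nat.factorial_zero, Nat.cast_one,
    div_one, Nat.cast_inj] at h
  rw [h]
  exact (Nat.choose_le_pow _ _).trans (Nat.pow_le_pow_left (by omega) _)

end

/-! ### Gaussian moments of products of Hermite polynomials -/

noncomputable section

/-- The function `P(u) e^{ibu - u²/2}`. -/
def gaussPoly (b : ℝ) (P : Polynomial ℂ) (u : ℝ) : ℂ :=
  Complex.exp (Complex.I * b * u - (u : ℂ) ^ 2 / 2) * P.eval (u : ℂ)

theorem integrable_gaussPoly (b : ℝ) (P : Polynomial ℂ) : Integrable (gaussPoly b P) := by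
  have hmon (k : ℕ) (c : ℂ) : Integrable (gaussPoly b (Polynomial.monomial k c)) := by
    have h := integrable_rpow_mul_exp_neg_mul_sq (b := 1 / 2) (by norm_num) (s := k)
      (by have : (0 : ℝ) ≤ k := by positivity
          linarith)
    have h' := (h.norm.const_mul ‖c‖)
    refine h'.mono (by unfold gaussPoly; fun_prop) (Filter.Eventually.of_forall fun u => ?_)
    simp only [gaussPoly, Polynomial.eval_monomial, norm_mul, norm_pow, Complex.norm_real,
      Real.rpow_natCast, Complex.norm_exp, Real.norm_eq_abs, abs_abs, Real.abs_exp, abs_norm]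

    refine le_of_eq ?_
    have : (Complex.I * b * u - (u : ℂ) ^ 2 / 2).re = -(1 / 2) * u ^ 2 := by
      simp [← Complex.ofReal_pow]; ring
    rw [this]; ring
  induction P using Polynomial.induction_on' with
  | add p q hp hq =>
    have : gaussPoly b (p + q) = fun u => gaussPoly b p u + gaussPoly b q u := by
      ext u; simp [gaussPoly]; ring
    rw [this]; exact hp.add hq
  | monomial k c => exact hmon k c

/-- The Gaussian moment functional `P ↦ ∫ P(u) e^{ibu - u²/2} du`. -/
def gaussMoment (b : ℝ) (P : Polynomial ℂ) : ℂ := ∫ u : ℝ, gaussPoly b P u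

theorem gaussMoment_add (b : ℝ) (P Q : Polynomial ℂ) :
    gaussMoment b (P + Q) = gaussMoment b P + gaussMoment b Q := by
  unfold gaussMoment
  rw [← integral_add (integrable_gaussPoly b P) (integrable_gaussPoly b Q)]
  congr 1; ext u; simp [gaussPoly]; ring

theorem gaussMoment_C_mul (b : ℝ) (c : ℂ) (P : Polynomial ℂ) :
    gaussMoment b (Polynomial.C c * P) = c * gaussMoment b P := by
  unfold gaussMoment
  rw [← integral_const_mul]
  congr 1; ext u; simp [gaussPoly]; ring

theorem gaussMoment_neg (b : ℝ) (P : Polynomial ℂ) :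
    gaussMoment b (-P) = -gaussMoment b P := by
  have := gaussMoment_C_mul b (-1) P
  simpa using this

theorem gaussMoment_one (b : ℝ) :
    gaussMoment b 1 = Real.sqrt (2 * Real.pi) * Real.exp (-b ^ 2 / 2) := by
  have h := fourierIntegral_gaussian (b := 1 / 2) (by norm_num) b
  have h2 : gaussMoment b 1 = ∫ x : ℝ, Complex.exp (Complex.I * b * x) *
      Complex.exp (-(1 / 2) * (x : ℂ) ^ 2) := by
    unfold gaussMoment
    congr 1; ext u; simp only [gaussPoly, Polynomial.eval_one, mul_one, ← Complex.exp_add]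
    congr 1; ring
  rw [h2, h, Real.sqrt_eq_rpow, Complex.ofReal_cpow (by positivity)]
  push_cast
  congr 2
  · ring
  · ring

/-- The integral of the derivative of P(u) e^{ibu - u²/2} vanishes, and that derivative brings down
the factor ib - u. -/
theorem gaussMoment_X_mul (b : ℝ) (P : Polynomial ℂ) :
    gaussMoment b (Polynomial.X * P) =
      gaussMoment b (Polynomial.derivative P) + Complex.I * b * gaussMoment b P := by
  have h := integral_eq_zero_of_hasDerivAt_of_integrable (f := gaussPoly b P)
    (f' := gaussPoly b (Polynomial.derivative P + Polynomial.C (Complex.I * b) * P +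
      -(Polynomial.X * P))) ?_ (integrable_gaussPoly _ _) (integrable_gaussPoly _ _)
  · change gaussMoment b _ = 0 at h
    rw [gaussMoment_add, gaussMoment_add, gaussMoment_C_mul, gaussMoment_neg] at h
    linear_combination -h
  · intro u
    have h1 : HasDerivAt (fun u : ℝ => P.eval (u : ℂ)) ((Polynomial.derivative P).eval (u : ℂ)) u :=
      (P.hasDerivAt (u : ℂ)).comp_ofReal
    have h2 : HasDerivAt (fun z : ℂ => Complex.exp (Complex.I * b * z - z ^ 2 / 2))
        (Complex.exp (Complex.I * b * u - (u : ℂ) ^ 2 / 2) * (Complex.I * b - u)) u := by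
      have h3 : HasDerivAt (fun z : ℂ => Complex.I * b * z - z ^ 2 / 2) (Complex.I * b - u) u := by
        have h4 := ((hasDerivAt_id (u : ℂ)).const_mul (Complex.I * b)).sub
          (((hasDerivAt_id (u : ℂ)).pow 2).div_const 2)
        refine h4.congr_deriv ?_
        simp
      exact h3.cexp
    refine (h2.comp_ofReal.mul h1).congr_deriv ?_
    simp [gaussPoly]; ring

theorem derivative_hermite_succ (n : ℕ) :
    Polynomial.derivative (Polynomial.hermite (n + 1)) = (n + 1 : ℤ) • Polynomial.hermite n := by
  induction n with
  | zero => simp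
  | succ n ih =>
    rw [Polynomial.hermite_succ (n + 1)]
    simp only [Polynomial.derivative_sub, Polynomial.derivative_mul, Polynomial.derivative_X, ih]
    rw [Polynomial.derivative_smul, Polynomial.hermite_succ n]
    simp only [zsmul_eq_mul]
    push_cast
    ring

/-- The (probabilists') Hermite polynomial with complex coefficients. -/
def hermiteC (n : ℕ) : Polynomial ℂ := (Polynomial.hermite n).map (Int.castRingHom ℂ)

theorem hermiteC_succ (n : ℕ) : hermiteC (n + 1) =
    Polynomial.X * hermiteC n - Polynomial.derivative (hermiteC n) := by
  simp [hermiteC, Polynomial.hermite_succ, Polynomial.derivative_map]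

theorem derivative_hermiteC (n : ℕ) : Polynomial.derivative (hermiteC (n + 1)) =
    Polynomial.C ((n : ℂ) + 1) * hermiteC n := by
  rw [hermiteC, Polynomial.derivative_map, derivative_hermite_succ, hermiteC]
  simp

/-- The Gaussian moment of a product of two translated Hermite polynomials. -/
def hermiteMoment (a b : ℝ) (m n : ℕ) : ℂ :=
  gaussMoment b ((hermiteC m).comp (Polynomial.X + Polynomial.C (a : ℂ)) *
    (hermiteC n).comp (Polynomial.X + Polynomial.C (-a : ℂ)))

theorem derivative_comp_X_add (P : Polynomial ℂ) (c : ℂ) :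
    Polynomial.derivative (P.comp (Polynomial.X + Polynomial.C c)) =
      (Polynomial.derivative P).comp (Polynomial.X + Polynomial.C c) := by
  simp [Polynomial.derivative_comp]

/-- He_{m+1} = X He_m - He_m'. Integrating the X by parts produces (He_m Q)', whose first half
cancels the term -He_m' Q. -/
theorem gaussMoment_hermiteC_succ_mul (b : ℝ) (c : ℂ) (m : ℕ) (Q : Polynomial ℂ) :
    gaussMoment b ((hermiteC (m + 1)).comp (Polynomial.X + Polynomial.C c) * Q) =
      (c + Complex.I * b) * gaussMoment b ((hermiteC m).comp (Polynomial.X + Polynomial.C c) * Q) +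
      gaussMoment b ((hermiteC m).comp (Polynomial.X + Polynomial.C c) *
        Polynomial.derivative Q) := by
  set P := (hermiteC m).comp (Polynomial.X + Polynomial.C c) with hP
  have h1 : (hermiteC (m + 1)).comp (Polynomial.X + Polynomial.C c) * Q =
      Polynomial.X * (P * Q) + Polynomial.C c * (P * Q) + -(Polynomial.derivative P * Q) := by
    rw [hermiteC_succ, Polynomial.sub_comp, Polynomial.mul_comp, Polynomial.X_comp,
      ← derivative_comp_X_add, ← hP]
    ring
  rw [h1, gaussMoment_add, gaussMoment_add, gaussMoment_X_mul, gaussMoment_C_mul,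
    Polynomial.derivative_mul, gaussMoment_add, gaussMoment_neg]
  ring

theorem hermiteMoment_succ_zero (a b : ℝ) (m : ℕ) :
    hermiteMoment a b (m + 1) 0 = (a + Complex.I * b) * hermiteMoment a b m 0 := by
  unfold hermiteMoment
  rw [gaussMoment_hermiteC_succ_mul]
  simp [hermiteC, gaussMoment]
  simp [gaussPoly]

theorem hermiteMoment_succ_succ (a b : ℝ) (m n : ℕ) :
    hermiteMoment a b (m + 1) (n + 1) = (a + Complex.I * b) * hermiteMoment a b m (n + 1) +
      (n + 1) * hermiteMoment a b m n := by
  unfold hermiteMoment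
  rw [gaussMoment_hermiteC_succ_mul, derivative_comp_X_add, derivative_hermiteC,
    Polynomial.mul_comp, Polynomial.C_comp, mul_left_comm _ (Polynomial.C _), gaussMoment_C_mul]

theorem hermiteMoment_zero_left (a b : ℝ) (n : ℕ) :
    hermiteMoment a b 0 n = gaussMoment b 1 * (-a + Complex.I * b) ^ n := by
  unfold hermiteMoment
  rw [show hermiteC 0 = 1 by simp [hermiteC], Polynomial.one_comp, one_mul]
  induction n with
  | zero => simp [hermiteC]
  | succ n ih =>
    have h := gaussMoment_hermiteC_succ_mul b (-a) n 1
    rw [mul_one, mul_one, ih, Polynomial.derivative_one, mul_zero] at h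
    rw [h]
    simp only [gaussMoment, gaussPoly, Polynomial.eval_zero, mul_zero, integral_zero, add_zero]
    ring

open Finset in
-- A Wick formula: j is the number of contractions between the two factors, chosen in C(m,j) C(n,j)
-- j! ways. It solves the recursions in m and n by Pascal's rule and (n+1) C(n,j) = (j+1)
-- C(n+1,j+1).
theorem hermiteMoment_eq (a b : ℝ) (m n : ℕ) :
    hermiteMoment a b m n = gaussMoment b 1 * ∑ j ∈ range (m + 1),
      (m.choose j * n.choose j * j.factorial : ℕ) * (a + Complex.I * b) ^ (m - j) *
        (-a + Complex.I * b) ^ (n - j) := by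
  induction m generalizing n with
  | zero => simp [hermiteMoment_zero_left]
  | succ m ih =>
    rcases n with _ | n
    · rw [hermiteMoment_succ_zero, ih, sum_range_succ', sum_range_succ']
      simp; ring
    · rw [hermiteMoment_succ_succ, ih, ih]
      generalize (a : ℂ) + Complex.I * b = c
      generalize -(a : ℂ) + Complex.I * b = d
      have h1 : c * ∑ j ∈ range (m + 1), (m.choose j * (n + 1).choose j * j.factorial : ℕ) *
          c ^ (m - j) * d ^ (n + 1 - j) = ∑ j ∈ range (m + 2),
          (m.choose j * (n + 1).choose j * j.factorial : ℕ) * c ^ (m + 1 - j) *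
            d ^ (n + 1 - j) := by
        rw [sum_range_succ _ (m + 1), Nat.choose_succ_self, mul_sum]
        simp only [zero_mul, Nat.cast_zero, add_zero]
        refine sum_congr rfl fun j hj => ?_
        have hj : j ≤ m := by simpa [Nat.lt_succ_iff] using hj
        rw [Nat.succ_sub hj, pow_succ]; ring
      have h2 : ∀ j, (((m + 1).choose (j + 1) * (n + 1).choose (j + 1) *
          (j + 1).factorial : ℕ) : ℂ) = (m.choose (j + 1) * (n + 1).choose (j + 1) *
          (j + 1).factorial : ℕ) + (n + 1) * (m.choose j * n.choose j * j.factorial : ℕ) := by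
        intro j
        have h3 := Nat.add_one_mul_choose_eq n j
        have h4 : ((n : ℂ) + 1) * n.choose j = (n + 1).choose (j + 1) * (j + 1) := by
          exact_mod_cast h3
        rw [Nat.choose_succ_succ' m j, Nat.factorial_succ]
        push_cast
        linear_combination (-(m.choose j : ℂ) * j.factorial) * h4
      have h5 : ∑ j ∈ range (m + 1 + 1), ((m + 1).choose j * (n + 1).choose j * j.factorial : ℕ) *
          c ^ (m + 1 - j) * d ^ (n + 1 - j) = ∑ j ∈ range (m + 1 + 1),
          (m.choose j * (n + 1).choose j * j.factorial : ℕ) * c ^ (m + 1 - j) * d ^ (n + 1 - j) +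
          (n + 1) * ∑ j ∈ range (m + 1), (m.choose j * n.choose j * j.factorial : ℕ) *
          c ^ (m - j) * d ^ (n - j) := by
        rw [sum_range_succ', sum_range_succ' _ (m + 1), mul_sum]
        simp only [h2, add_mul, sum_add_distrib, Nat.add_sub_add_right, Nat.choose_zero_right]
        simp only [mul_assoc]
        ring
      rw [h5, mul_add, ← h1]
      ring

open Finset in
-- For equal degrees the two powers combine through (a+ib)(-a+ib) = -(a²+b²), and reversing the sum,
-- j ↦ m - j, turns it into m! times the Laguerre sum.
theorem hermiteMoment_self (a b : ℝ) (m : ℕ) :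
    hermiteMoment a b m m = gaussMoment b 1 * m.factorial *
      ((laguerre 0 m).eval (a ^ 2 + b ^ 2) : ℝ) := by
  rw [hermiteMoment_eq, mul_assoc, eval_laguerre (Nat.lt_succ_self m)]
  congr 1
  rw [← sum_flip]
  push_cast
  rw [mul_sum]
  refine sum_congr rfl fun i hi => ?_
  have hi : i ≤ m := by simpa [Nat.lt_succ_iff] using hi
  rw [Nat.sub_sub_self hi, mul_assoc, ← mul_pow, laguerreCoeff]
  have h1 : (a + Complex.I * b) * (-a + Complex.I * b) = -1 * ((a : ℂ) ^ 2 + b ^ 2) := by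
    linear_combination ((b : ℂ) ^ 2) * Complex.I_sq
  rw [h1, mul_pow, Nat.choose_symm hi]
  have h2 := Nat.choose_mul_factorial_mul_factorial hi
  have h3 : (m.choose i : ℂ) * i.factorial * (m - i).factorial = m.factorial := by
    exact_mod_cast h2
  push_cast
  have : (i.factorial : ℂ) ≠ 0 := by exact_mod_cast i.factorial_ne_zero
  field_simp
  simp only [add_zero]
  linear_combination ((m.choose i : ℂ) * ((a : ℂ) ^ 2 + b ^ 2) ^ i) * h3

end

/-! ### Matrix entries and spherical functions as Laguerre functions -/

noncomputable section

/-- The one-dimensional scaled Hermite function. -/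
def scaledHermite₁ (l : ℝ) (m : ℕ) (ξ : ℝ) : ℝ :=
  |l| ^ (1 / 4 : ℝ) * hermiteFun m (Real.sqrt |l| * ξ)

/-- The integrand of the diagonal matrix entry in one dimension. -/
def diagIntegrand₁ (l : ℝ) (m : ℕ) (x y ξ : ℝ) : ℂ :=
  Complex.exp (Complex.I * ((l * (y * ξ + x * y / 2) : ℝ) : ℂ)) *
    ((scaledHermite₁ l m (ξ + x) * scaledHermite₁ l m ξ : ℝ) : ℂ)

theorem ofReal_aeval_hermite (m : ℕ) (v : ℝ) :
    ((Polynomial.aeval v (Polynomial.hermite m) : ℝ) : ℂ) = (hermiteC m).eval (v : ℂ) := by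
  rw [hermiteC, Polynomial.eval_map, ← Complex.coe_algebraMap, ← Polynomial.aeval_algebraMap_apply,
    Polynomial.aeval_def]
  rfl

/-- The variable u = rξ + a is centred midway between ξ and ξ + x. The Hermite arguments become u ±
a up to scale, the Gaussians combine to e^{-u²/2 - a²/2}, and the term xy/2 of the phase is absorbed
into bu. -/
theorem diagIntegrand₁_eq {l : ℝ} (hl : l ≠ 0) (m : ℕ) (x y ξ : ℝ) :
    let r := Real.sqrt 2 * Real.sqrt |l|
    let a := r * x / 2
    let b := l * y / r
    diagIntegrand₁ l m x y ξ =
      ((Real.sqrt |l| / (m.factorial * Real.sqrt Real.pi) * Real.exp (-a ^ 2 / 2) : ℝ) : ℂ) *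
      gaussPoly b ((hermiteC m).comp (Polynomial.X + Polynomial.C (a : ℂ)) *
        (hermiteC m).comp (Polynomial.X + Polynomial.C (-a : ℂ))) (r * ξ + a) := by
  intro r a b
  have hl' : 0 < |l| := abs_pos.2 hl
  have hr : r ≠ 0 := by positivity
  have hr2 : r ^ 2 = 2 * |l| := by
    simp only [r, mul_pow]; rw [Real.sq_sqrt (by norm_num), Real.sq_sqrt hl'.le]
  have hs2 : Real.sqrt |l| ^ 2 = |l| := Real.sq_sqrt hl'.le
  have hq : (|l| ^ (1 / 4 : ℝ)) ^ 2 = Real.sqrt |l| := by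
    rw [← Real.rpow_natCast, ← Real.rpow_mul hl'.le, Real.sqrt_eq_rpow]; norm_num
  have hm : (0 : ℝ) < m.factorial * Real.sqrt Real.pi := by positivity
  have h1 : scaledHermite₁ l m (ξ + x) * scaledHermite₁ l m ξ =
      Real.sqrt |l| / (m.factorial * Real.sqrt Real.pi) *
      (Polynomial.aeval (r * (ξ + x)) (Polynomial.hermite m) *
        Polynomial.aeval (r * ξ) (Polynomial.hermite m)) *
      Real.exp (-((r * ξ + a) ^ 2 / 2) - a ^ 2 / 2) := by
    have he : -((r * ξ + a) ^ 2 / 2) - a ^ 2 / 2 = -(Real.sqrt |l| * (ξ + x)) ^ 2 / 2 +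
        -(Real.sqrt |l| * ξ) ^ 2 / 2 := by
      simp only [a]
      linear_combination (-(ξ ^ 2 + ξ * x + x ^ 2 / 2) / 2) * hr2 +
        (ξ ^ 2 + ξ * x + x ^ 2 / 2) * hs2
    rw [he, Real.exp_add]
    have h3 : Real.sqrt |l| / (m.factorial * Real.sqrt Real.pi) = (|l| ^ (1 / 4 : ℝ)) ^ 2 /
        Real.sqrt (m.factorial * Real.sqrt Real.pi) ^ 2 := by
      rw [hq, Real.sq_sqrt hm.le]
    have h4 (v : ℝ) : Real.sqrt 2 * (Real.sqrt |l| * v) = r * v := by simp only [r]; ring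
    rw [h3]
    simp only [scaledHermite₁, hermiteFun, h4]
    ring
  have h2 : (Complex.I * ((l * (y * ξ + x * y / 2) : ℝ) : ℂ)) =
      Complex.I * b * ((r * ξ + a : ℝ) : ℂ) := by
    have : l * (y * ξ + x * y / 2) = b * (r * ξ + a) := by
      simp only [a, b]; field_simp
    rw [this]; push_cast; ring
  rw [diagIntegrand₁, h1, h2, gaussPoly]
  simp only [Complex.ofReal_mul, ofReal_aeval_hermite, Polynomial.eval_mul, Polynomial.eval_comp,
    Polynomial.eval_add, Polynomial.eval_X, Polynomial.eval_C]
  have e1 : ((r * ξ + a : ℝ) : ℂ) + (a : ℂ) = (r : ℂ) * (ξ + x : ℝ) := by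
    simp only [a]; push_cast; ring
  have e2 : ((r * ξ + a : ℝ) : ℂ) + (-a : ℂ) = (r : ℂ) * ξ := by push_cast; ring
  rw [e1, e2, sub_eq_add_neg, Real.exp_add, sub_eq_add_neg, Complex.exp_add, Complex.ofReal_mul]
  push_cast
  rw [neg_div]
  ring

theorem integrable_diagIntegrand₁ {l : ℝ} (hl : l ≠ 0) (m : ℕ) (x y : ℝ) :
    Integrable (diagIntegrand₁ l m x y) := by
  have hl' : 0 < |l| := abs_pos.2 hl
  have hr : Real.sqrt 2 * Real.sqrt |l| ≠ 0 := by positivity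
  simp only [funext (diagIntegrand₁_eq hl m x y)]
  exact (((integrable_gaussPoly _ _).comp_add_right _).comp_mul_left' hr).const_mul _

/-- The diagonal matrix entries of the Schrödinger representation in one dimension. -/
theorem integral_diagIntegrand₁ {l : ℝ} (hl : l ≠ 0) (m : ℕ) (x y : ℝ) :
    ∫ ξ, diagIntegrand₁ l m x y ξ = ((Real.exp (-(|l| * (x ^ 2 + y ^ 2) / 4)) *
      (laguerre 0 m).eval (|l| * (x ^ 2 + y ^ 2) / 2) : ℝ) : ℂ) := by
  have hl' : 0 < |l| := abs_pos.2 hl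
  have hr : 0 < Real.sqrt 2 * Real.sqrt |l| := by positivity
  have hr2 : (Real.sqrt 2 * Real.sqrt |l|) ^ 2 = 2 * |l| := by
    rw [mul_pow, Real.sq_sqrt (by norm_num), Real.sq_sqrt hl'.le]
  simp only [diagIntegrand₁_eq hl m x y]
  rw [integral_const_mul, Measure.integral_comp_mul_left (fun v => gaussPoly _ _ (v + _)),
    integral_add_right_eq_self (fun v => gaussPoly _ _ v)]
  change _ * (_ • hermiteMoment _ _ m m) = _
  rw [hermiteMoment_self, gaussMoment_one, abs_of_pos (inv_pos.2 hr)]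
  -- Here a² + b² is the Laguerre argument; half of it, with a minus sign, is the exponent: a² comes
  -- from the Gaussian prefactor and b² from `gaussMoment_one`.
  have hab : (Real.sqrt 2 * Real.sqrt |l| * x / 2) ^ 2 + (l * y / (Real.sqrt 2 * Real.sqrt |l|)) ^ 2
      = |l| * (x ^ 2 + y ^ 2) / 2 := by
    rw [div_pow, div_pow, mul_pow _ x, hr2, mul_pow l y, ← sq_abs l]; field_simp
  have hexp : Real.exp (-(|l| * (x ^ 2 + y ^ 2) / 4)) =
      Real.exp (-(Real.sqrt 2 * Real.sqrt |l| * x / 2) ^ 2 / 2) *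
        Real.exp (-(l * y / (Real.sqrt 2 * Real.sqrt |l|)) ^ 2 / 2) := by
    rw [← Real.exp_add]; congr 1; linarith
  have hab' : ((Real.sqrt 2 * Real.sqrt |l| * x / 2 : ℝ) : ℂ) ^ 2 +
      ((l * y / (Real.sqrt 2 * Real.sqrt |l|) : ℝ) : ℂ) ^ 2 =
      ((|l| * (x ^ 2 + y ^ 2) / 2 : ℝ) : ℂ) := by rw [← hab]; push_cast; ring
  rw [hexp, ← hab, Complex.real_smul]
  have hpi : Real.sqrt (2 * Real.pi) = Real.sqrt 2 * Real.sqrt Real.pi :=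
    Real.sqrt_mul (by norm_num) _
  rw [hpi]
  have hm : (m.factorial : ℝ) ≠ 0 := by positivity
  have hp : Real.sqrt Real.pi ≠ 0 := by positivity
  have hs : Real.sqrt |l| ≠ 0 := by positivity
  have h2 : Real.sqrt 2 ≠ 0 := by positivity
  norm_cast
  field_simp

/-- Cauchy–Schwarz for a unitary operator, in the form |xy| ≤ (x²+y²)/2 with translation invariance.
The normalization of the Hermite function is read off from the explicit formula at x = y = 0. -/
theorem norm_integral_diagIntegrand₁_le {l : ℝ} (hl : l ≠ 0) (m : ℕ) (x y : ℝ) :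
    ‖∫ ξ, diagIntegrand₁ l m x y ξ‖ ≤ 1 := by
  have h0 : Integrable fun ξ => scaledHermite₁ l m ξ ^ 2 := by
    refine (integrable_diagIntegrand₁ hl m 0 0).re.congr (Filter.Eventually.of_forall fun ξ => ?_)
    simp [diagIntegrand₁, sq]
  have h1 : ∫ ξ, scaledHermite₁ l m ξ ^ 2 = 1 := by
    have h := integral_diagIntegrand₁ hl m 0 0
    have h2 : ∀ ξ, diagIntegrand₁ l m 0 0 ξ = ((scaledHermite₁ l m ξ ^ 2 : ℝ) : ℂ) := by
      intro ξ; simp [diagIntegrand₁, sq]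
    simp only [h2] at h
    rw [integral_complex_ofReal, Complex.ofReal_inj] at h
    rw [h]
    simp [eval_zero_laguerre]
  have h2 := h0.comp_add_right x
  calc ‖∫ ξ, diagIntegrand₁ l m x y ξ‖
      ≤ ∫ ξ, (scaledHermite₁ l m (ξ + x) ^ 2 + scaledHermite₁ l m ξ ^ 2) / 2 := by
        refine norm_integral_le_of_norm_le ((h2.add h0).div_const 2)
          (Filter.Eventually.of_forall fun ξ => ?_)
        rw [diagIntegrand₁, norm_mul, mul_comm Complex.I, Complex.norm_exp_ofReal_mul_I, one_mul,
          Complex.norm_real, Real.norm_eq_abs]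
        rw [abs_le]
        constructor <;> nlinarith [sq_nonneg (scaledHermite₁ l m (ξ + x) + scaledHermite₁ l m ξ),
          sq_nonneg (scaledHermite₁ l m (ξ + x) - scaledHermite₁ l m ξ)]
    _ = 1 := by
        rw [integral_div, integral_add h2 h0,
          integral_add_right_eq_self (fun ξ => scaledHermite₁ l m ξ ^ 2), h1]
        norm_num

theorem diagEntry_eq_prod {n : ℕ} (l : ℝ) (β : Fin n → ℕ) (p : Heis n) :
    diagEntry l β p = Complex.exp (Complex.I * ((l * p.2 : ℝ) : ℂ)) *
      ∏ j, ∫ ξ, diagIntegrand₁ l (β j) (p.1 j).re (p.1 j).im ξ := by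
  rw [← integral_fintype_prod_volume_eq_prod, ← integral_const_mul]
  unfold diagEntry
  congr 1
  ext ξ
  simp only [diagIntegrand₁, Finset.prod_mul_distrib, ← Complex.exp_sum, ← Complex.ofReal_prod,
    ← mul_assoc, ← Complex.exp_add, schrodingerRep, scaledHermite, Complex.conj_ofReal]
  rw [mul_assoc, ← Complex.ofReal_mul]
  congr 2
  · simp only [← Finset.mul_sum, ← mul_add, Finset.sum_add_distrib, ← Complex.ofReal_sum,
      Finset.sum_div]
    push_cast
    ring
  · simp only [scaledHermite₁, Finset.prod_mul_distrib]

theorem diagEntry_eq {n : ℕ} {l : ℝ} (hl : l ≠ 0) (β : Fin n → ℕ) (p : Heis n) :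
    diagEntry l β p = Complex.exp (Complex.I * ((l * p.2 : ℝ) : ℂ)) *
      ((Real.exp (-(|l| * zNormSq p / 4)) *
        ∏ j, (laguerre 0 (β j)).eval (|l| * Complex.normSq (p.1 j) / 2) : ℝ) : ℂ) := by
  rw [diagEntry_eq_prod]
  simp only [integral_diagIntegrand₁ hl, zNormSq]
  rw [← Complex.ofReal_prod, Finset.prod_mul_distrib, ← Real.exp_sum, Finset.mul_sum,
    Finset.sum_div, ← Finset.sum_neg_distrib]
  simp only [Complex.normSq_apply, sq]

theorem norm_diagEntry_le {n : ℕ} {l : ℝ} (hl : l ≠ 0) (β : Fin n → ℕ) (p : Heis n) :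
    ‖diagEntry l β p‖ ≤ 1 := by
  rw [diagEntry_eq_prod, norm_mul, mul_comm Complex.I, Complex.norm_exp_ofReal_mul_I, one_mul,
    norm_prod]
  exact Finset.prod_le_one (fun _ _ => norm_nonneg _)
    fun _ _ => norm_integral_diagIntegrand₁_le hl _ _ _

/-- The spherical functions in terms of Laguerre polynomials. -/
theorem sphericalFun_eq {n : ℕ} (hn : 1 ≤ n) {l : ℝ} (hl : l ≠ 0) (k : ℕ) (p : Heis n) :
    sphericalFun l k p = Complex.exp (Complex.I * ((l * p.2 : ℝ) : ℂ)) *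
      ((Real.exp (-(|l| * zNormSq p / 4)) *
        (laguerre (n - 1) k).eval (|l| * zNormSq p / 2) : ℝ) : ℂ) := by
  simp only [sphericalFun, diagEntry_eq hl]
  rw [← Finset.mul_sum, ← Complex.ofReal_sum, ← Finset.mul_sum,
    sum_piAntidiag_prod_laguerre hn k (fun j => |l| * Complex.normSq (p.1 j) / 2),
    ← Finset.sum_div, ← Finset.mul_sum]
  rfl

/-- Each matrix entry has modulus at most 1, so the number of multi-indices is a bound uniform in
`l` and `p`; no estimate of Laguerre polynomials is needed. -/
theorem norm_sphericalFun_le {n : ℕ} (hn : 1 ≤ n) {l : ℝ} (hl : l ≠ 0) (k : ℕ) (p : Heis n) :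
    ‖sphericalFun l k p‖ ≤ (2 * k + n : ℝ) ^ (n - 1) := by
  calc ‖sphericalFun l k p‖
      ≤ ∑ β ∈ Finset.piAntidiag (Finset.univ : Finset (Fin n)) k, (1 : ℝ) :=
        norm_sum_le_of_le _ fun β _ => norm_diagEntry_le hl β p
    _ = (Finset.piAntidiag (Finset.univ : Finset (Fin n)) k).card := by simp
    _ ≤ (2 * k + n : ℝ) ^ (n - 1) := by exact_mod_cast card_piAntidiag_le hn k

end

/-! ### Integration by parts against functions of polynomial growth -/

noncomputable section

/-- Continuous functions of at most polynomial growth. -/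
def PolyGrowth {E : Type*} [NormedAddCommGroup E] (φ : E → ℂ) : Prop :=
  Continuous φ ∧ ∃ (C : ℝ) (N : ℕ), 0 ≤ C ∧ ∀ p, ‖φ p‖ ≤ C * (1 + ‖p‖) ^ N

namespace PolyGrowth

variable {E : Type*} [NormedAddCommGroup E] {φ ψ : E → ℂ}

theorem of_bounded (hφ : Continuous φ) {C : ℝ} (h : ∀ p, ‖φ p‖ ≤ C) : PolyGrowth φ :=
  ⟨hφ, C, 0, (norm_nonneg _).trans (h 0), by simpa using h⟩

theorem const (c : ℂ) : PolyGrowth (fun _ : E => c) :=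
  of_bounded continuous_const fun _ => le_rfl

theorem mul (hφ : PolyGrowth φ) (hψ : PolyGrowth ψ) : PolyGrowth (fun p => φ p * ψ p) := by
  obtain ⟨h1, C, N, hC, h2⟩ := hφ
  obtain ⟨h3, D, M, hD, h4⟩ := hψ
  refine ⟨h1.mul h3, C * D, N + M, by positivity, fun p => ?_⟩
  rw [norm_mul, pow_add]
  calc _ ≤ (C * (1 + ‖p‖) ^ N) * (D * (1 + ‖p‖) ^ M) :=
        mul_le_mul (h2 p) (h4 p) (norm_nonneg _) (by positivity)
    _ = _ := by ring

theorem add (hφ : PolyGrowth φ) (hψ : PolyGrowth ψ) : PolyGrowth (fun p => φ p + ψ p) := by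
  obtain ⟨h1, C, N, hC, h2⟩ := hφ
  obtain ⟨h3, D, M, hD, h4⟩ := hψ
  refine ⟨h1.add h3, C + D, N + M, by positivity, fun p => (norm_add_le _ _).trans ?_⟩
  have hp : 1 ≤ 1 + ‖p‖ := by linarith [norm_nonneg p]
  have e1 : (1 + ‖p‖) ^ N ≤ (1 + ‖p‖) ^ (N + M) := pow_le_pow_right₀ hp (by omega)
  have e2 : (1 + ‖p‖) ^ M ≤ (1 + ‖p‖) ^ (N + M) := pow_le_pow_right₀ hp (by omega)
  calc _ ≤ C * (1 + ‖p‖) ^ N + D * (1 + ‖p‖) ^ M := add_le_add (h2 p) (h4 p)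
    _ ≤ C * (1 + ‖p‖) ^ (N + M) + D * (1 + ‖p‖) ^ (N + M) := by gcongr
    _ = _ := by ring

theorem sum {ι : Type*} (s : Finset ι) {φ : ι → E → ℂ} (h : ∀ i, PolyGrowth (φ i)) :
    PolyGrowth (fun p => ∑ i ∈ s, φ i p) := by
  classical
  induction s using Finset.induction_on with
  | empty => simpa using const 0
  | insert i s hi ih => simpa [Finset.sum_insert hi] using (h i).add ih

theorem pow (hφ : PolyGrowth φ) (k : ℕ) : PolyGrowth (fun p => φ p ^ k) := by
  induction k with
  | zero => simpa using const 1
  | succ k ih => simpa [pow_succ] using ih.mul hφ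

theorem ofReal_eval {g : E → ℝ} (hg : PolyGrowth fun p => (g p : ℂ)) (Q : Polynomial ℝ) :
    PolyGrowth fun p => ((Q.eval (g p) : ℝ) : ℂ) := by
  simp only [Polynomial.eval_eq_sum_range, Complex.ofReal_sum, Complex.ofReal_mul,
    Complex.ofReal_pow]
  exact sum _ fun i => (const _).mul (hg.pow i)

theorem ofReal_clm [NormedSpace ℝ E] (L : E →L[ℝ] ℝ) : PolyGrowth fun p => (L p : ℂ) := by
  refine ⟨by fun_prop, ‖L‖, 1, norm_nonneg _, fun p => ?_⟩
  rw [Complex.norm_real, pow_one]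
  exact (L.le_opNorm p).trans (by gcongr; linarith)

theorem integrable_mul_schwartz [NormedSpace ℝ E] [MeasurableSpace E] [BorelSpace E]
    [SecondCountableTopology E] {μ : Measure E} [μ.HasTemperateGrowth] (hφ : PolyGrowth φ)
    (f : 𝓢(E, ℂ)) : Integrable (fun p => φ p * f p) μ := by
  obtain ⟨h1, C, N, hC, h2⟩ := hφ
  have h3 : Integrable (fun p => C * 2 ^ (N - 1) * (‖p‖ ^ 0 * ‖f p‖ + ‖p‖ ^ N * ‖f p‖)) μ :=
    ((f.integrable_pow_mul μ 0).add (f.integrable_pow_mul μ N)).const_mul _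
  refine h3.mono' ((h1.mul f.continuous).aestronglyMeasurable)
    (Filter.Eventually.of_forall fun p => ?_)
  rw [norm_mul]
  calc ‖φ p‖ * ‖f p‖ ≤ C * (1 + ‖p‖) ^ N * ‖f p‖ := by gcongr; exact h2 p
    _ ≤ C * (2 ^ (N - 1) * (1 ^ N + ‖p‖ ^ N)) * ‖f p‖ := by
        gcongr; exact add_pow_le zero_le_one (norm_nonneg p) N
    _ = _ := by rw [one_pow, pow_zero]; ring

open LineDeriv in
theorem integral_mul_lineDerivOp [NormedSpace ℝ E] [MeasurableSpace E] [BorelSpace E]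
    [FiniteDimensional ℝ E] {μ : Measure E} [μ.IsAddHaarMeasure] {φ' : E → ℂ} (v : E)
    (hφ : PolyGrowth φ) (hφ' : PolyGrowth φ') (hd : ∀ p, HasLineDerivAt ℝ φ (φ' p) p v)
    (f : 𝓢(E, ℂ)) : ∫ p, φ p * (∂_{v} f) p ∂μ = -∫ p, φ' p * f p ∂μ := by
  refine integral_bilinear_hasLineDerivAt_right_eq_neg_left_of_integrable
    (B := ContinuousLinearMap.mul ℝ ℂ) (v := v) (hφ'.integrable_mul_schwartz f)
    (hφ.integrable_mul_schwartz _) (hφ.integrable_mul_schwartz f) (fun p _ => hd p) fun p _ => ?_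
  rw [SchwartzMap.lineDerivOp_apply_eq_fderiv]
  exact (f.hasFDerivAt p).hasLineDerivAt v

open LineDeriv in
theorem integral_mul_lineDerivOp_lineDerivOp [NormedSpace ℝ E] [MeasurableSpace E] [BorelSpace E]
    [FiniteDimensional ℝ E] {μ : Measure E} [μ.IsAddHaarMeasure] {φ' φ'' : E → ℂ} (v : E)
    (hφ : PolyGrowth φ) (hφ' : PolyGrowth φ') (hφ'' : PolyGrowth φ'')
    (hd : ∀ p, HasLineDerivAt ℝ φ (φ' p) p v) (hd' : ∀ p, HasLineDerivAt ℝ φ' (φ'' p) p v)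
    (f : 𝓢(E, ℂ)) : ∫ p, φ p * (∂_{v} (∂_{v} f)) p ∂μ = ∫ p, φ'' p * f p ∂μ := by
  rw [integral_mul_lineDerivOp v hφ hφ' hd, integral_mul_lineDerivOp v hφ' hφ'' hd', neg_neg]

end PolyGrowth

/-! ### Functions radial in z and their eigenvalue equation -/

section Heisenberg

variable {n : ℕ}

theorem polyGrowth_re (j : Fin n) : PolyGrowth fun p : Heis n => ((p.1 j).re : ℂ) :=
  .ofReal_clm (Complex.reCLM.comp ((ContinuousLinearMap.proj (R := ℝ) j).comp
    (ContinuousLinearMap.fst ℝ (Fin n → ℂ) ℝ)))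

theorem polyGrowth_im (j : Fin n) : PolyGrowth fun p : Heis n => ((p.1 j).im : ℂ) :=
  .ofReal_clm (Complex.imCLM.comp ((ContinuousLinearMap.proj (R := ℝ) j).comp
    (ContinuousLinearMap.fst ℝ (Fin n → ℂ) ℝ)))

theorem polyGrowth_zNormSq : PolyGrowth fun p : Heis n => (zNormSq p : ℂ) := by
  simp only [zNormSq, Complex.normSq_apply, Complex.ofReal_sum, Complex.ofReal_add,
    Complex.ofReal_mul]
  exact .sum _ fun j => ((polyGrowth_re j).mul (polyGrowth_re j)).add
    ((polyGrowth_im j).mul (polyGrowth_im j))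

theorem zNormSq_nonneg (p : Heis n) : 0 ≤ zNormSq p :=
  Finset.sum_nonneg fun _ _ => Complex.normSq_nonneg _

theorem hasTemperateGrowth_zNormSq :
    (fun p : Heis n => ((zNormSq p / 4 : ℝ) : ℂ)).HasTemperateGrowth := by
  have h1 (j : Fin n) : (fun p : Heis n => (p.1 j).re).HasTemperateGrowth :=
    (Complex.reCLM.comp ((ContinuousLinearMap.proj (R := ℝ) j).comp
      (ContinuousLinearMap.fst ℝ (Fin n → ℂ) ℝ))).hasTemperateGrowth
  have h2 (j : Fin n) : (fun p : Heis n => (p.1 j).im).HasTemperateGrowth :=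
    (Complex.imCLM.comp ((ContinuousLinearMap.proj (R := ℝ) j).comp
      (ContinuousLinearMap.fst ℝ (Fin n → ℂ) ℝ))).hasTemperateGrowth
  have h3 : (fun p : Heis n => zNormSq p).HasTemperateGrowth := by
    simp only [zNormSq, Complex.normSq_apply]
    exact .sum fun j _ => ((h1 j).mul (h1 j)).add ((h2 j).mul (h2 j))
  have h4 : (fun p : Heis n => zNormSq p / 4).HasTemperateGrowth := by
    simp only [div_eq_mul_inv]; exact h3.mul (.const _)
  exact Function.Complex.hasTemperateGrowth_ofReal.comp h4

/-- The radial function `e^{ilt} e^{-|l||z|²/4} Q(|l||z|²/2)`. -/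
def radialExp (l : ℝ) (Q : Polynomial ℝ) (p : Heis n) : ℂ :=
  Complex.exp (Complex.I * ((l * p.2 : ℝ) : ℂ)) *
    ((Real.exp (-(|l| * zNormSq p / 4)) * Q.eval (|l| * zNormSq p / 2) : ℝ) : ℂ)

theorem continuous_zNormSq : Continuous (zNormSq : Heis n → ℝ) := by
  unfold zNormSq
  exact continuous_finsetSum _ fun j _ =>
    Complex.continuous_normSq.comp ((continuous_apply j).comp continuous_fst)

theorem polyGrowth_radialExp (l : ℝ) (Q : Polynomial ℝ) :
    PolyGrowth (radialExp l Q : Heis n → ℂ) := by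
  have h1 : PolyGrowth fun p : Heis n => Complex.exp (Complex.I * ((l * p.2 : ℝ) : ℂ)) :=
    .of_bounded (by fun_prop) (C := 1) fun p => by
      rw [mul_comm Complex.I, Complex.norm_exp_ofReal_mul_I]
  have h2 : PolyGrowth fun p : Heis n => ((Real.exp (-(|l| * zNormSq p / 4)) : ℝ) : ℂ) := by
    refine .of_bounded (by have := continuous_zNormSq (n := n); fun_prop) (C := 1) fun p => ?_
    rw [Complex.norm_real, Real.norm_eq_abs, Real.abs_exp, Real.exp_le_one_iff]
    have := zNormSq_nonneg p
    have : 0 ≤ |l| * zNormSq p / 4 := by positivity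
    linarith
  have h3 : PolyGrowth fun p : Heis n => ((|l| * zNormSq p / 2 : ℝ) : ℂ) := by
    convert! (PolyGrowth.const (((|l| : ℝ) : ℂ) / 2)).mul (polyGrowth_zNormSq (n := n)) using 2 with p
    push_cast; ring
  have h4 := h1.mul (h2.mul (h3.ofReal_eval Q))
  refine (funext fun p => ?_ : (radialExp l Q : Heis n → ℂ) = _) ▸ h4
  rw [radialExp, Complex.ofReal_mul (Real.exp _)]

/-- The linear form `Re (z_j conj c)`. -/
def coordForm (j : Fin n) (c : ℂ) (p : Heis n) : ℝ := (p.1 j * (starRingEnd ℂ) c).re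

theorem polyGrowth_coordForm (j : Fin n) (c : ℂ) :
    PolyGrowth fun p : Heis n => (coordForm j c p : ℂ) := by
  have h := ((polyGrowth_re j).mul (.const (c.re : ℂ))).add
    ((polyGrowth_im j).mul (.const (c.im : ℂ)))
  convert! h using 2 with p
  simp [coordForm]

/-- The direction of the coordinate `z_j` rotated by `c`. -/
def coordDir (j : Fin n) (c : ℂ) : Heis n := (Pi.single j c, 0)

theorem zNormSq_add_smul (j : Fin n) {c : ℂ} (hc : Complex.normSq c = 1) (p : Heis n) (τ : ℝ) :
    zNormSq (p + τ • coordDir j c) = zNormSq p + 2 * τ * coordForm j c p + τ ^ 2 := by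
  have h (i : Fin n) : Complex.normSq ((p + τ • coordDir j c).1 i) = Complex.normSq (p.1 i) +
      if i = j then 2 * τ * coordForm j c p + τ ^ 2 else 0 := by
    by_cases hij : i = j
    · subst hij
      simp only [coordDir, Prod.fst_add, Prod.smul_fst, Pi.add_apply, Pi.smul_apply,
        Pi.single_eq_same, if_true, Complex.normSq_add, coordForm]
      rw [Complex.real_smul, map_mul, map_mul, hc, Complex.normSq_ofReal, Complex.conj_ofReal,
        mul_left_comm, Complex.re_ofReal_mul]
      ring
    · simp [coordDir, hij]
  simp only [zNormSq, h, Finset.sum_add_distrib, Finset.sum_ite_eq', Finset.mem_univ, if_true]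
  ring

theorem hasLineDerivAt_zNormSq (j : Fin n) {c : ℂ} (hc : Complex.normSq c = 1) (p : Heis n) :
    HasLineDerivAt ℝ zNormSq (2 * coordForm j c p) p (coordDir j c) := by
  simp only [HasLineDerivAt, zNormSq_add_smul j hc]
  have h := (((hasDerivAt_id (0 : ℝ)).const_mul 2).mul_const (coordForm j c p)).const_add
    (zNormSq p) |>.add ((hasDerivAt_id (0 : ℝ)).pow 2)
  refine h.congr_deriv ?_
  simp

theorem hasLineDerivAt_coordForm (j : Fin n) {c : ℂ} (hc : Complex.normSq c = 1) (p : Heis n) :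
    HasLineDerivAt ℝ (coordForm j c) 1 p (coordDir j c) := by
  have h (τ : ℝ) : coordForm j c (p + τ • coordDir j c) = coordForm j c p + τ := by
    simp only [coordForm, coordDir, Prod.fst_add, Prod.smul_fst, Pi.add_apply, Pi.smul_apply,
        Pi.single_eq_same, add_mul, Complex.add_re]
    rw [Complex.real_smul, mul_assoc, Complex.mul_conj, hc]
    simp
  simp only [HasLineDerivAt, h]
  exact (hasDerivAt_id (0 : ℝ)).const_add _

/-- The profile of the derivative of `radialExp l Q` in `|z|²`. -/
def radialDeriv (l : ℝ) (Q : Polynomial ℝ) : Polynomial ℝ :=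
  Polynomial.C (|l| / 2) * (Polynomial.derivative Q - Polynomial.C (1 / 2) * Q)

/-- The chain rule through s = |z|²: differentiating e^{-|l|s/4} Q(|l|s/2) in s only changes the
polynomial, so the family `radialExp l` is stable under differentiation up to the factor 2 Re(z_j
c̄). -/
theorem hasLineDerivAt_radialExp (l : ℝ) (Q : Polynomial ℝ) (j : Fin n) {c : ℂ}
    (hc : Complex.normSq c = 1) (p : Heis n) :
    HasLineDerivAt ℝ (radialExp l Q)
      (radialExp l (radialDeriv l Q) p * (2 * coordForm j c p : ℝ)) p (coordDir j c) := by
  have h1 := hasLineDerivAt_zNormSq j hc p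
  unfold HasLineDerivAt at *
  have h2 (τ : ℝ) : radialExp l Q (p + τ • coordDir j c) =
      Complex.exp (Complex.I * ((l * p.2 : ℝ) : ℂ)) *
    ((Real.exp (-(|l| * zNormSq (p + τ • coordDir j c) / 4)) *
      Q.eval (|l| * zNormSq (p + τ • coordDir j c) / 2) : ℝ) : ℂ) := by
    simp [radialExp, coordDir]
  simp only [h2]
  have h3 := (((h1.const_mul |l|).div_const 4).neg.exp).mul
    ((Q.hasDerivAt _).comp _ ((h1.const_mul |l|).div_const 2))
  refine (h3.ofReal_comp.const_mul _).congr_deriv ?_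
  simp only [zero_smul, add_zero, radialExp, radialDeriv, Polynomial.eval_mul, Polynomial.eval_C,
    Polynomial.eval_sub, Function.comp_apply, Pi.neg_apply]
  push_cast
  ring

theorem hasLineDerivAt_radialExp_vert (l : ℝ) (Q : Polynomial ℝ) (p : Heis n) :
    HasLineDerivAt ℝ (radialExp l Q) (Complex.I * l * radialExp l Q p) p ((0, 1) : Heis n) := by
  unfold HasLineDerivAt
  have h2 (τ : ℝ) : radialExp l Q (p + τ • ((0, 1) : Heis n)) =
      Complex.exp (Complex.I * ((l * (p.2 + τ) : ℝ) : ℂ)) *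
    ((Real.exp (-(|l| * zNormSq p / 4)) * Q.eval (|l| * zNormSq p / 2) : ℝ) : ℂ) := by
    simp [radialExp, zNormSq]
  simp only [h2]
  have h1 := (((((hasDerivAt_id (0 : ℝ)).const_add p.2).const_mul l).ofReal_comp.const_mul
    Complex.I).cexp).mul_const
    ((Real.exp (-(|l| * zNormSq p / 4)) * Q.eval (|l| * zNormSq p / 2) : ℝ) : ℂ)
  refine h1.congr_deriv ?_
  simp only [radialExp, id, add_zero, mul_one]
  ring

/-- On ℂⁿ the Laplacian of g(|z|²) is 4s g'' + 4n g' with s = |z|², and ∂_t² acts as -l². In the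
variable x = |l|s/2 the identity is 2|l| times the Laguerre equation with parameter n - 1. -/
theorem radial_eigen (hn : 1 ≤ n) (l : ℝ) (k : ℕ) (p : Heis n) :
    4 * zNormSq p * radialExp l (radialDeriv l (radialDeriv l (laguerre (n - 1) k))) p +
      4 * n * radialExp l (radialDeriv l (laguerre (n - 1) k)) p -
      l ^ 2 * zNormSq p / 4 * radialExp l (laguerre (n - 1) k) p =
      -(|l| * (2 * k + n) : ℝ) * radialExp l (laguerre (n - 1) k) p := by
  have h := congrArg (Polynomial.eval (|l| * zNormSq p / 2)) (laguerre_ode (n - 1) k)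
  have hn' : ((n - 1 : ℕ) : ℝ) + 1 = n := by rw [Nat.cast_sub hn]; simp
  rw [hn'] at h
  simp only [Polynomial.eval_add, Polynomial.eval_mul, Polynomial.eval_sub, Polynomial.eval_C,
    Polynomial.eval_X, Polynomial.eval_zero] at h
  have key : 4 * zNormSq p *
      (radialDeriv l (radialDeriv l (laguerre (n - 1) k))).eval (|l| * zNormSq p / 2) +
      4 * n * (radialDeriv l (laguerre (n - 1) k)).eval (|l| * zNormSq p / 2) -
      l ^ 2 * zNormSq p / 4 * (laguerre (n - 1) k).eval (|l| * zNormSq p / 2) =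
      -(|l| * (2 * k + n)) * (laguerre (n - 1) k).eval (|l| * zNormSq p / 2) := by
    simp only [radialDeriv, Polynomial.eval_mul, Polynomial.eval_sub, Polynomial.eval_C,
      Polynomial.derivative_mul, Polynomial.derivative_C, Polynomial.derivative_sub, zero_mul,
      zero_add]
    rw [← sq_abs l]
    linear_combination (2 * |l|) * h
  have key' := congrArg (fun x : ℝ => Complex.exp (Complex.I * ((l * p.2 : ℝ) : ℂ)) *
    (Real.exp (-(|l| * zNormSq p / 4)) : ℝ) * (x : ℂ)) key
  simp only [radialExp]
  push_cast at key' ⊢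
  linear_combination key'

end Heisenberg

end

/-! ### Decay of the spherical pairings and absolute convergence -/

noncomputable section

section Decay

variable {n : ℕ}

instance isAddHaarMeasure_volume_heis : (volume : Measure (Heis n)).IsAddHaarMeasure :=
  Measure.prod.instIsAddHaarMeasure _ _

open LineDeriv in
/-- The operator `Δ_z + (|z|²/4) ∂_t²`, which agrees with the sub-Laplacian on functions that
are radial in `z`. -/
def radialSublaplacian (f : 𝓢(Heis n, ℂ)) : 𝓢(Heis n, ℂ) :=
  ∑ j : Fin n, (∂_{coordDir j 1} (∂_{coordDir j 1} f) +
    ∂_{coordDir j Complex.I} (∂_{coordDir j Complex.I} f)) +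
  SchwartzMap.smulLeftCLM ℂ (fun p : Heis n => ((zNormSq p / 4 : ℝ) : ℂ))
    (∂_{((0, 1) : Heis n)} (∂_{((0, 1) : Heis n)} f))

theorem integral_radialExp_mul_coord (l : ℝ) (Q : Polynomial ℝ) (j : Fin n) {c : ℂ}
    (hc : Complex.normSq c = 1) (f : 𝓢(Heis n, ℂ)) :
    ∫ p, radialExp l Q p * (LineDeriv.lineDerivOp (coordDir j c)
      (LineDeriv.lineDerivOp (coordDir j c) f)) p =
    ∫ p, (radialExp l (radialDeriv l (radialDeriv l Q)) p * (4 * coordForm j c p ^ 2 : ℝ) +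
      radialExp l (radialDeriv l Q) p * 2) * f p := by
  have hL : PolyGrowth fun p : Heis n => ((2 * coordForm j c p : ℝ) : ℂ) := by
    simp only [Complex.ofReal_mul]
    exact (PolyGrowth.const _).mul (polyGrowth_coordForm j c)
  have hL' : PolyGrowth fun p : Heis n => ((4 * coordForm j c p ^ 2 : ℝ) : ℂ) := by
    simp only [Complex.ofReal_mul, Complex.ofReal_pow]
    exact (PolyGrowth.const _).mul ((polyGrowth_coordForm j c).pow 2)
  refine PolyGrowth.integral_mul_lineDerivOp_lineDerivOp _ (polyGrowth_radialExp l Q)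
    ((polyGrowth_radialExp l (radialDeriv l Q)).mul hL)
    (((polyGrowth_radialExp l _).mul hL').add ((polyGrowth_radialExp l _).mul (.const 2)))
    (fun p => hasLineDerivAt_radialExp l Q j hc p) (fun p => ?_) f
  have h1 := hasLineDerivAt_radialExp l (radialDeriv l Q) j hc p
  have h2 := hasLineDerivAt_coordForm j hc p
  unfold HasLineDerivAt at *
  refine (h1.mul (h2.const_mul 2).ofReal_comp).congr_deriv ?_
  simp only [zero_smul, add_zero]
  push_cast
  ring

theorem integral_radialExp_mul_vert (l : ℝ) (Q : Polynomial ℝ) (f : 𝓢(Heis n, ℂ)) :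
    ∫ p, radialExp l Q p * (SchwartzMap.smulLeftCLM ℂ
      (fun p : Heis n => ((zNormSq p / 4 : ℝ) : ℂ)) (LineDeriv.lineDerivOp ((0, 1) : Heis n)
      (LineDeriv.lineDerivOp ((0, 1) : Heis n) f))) p =
    ∫ p, -(l ^ 2 * zNormSq p / 4 : ℝ) * radialExp l Q p * f p := by
  have hs : PolyGrowth fun p : Heis n => ((zNormSq p / 4 : ℝ) : ℂ) := by
    simp only [div_eq_mul_inv, Complex.ofReal_mul]
    exact polyGrowth_zNormSq.mul (.const _)
  have hφ : PolyGrowth fun p : Heis n => ((zNormSq p / 4 : ℝ) : ℂ) * radialExp l Q p :=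
    hs.mul (polyGrowth_radialExp l Q)
  have hd (p : Heis n) : HasLineDerivAt ℝ
      (fun p : Heis n => ((zNormSq p / 4 : ℝ) : ℂ) * radialExp l Q p)
      (Complex.I * l * (((zNormSq p / 4 : ℝ) : ℂ) * radialExp l Q p)) p ((0, 1) : Heis n) := by
    have h1 := hasLineDerivAt_radialExp_vert l Q p
    unfold HasLineDerivAt at *
    have h2 (τ : ℝ) : zNormSq (p + τ • ((0, 1) : Heis n)) = zNormSq p := by simp [zNormSq]
    simp only [h2]
    refine (h1.const_mul _).congr_deriv ?_
    ring
  have hφ' := (PolyGrowth.const (E := Heis n) (Complex.I * l)).mul hφ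
  have h := PolyGrowth.integral_mul_lineDerivOp_lineDerivOp (μ := volume) _ hφ hφ'
    ((PolyGrowth.const (Complex.I * l)).mul hφ') hd (fun p => by
      have := hd p
      unfold HasLineDerivAt at *
      exact this.const_mul _) f
  refine Eq.trans ?_ (h.trans ?_)
  · congr 1; ext p
    rw [SchwartzMap.smulLeftCLM_apply_apply hasTemperateGrowth_zNormSq, smul_eq_mul]
    ring
  · congr 1; ext p
    push_cast
    linear_combination (l ^ 2 * zNormSq p / 4 * radialExp l Q p * f p) * Complex.I_sq

/-- The operator is formally symmetric, since |z|²/4 does not depend on t. Integration by parts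
therefore moves it onto the radial function, where the eigenvalue equation applies. -/
theorem integral_radialExp_mul_sublaplacian (hn : 1 ≤ n) (l : ℝ) (k : ℕ) (f : 𝓢(Heis n, ℂ)) :
    ∫ p, radialExp l (laguerre (n - 1) k) p * radialSublaplacian f p =
      -(|l| * (2 * k + n) : ℝ) * ∫ p, radialExp l (laguerre (n - 1) k) p * f p := by
  set Q := laguerre (n - 1) k with hQ
  have hi (g : 𝓢(Heis n, ℂ)) : Integrable fun p => radialExp l Q p * g p :=
    (polyGrowth_radialExp l Q).integrable_mul_schwartz g
  have hL' (j : Fin n) (c : ℂ) : PolyGrowth fun p : Heis n =>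
      radialExp l (radialDeriv l (radialDeriv l Q)) p * (4 * coordForm j c p ^ 2 : ℝ) +
      radialExp l (radialDeriv l Q) p * 2 := by
    simp only [Complex.ofReal_mul, Complex.ofReal_pow]
    exact ((polyGrowth_radialExp l _).mul ((PolyGrowth.const _).mul
      ((polyGrowth_coordForm j c).pow 2))).add ((polyGrowth_radialExp l _).mul (.const 2))
  have hs : PolyGrowth fun p : Heis n => -((l ^ 2 * zNormSq p / 4 : ℝ) : ℂ) * radialExp l Q p := by
    have h := ((PolyGrowth.const (E := Heis n) (-(l : ℂ) ^ 2 / 4)).mul polyGrowth_zNormSq).mul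
      (polyGrowth_radialExp l Q)
    refine (funext fun p => ?_ : (fun p : Heis n => _) = _) ▸ h
    push_cast; ring
  have hi2 (g g' : 𝓢(Heis n, ℂ)) :
      Integrable fun p => radialExp l Q p * g p + radialExp l Q p * g' p := (hi g).add (hi g')
  have hL2 (j : Fin n) (c c' : ℂ) : Integrable fun p : Heis n =>
      (radialExp l (radialDeriv l (radialDeriv l Q)) p * (4 * coordForm j c p ^ 2 : ℝ) +
      radialExp l (radialDeriv l Q) p * 2) * f p +
      (radialExp l (radialDeriv l (radialDeriv l Q)) p * (4 * coordForm j c' p ^ 2 : ℝ) +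
      radialExp l (radialDeriv l Q) p * 2) * f p :=
    ((hL' _ _).integrable_mul_schwartz f).add ((hL' _ _).integrable_mul_schwartz f)
  have hexp (p : Heis n) : radialExp l Q p * radialSublaplacian f p =
      ∑ j : Fin n, (radialExp l Q p * (LineDeriv.lineDerivOp (coordDir j 1)
        (LineDeriv.lineDerivOp (coordDir j 1) f)) p +
      radialExp l Q p * (LineDeriv.lineDerivOp (coordDir j Complex.I)
        (LineDeriv.lineDerivOp (coordDir j Complex.I) f)) p) +
      radialExp l Q p * (SchwartzMap.smulLeftCLM ℂ
        (fun p : Heis n => ((zNormSq p / 4 : ℝ) : ℂ)) (LineDeriv.lineDerivOp ((0, 1) : Heis n)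
        (LineDeriv.lineDerivOp ((0, 1) : Heis n) f))) p := by
    simp only [radialSublaplacian, add_apply, sum_apply, mul_add, Finset.mul_sum]
  simp only [hexp]
  rw [integral_add (integrable_finsetSum _ fun j _ => hi2 _ _) (hi _),
    integral_finsetSum _ fun j _ => hi2 _ _, integral_radialExp_mul_vert]
  have h1 (j : Fin n) := integral_add (hi (LineDeriv.lineDerivOp (coordDir j 1)
    (LineDeriv.lineDerivOp (coordDir j 1) f))) (hi (LineDeriv.lineDerivOp (coordDir j Complex.I)
    (LineDeriv.lineDerivOp (coordDir j Complex.I) f)))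
  simp only [h1, integral_radialExp_mul_coord l Q _ (map_one Complex.normSq),
    integral_radialExp_mul_coord l Q _ Complex.normSq_I]
  simp only [← integral_add ((hL' _ _).integrable_mul_schwartz f)
    ((hL' _ _).integrable_mul_schwartz f)]
  rw [← integral_finsetSum _ fun j _ => hL2 _ _ _,
    ← integral_add (integrable_finsetSum _ fun j _ => hL2 _ _ _)
      (hs.integrable_mul_schwartz f), ← integral_const_mul]
  congr 1
  ext p
  -- Summing the squared linear forms over all coordinate directions restores the coefficient |z|²
  -- of the second radial derivative.
  have h2 : (zNormSq p : ℂ) = ∑ j, ((coordForm j 1 p : ℂ) ^ 2 + (coordForm j Complex.I p) ^ 2) := by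
    simp only [zNormSq, Complex.normSq_apply]
    push_cast
    refine Finset.sum_congr rfl fun j _ => ?_
    simp [coordForm]; ring
  have h3 := radial_eigen hn l k p
  rw [← hQ] at h3
  rw [← mul_assoc, ← h3]
  have h4 : ∀ j : Fin n, (radialExp l (radialDeriv l (radialDeriv l Q)) p *
      (4 * coordForm j 1 p ^ 2 : ℝ) + radialExp l (radialDeriv l Q) p * 2) * f p +
      (radialExp l (radialDeriv l (radialDeriv l Q)) p *
      (4 * coordForm j Complex.I p ^ 2 : ℝ) + radialExp l (radialDeriv l Q) p * 2) * f p =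
      (4 * radialExp l (radialDeriv l (radialDeriv l Q)) p * f p) *
        ((coordForm j 1 p : ℂ) ^ 2 + (coordForm j Complex.I p) ^ 2) +
      4 * radialExp l (radialDeriv l Q) p * f p := by
    intro j; push_cast; ring
  simp only [h4, Finset.sum_add_distrib, ← Finset.mul_sum, Finset.sum_const, Finset.card_univ,
    Fintype.card_fin, nsmul_eq_mul]
  rw [Finset.sum_add_distrib] at h2
  rw [← h2]
  push_cast
  ring

theorem sphericalFun_eq_radialExp (hn : 1 ≤ n) {l : ℝ} (hl : l ≠ 0) (k : ℕ) :
    (sphericalFun l k : Heis n → ℂ) = radialExp l (laguerre (n - 1) k) :=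
  funext fun p => sphericalFun_eq hn hl k p

theorem integrable_sphericalFun_mul (hn : 1 ≤ n) {l : ℝ} (hl : l ≠ 0) (k : ℕ)
    (f : 𝓢(Heis n, ℂ)) : Integrable fun p => sphericalFun l k p * f p := by
  rw [sphericalFun_eq_radialExp hn hl]
  exact (polyGrowth_radialExp l _).integrable_mul_schwartz f

/-- Subtracting the operator from the identity gives a multiplier that is at least 1 and can be
iterated without trouble at small |l|. -/
theorem sphericalPairing_sub_sublaplacian (hn : 1 ≤ n) {l : ℝ} (hl : l ≠ 0) (k : ℕ)
    (f : 𝓢(Heis n, ℂ)) : sphericalPairing l k (f - radialSublaplacian f) =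
      (1 + |l| * (2 * k + n) : ℝ) * sphericalPairing l k f := by
  have h := integral_radialExp_mul_sublaplacian hn l k f
  have hi := integrable_sphericalFun_mul hn hl k f
  have hi' := integrable_sphericalFun_mul hn hl k (radialSublaplacian f)
  unfold sphericalPairing
  rw [← sphericalFun_eq_radialExp hn hl] at h
  simp only [sub_apply, mul_sub]
  rw [integral_sub hi hi', h]
  push_cast
  ring

theorem norm_sphericalPairing_le (hn : 1 ≤ n) {l : ℝ} (hl : l ≠ 0) (k : ℕ) (f : 𝓢(Heis n, ℂ)) :
    ‖sphericalPairing l k f‖ ≤ (2 * k + n : ℝ) ^ (n - 1) * ∫ p, ‖f p‖ := by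
  rw [← integral_const_mul]
  refine norm_integral_le_of_norm_le (f.integrable.norm.const_mul _)
    (Filter.Eventually.of_forall fun p => ?_)
  rw [norm_mul]
  gcongr
  exact norm_sphericalFun_le hn hl k p

theorem exists_norm_sphericalPairing_le (hn : 1 ≤ n) (f : 𝓢(Heis n, ℂ)) (N : ℕ) :
    ∃ C, 0 ≤ C ∧ ∀ (k : ℕ) (l : ℝ), l ≠ 0 → (1 + |l| * (2 * k + n)) ^ N *
      ‖sphericalPairing l k f‖ ≤ C * (2 * k + n : ℝ) ^ (n - 1) := by
  induction N generalizing f with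
  | zero =>
    refine ⟨∫ p, ‖f p‖, by positivity, fun k l hl => ?_⟩
    rw [pow_zero, one_mul, mul_comm]
    exact norm_sphericalPairing_le hn hl k f
  | succ N ih =>
    obtain ⟨C, hC, h⟩ := ih (f - radialSublaplacian f)
    refine ⟨C, hC, fun k l hl => ?_⟩
    have := h k l hl
    rw [sphericalPairing_sub_sublaplacian hn hl, norm_mul, Complex.norm_real, Real.norm_eq_abs,
      abs_of_nonneg (by positivity : 0 ≤ 1 + |l| * (2 * (k : ℝ) + n)), ← mul_assoc,
      ← pow_succ] at this
    exact this

theorem exists_norm_phiIntegrand_le (hn : 1 ≤ n) (α : ℝ) (f : 𝓢(Heis n, ℂ)) :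
    ∃ C, 0 ≤ C ∧ ∀ (k : ℕ) (l : ℝ), ‖phiIntegrand α k f l‖ ≤
      C / |2 * k + n - α| * (1 + ((2 * k + n : ℝ) * l) ^ 2)⁻¹ := by
  -- Of the n + 1 powers, n - 1 absorb (|l|(2k+n))^{n-1} and the other two give integrability in l.
  -- The remaining |l| of |l|ⁿ cancels the singular 1/|l|.
  obtain ⟨C, hC, h⟩ := exists_norm_sphericalPairing_le hn f (n + 1)
  refine ⟨C, hC, fun k l => ?_⟩
  -- At l = 0 the integrand is 0 by the convention for division by zero.
  rcases eq_or_ne l 0 with rfl | hl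
  · simp only [phiIntegrand, abs_zero, neg_zero, zero_mul, div_zero, Complex.ofReal_zero, norm_zero]
    positivity
  have hl' : 0 < |l| := abs_pos.2 hl
  have hm : (0 : ℝ) < 2 * k + n := by
    have : (1 : ℝ) ≤ n := by exact_mod_cast hn
    positivity
  have h1 := h k l hl
  rw [phiIntegrand, norm_mul, norm_mul, Complex.norm_real, Complex.norm_real, Real.norm_eq_abs,
    Real.norm_eq_abs, abs_div, abs_mul, abs_neg, abs_abs, abs_one, abs_pow, abs_abs]
  clear h
  generalize (2 * (k : ℝ) + n) = m at *
  have hx : 0 < 1 + |l| * m := by positivity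
  obtain ⟨a, rfl⟩ : ∃ a, n = a + 1 := ⟨n - 1, by omega⟩
  rw [Nat.add_sub_cancel] at h1
  have h2 : ‖sphericalPairing l k f‖ ≤ C * m ^ a / (1 + |l| * m) ^ (a + 2) := by
    rw [le_div_iff₀ (by positivity), mul_comm]; exact h1
  have h3 : (|l| * m) ^ a / (1 + |l| * m) ^ (a + 2) ≤ (1 + (m * l) ^ 2)⁻¹ := by
    rw [inv_eq_one_div, div_le_div_iff₀ (by positivity) (by positivity), one_mul, pow_add]
    have e1 : (|l| * m) ^ a ≤ (1 + |l| * m) ^ a := by gcongr; linarith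
    have e2 : 1 + (m * l) ^ 2 ≤ (1 + |l| * m) ^ 2 := by
      have : (m * l) ^ 2 = (|l| * m) ^ 2 := by rw [mul_pow, mul_pow, sq_abs]; ring
      rw [this]; nlinarith [mul_pos hl' hm]
    exact mul_le_mul e1 e2 (by positivity) (by positivity)
  calc 1 / (|l| * |m - α|) * ‖sphericalPairing l k f‖ * |l| ^ (a + 1)
      ≤ 1 / (|l| * |m - α|) * (C * m ^ a / (1 + |l| * m) ^ (a + 2)) * |l| ^ (a + 1) := by gcongr
    _ = C / |m - α| * ((|l| * m) ^ a / (1 + |l| * m) ^ (a + 2)) := by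
        rw [mul_pow]
        field_simp
        ring
    _ ≤ _ := by gcongr

theorem aestronglyMeasurable_phiIntegrand (hn : 1 ≤ n) (α : ℝ) (k : ℕ) (f : 𝓢(Heis n, ℂ)) :
    AEStronglyMeasurable (phiIntegrand α k f) := by
  have h1 : AEStronglyMeasurable (fun l : ℝ => sphericalPairing l k f) := by
    have h2 : Continuous fun q : ℝ × Heis n =>
        radialExp q.1 (laguerre (n - 1) k) q.2 * f q.2 := by
      have := continuous_zNormSq (n := n)
      have := f.continuous
      have := (laguerre (n - 1) k).continuous
      unfold radialExp
      fun_prop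
    have h3 : StronglyMeasurable fun l : ℝ => ∫ p, radialExp l (laguerre (n - 1) k) p * f p :=
      h2.stronglyMeasurable.integral_prod_right
    refine h3.aestronglyMeasurable.congr ?_
    filter_upwards [compl_mem_ae_iff.2 (measure_singleton (0 : ℝ))] with l hl
    have hl : l ≠ 0 := hl
    rw [sphericalPairing, sphericalFun_eq_radialExp hn hl]
  unfold phiIntegrand
  refine (AEStronglyMeasurable.mul ?_ h1).mul ?_
  · exact (Complex.measurable_ofReal.comp (by fun_prop)).aestronglyMeasurable
  · exact (by fun_prop : Continuous fun l : ℝ => ((|l| ^ n : ℝ) : ℂ)).aestronglyMeasurable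

theorem integrable_phiIntegrand (hn : 1 ≤ n) (α : ℝ) (k : ℕ) (f : 𝓢(Heis n, ℂ)) :
    Integrable (phiIntegrand α k f) := by
  obtain ⟨C, -, h⟩ := exists_norm_phiIntegrand_le hn α f
  have hm : (2 * k + n : ℝ) ≠ 0 := by
    have : (1 : ℝ) ≤ n := by exact_mod_cast hn
    positivity
  exact ((integrable_inv_one_add_sq.comp_mul_left' hm).const_mul _).mono'
    (aestronglyMeasurable_phiIntegrand hn α k f) (Filter.Eventually.of_forall fun l => h k l)

/-- Rescaling l turns the bound into Cπ/(|2k+n-α|(2k+n)). It is compared with 1/k² only for k ≥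
max(α, 1), where |2k+n-α| ≥ k. -/
theorem summable_integral_norm_phiIntegrand (hn : 1 ≤ n) (α : ℝ) (f : 𝓢(Heis n, ℂ)) :
    Summable fun k : ℕ => ∫ l : ℝ, ‖phiIntegrand α k f l‖ := by
  obtain ⟨C, hC, h⟩ := exists_norm_phiIntegrand_le hn α f
  have h1 : Summable fun k : ℕ => C * Real.pi * (1 / (k : ℝ) ^ 2) :=
    (Real.summable_one_div_nat_pow.2 (by norm_num)).mul_left _
  refine Summable.of_norm_bounded_eventually_nat h1 ?_
  obtain ⟨K, hK⟩ := exists_nat_ge α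
  filter_upwards [Filter.eventually_ge_atTop (max K 1)] with k hk
  have hk1 : (1 : ℝ) ≤ k := by exact_mod_cast (le_max_right _ _).trans hk
  have hk2 : α ≤ k := hK.trans (by exact_mod_cast (le_max_left _ _).trans hk)
  have hn1 : (1 : ℝ) ≤ n := by exact_mod_cast hn
  have hm : (0 : ℝ) < 2 * k + n := by positivity
  rw [Real.norm_of_nonneg (by positivity)]
  calc ∫ l : ℝ, ‖phiIntegrand α k f l‖
      ≤ ∫ l : ℝ, C / |2 * k + n - α| * (1 + ((2 * k + n : ℝ) * l) ^ 2)⁻¹ :=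
        integral_mono (integrable_phiIntegrand hn α k f).norm
          ((integrable_inv_one_add_sq.comp_mul_left' hm.ne').const_mul _) (fun l => h k l)
    _ = C * Real.pi * (1 / (|2 * k + n - α| * (2 * k + n))) := by
        rw [integral_const_mul, Measure.integral_comp_mul_left (fun x : ℝ => (1 + x ^ 2)⁻¹),
          integral_univ_inv_one_add_sq, abs_of_pos (inv_pos.2 hm), smul_eq_mul]
        field_simp
    _ ≤ C * Real.pi * (1 / (k : ℝ) ^ 2) := by
        have h2 : (k : ℝ) ≤ |2 * k + n - α| := (by linarith : (k : ℝ) ≤ 2 * k + n - α).trans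
          (le_abs_self _)
        have h3 : (k : ℝ) ≤ 2 * k + n := by linarith
        rw [sq]
        gcongr

end Decay

end

/-! ### Continuation of the hypergeometric series and its growth at 1 -/

noncomputable section

/-- The domain `ℂ ∖ [1, ∞)`. -/
def hypDomain : Set ℂ := {ζ : ℂ | 1 - ζ ∈ Complex.slitPlane}

theorem isOpen_hypDomain : IsOpen hypDomain :=
  Complex.isOpen_slitPlane.preimage (by fun_prop)

theorem mem_hypDomain_of_norm_lt_one {ζ : ℂ} (h : ‖ζ‖ < 1) : ζ ∈ hypDomain := by
  have := Complex.mem_slitPlane_of_norm_lt_one (z := -ζ) (by simpa using h)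
  simpa [hypDomain, sub_eq_add_neg] using this

theorem isPreconnected_hypDomain : IsPreconnected hypDomain := by
  have h : hypDomain = (fun ζ : ℂ => 1 - ζ) '' Complex.slitPlane := by
    ext ζ
    refine ⟨fun h => ⟨1 - ζ, h, by simp⟩, ?_⟩
    rintro ⟨w, hw, rfl⟩
    simpa [hypDomain] using hw
  rw [h]
  exact ((Complex.starConvex_one_slitPlane.isPathConnected
    Complex.one_mem_slitPlane).isConnected.isPreconnected).image _ (by fun_prop)

/-- The point 1 - uζ lies on the segment from 1 to 1 - ζ, and the slit plane is star-shaped about 1.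
-/
theorem one_sub_mul_ne_zero {ζ : ℂ} (hζ : ζ ∈ hypDomain) {u : ℝ} (hu : u ∈ Set.Icc (0 : ℝ) 1) :
    1 - u * ζ ≠ 0 := by
  have h := Complex.starConvex_one_slitPlane.add_smul_mem (x := 1) (y := -ζ)
    (by simpa [hypDomain, sub_eq_add_neg] using hζ) hu.1 hu.2
  have := Complex.slitPlane_ne_zero h
  simpa [sub_eq_add_neg] using this

/-- The integral `∫₀¹ u^(b-1) / (1 - uζ) du`. -/
def lerchIntegral (b : ℝ) (ζ : ℂ) : ℂ :=
  ∫ u in (0 : ℝ)..1, ((u ^ (b - 1) : ℝ) : ℂ) / (1 - u * ζ)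

theorem continuous_rpow_sub_one {b : ℝ} (hb : 1 ≤ b) :
    Continuous fun u : ℝ => ((u ^ (b - 1) : ℝ) : ℂ) :=
  Complex.continuous_ofReal.comp (Real.continuous_rpow_const (by linarith))

theorem continuousOn_lerchIntegrand {b : ℝ} (hb : 1 ≤ b) {ζ : ℂ} (hζ : ζ ∈ hypDomain) (m : ℕ) :
    ContinuousOn (fun u : ℝ => ((u ^ (b - 1) : ℝ) : ℂ) / (1 - u * ζ) ^ m) (Set.Icc 0 1) :=
  (continuous_rpow_sub_one hb).continuousOn.div (by fun_prop)
    fun _ hu => pow_ne_zero _ (one_sub_mul_ne_zero hζ hu)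

/-- For b ≥ 1 the factor u^{b-1} is continuous on [0,1], so compactness bounds the ζ-derivative of
the integrand and allows differentiation under the integral. -/
theorem differentiableOn_lerchIntegral {b : ℝ} (hb : 1 ≤ b) :
    DifferentiableOn ℂ (lerchIntegral b) hypDomain := by
  intro ζ₀ hζ₀
  obtain ⟨ε, hε, hball⟩ := Metric.nhds_basis_closedBall.mem_iff.1 (isOpen_hypDomain.mem_nhds hζ₀)
  have hK : IsCompact (Set.Icc (0 : ℝ) 1 ×ˢ Metric.closedBall ζ₀ ε) :=
    isCompact_Icc.prod (isCompact_closedBall _ _)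
  obtain ⟨C, hC⟩ := hK.exists_bound_of_continuousOn (f := fun q : ℝ × ℂ =>
    ((q.1 ^ (b - 1) : ℝ) : ℂ) * q.1 / (1 - q.1 * q.2) ^ 2) (by
      refine ContinuousOn.div ?_ (by fun_prop) fun q hq =>
        pow_ne_zero _ (one_sub_mul_ne_zero (hball hq.2) hq.1)
      have := (continuous_rpow_sub_one hb).comp (continuous_fst (X := ℝ) (Y := ℂ))
      exact (this.mul (by fun_prop)).continuousOn)
  have hsub : Set.uIoc (0 : ℝ) 1 ⊆ Set.Icc 0 1 := by
    rw [Set.uIoc_of_le zero_le_one]; exact Set.Ioc_subset_Icc_self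
  have hmeas (ζ : ℂ) (hζ : ζ ∈ hypDomain) : AEStronglyMeasurable
      (fun u : ℝ => ((u ^ (b - 1) : ℝ) : ℂ) / (1 - u * ζ))
      (volume.restrict (Set.uIoc 0 1)) := by
    have := (continuousOn_lerchIntegrand hb hζ 1).mono hsub
    simp only [pow_one] at this
    exact this.aestronglyMeasurable measurableSet_uIoc
  have h := intervalIntegral.hasDerivAt_integral_of_dominated_loc_of_deriv_le
    (F := fun (ζ : ℂ) (u : ℝ) => ((u ^ (b - 1) : ℝ) : ℂ) / (1 - u * ζ))
    (F' := fun (ζ : ℂ) (u : ℝ) => ((u ^ (b - 1) : ℝ) : ℂ) * u / (1 - u * ζ) ^ 2)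
    (μ := volume) (a := 0) (b := 1) (x₀ := ζ₀) (bound := fun _ => C)
    (Metric.closedBall_mem_nhds ζ₀ hε)
    ((isOpen_hypDomain.mem_nhds hζ₀ |> Filter.Eventually.mono) fun ζ hζ => hmeas ζ hζ)
    (by
      refine ContinuousOn.intervalIntegrable ?_
      rw [Set.uIcc_of_le zero_le_one]
      simpa using continuousOn_lerchIntegrand hb hζ₀ 1)
    (by
      refine ContinuousOn.aestronglyMeasurable ?_ measurableSet_uIoc
      exact (((continuous_rpow_sub_one hb).mul Complex.continuous_ofReal).continuousOn.div
        (by fun_prop) fun _ hu => pow_ne_zero _ (one_sub_mul_ne_zero hζ₀ hu)).mono hsub)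
    (Filter.Eventually.of_forall fun u hu ζ hζ => hC (u, ζ) ⟨hsub hu, hζ⟩)
    intervalIntegrable_const
    (Filter.Eventually.of_forall fun u hu ζ hζ => by
      have hne := one_sub_mul_ne_zero (hball hζ) (hsub hu)
      have h1 : HasDerivAt (fun ζ : ℂ => 1 - (u : ℂ) * ζ) (-u) ζ := by
        simpa using ((hasDerivAt_id ζ).const_mul (u : ℂ)).const_sub 1
      refine ((hasDerivAt_const ζ _).div h1 hne).congr_deriv ?_
      ring)
  exact h.2.differentiableAt.differentiableWithinAt

theorem hasSum_lerchIntegral {b : ℝ} (hb : 1 ≤ b) {ζ : ℂ} (hζ : ‖ζ‖ < 1) :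
    HasSum (fun k : ℕ => ζ ^ k / (b + k)) (lerchIntegral b ζ) := by
  have hr (u : ℝ) (hu : u ∈ Set.uIoc (0 : ℝ) 1) : 0 < u ∧ u ≤ 1 := by
    rwa [Set.uIoc_of_le zero_le_one] at hu
  have hle (u : ℝ) (hu : u ∈ Set.uIoc (0 : ℝ) 1) : ‖(u : ℂ) * ζ‖ ≤ ‖ζ‖ := by
    rw [norm_mul, Complex.norm_real, Real.norm_of_nonneg (hr u hu).1.le]
    exact mul_le_of_le_one_left (norm_nonneg _) (hr u hu).2
  have h := intervalIntegral.hasSum_integral_of_dominated_convergence (μ := volume)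
    (a := 0) (b := 1)
    (F := fun (k : ℕ) (u : ℝ) => ((u ^ (b - 1) : ℝ) : ℂ) * (u * ζ) ^ k)
    (f := fun u : ℝ => ((u ^ (b - 1) : ℝ) : ℂ) / (1 - u * ζ)) (fun k _ => ‖ζ‖ ^ k)
    (fun k => (by
      have := continuous_rpow_sub_one hb
      fun_prop : Continuous _).aestronglyMeasurable)
    (fun k => Filter.Eventually.of_forall fun u hu => by
      rw [norm_mul, norm_pow, Complex.norm_real, Real.norm_of_nonneg (by
        have := (hr u hu).1.le; positivity)]
      calc _ ≤ 1 * ‖ζ‖ ^ k := mul_le_mul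
            (Real.rpow_le_one (hr u hu).1.le (hr u hu).2 (by linarith))
            (pow_le_pow_left₀ (norm_nonneg _) (hle u hu) k) (by positivity) zero_le_one
        _ = _ := one_mul _)
    (Filter.Eventually.of_forall fun u _ => summable_geometric_of_lt_one (norm_nonneg _) hζ)
    intervalIntegrable_const
    (Filter.Eventually.of_forall fun u hu => by
      rw [div_eq_mul_inv]
      exact (hasSum_geometric_of_norm_lt_one ((hle u hu).trans_lt hζ)).mul_left _)
  refine (funext fun k => ?_ : (fun k : ℕ => _) = _) ▸ h
  have hbk : 0 < b + k := by positivity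
  have h1 : ∫ u in (0 : ℝ)..1, ((u ^ (b - 1) : ℝ) : ℂ) * (u * ζ) ^ k =
      ∫ u in (0 : ℝ)..1, ((u ^ (b - 1 + k) : ℝ) : ℂ) * ζ ^ k := by
    refine intervalIntegral.integral_congr_ae (Filter.Eventually.of_forall fun u hu => ?_)
    rw [Real.rpow_add_natCast (hr u hu).1.ne']
    push_cast
    ring
  rw [h1, intervalIntegral.integral_mul_const, intervalIntegral.integral_ofReal,
    integral_rpow (Or.inl (by have : (0 : ℝ) ≤ k := by positivity
                              linarith))]
  rw [show b - 1 + k + 1 = b + k by ring, Real.one_rpow, Real.zero_rpow hbk.ne']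
  push_cast
  ring

/-- Both |1-uζ| ≥ 1-u and |1-uζ| ≥ |1-ζ|/2 hold in the unit disc. Their geometric mean bounds the
integrand, after multiplication by √|1-ζ|, by 2(1-u)^{-1/2}, whose integral is 4. -/
theorem norm_lerchIntegral_le {b : ℝ} (hb : 1 ≤ b) {ζ : ℂ} (hζ : ‖ζ‖ ≤ 1) :
    ‖lerchIntegral b ζ‖ * Real.sqrt ‖1 - ζ‖ ≤ 4 := by
  have hint : IntervalIntegrable (fun u : ℝ => 2 * (1 - u) ^ (-(1 / 2) : ℝ)) volume 0 1 := by
    have := (intervalIntegral.intervalIntegrable_rpow' (a := 1) (b := 0) (r := -(1 / 2))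
      (by norm_num)).comp_sub_left 1
    simpa using this.const_mul 2
  have hval : ∫ u in (0 : ℝ)..1, 2 * (1 - u) ^ (-(1 / 2) : ℝ) = 4 := by
    rw [intervalIntegral.integral_const_mul,
      intervalIntegral.integral_comp_sub_left (fun v : ℝ => v ^ (-(1 / 2) : ℝ)),
      integral_rpow (Or.inl (by norm_num))]
    norm_num
  calc ‖lerchIntegral b ζ‖ * Real.sqrt ‖1 - ζ‖
      = ‖∫ u in (0 : ℝ)..1, ((u ^ (b - 1) : ℝ) : ℂ) / (1 - u * ζ) *
          (Real.sqrt ‖1 - ζ‖ : ℝ)‖ := by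
        rw [intervalIntegral.integral_mul_const, norm_mul, Complex.norm_real,
          Real.norm_of_nonneg (Real.sqrt_nonneg _)]
        rfl
    _ ≤ ∫ u in (0 : ℝ)..1, 2 * (1 - u) ^ (-(1 / 2) : ℝ) := by
        refine intervalIntegral.norm_integral_le_of_norm_le zero_le_one ?_ hint
        filter_upwards [compl_mem_ae_iff.2 (measure_singleton (1 : ℝ))] with u hu1 hu
        have hx : 0 < 1 - u := sub_pos.2 (lt_of_le_of_ne hu.2 hu1)
        have hD1 : 1 - u ≤ ‖1 - u * ζ‖ := by
          have h1 : ‖(u : ℂ) * ζ‖ ≤ u := by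
            rw [norm_mul, Complex.norm_real, Real.norm_of_nonneg hu.1.le]
            exact mul_le_of_le_one_right hu.1.le hζ
          have h2 := norm_sub_norm_le (1 : ℂ) (u * ζ)
          rw [norm_one] at h2
          linarith
        have hD2 : ‖1 - ζ‖ ≤ 2 * ‖1 - u * ζ‖ := by
          have h1 : 1 - ζ = (1 - u * ζ) - ((1 - u : ℝ) : ℂ) * ζ := by push_cast; ring
          have h2 : ‖((1 - u : ℝ) : ℂ) * ζ‖ ≤ 1 - u := by
            rw [norm_mul, Complex.norm_real, Real.norm_of_nonneg hx.le]
            exact mul_le_of_le_one_right hx.le hζ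
          have h3 := norm_sub_le (1 - u * ζ) (((1 - u : ℝ) : ℂ) * ζ)
          rw [← h1] at h3
          linarith
        have hD : 0 < ‖1 - u * ζ‖ := hx.trans_le hD1
        have hsq : Real.sqrt ‖1 - ζ‖ * Real.sqrt (1 - u) ≤ 2 * ‖1 - u * ζ‖ := by
          rw [← Real.sqrt_mul (norm_nonneg _)]
          refine Real.sqrt_le_iff.2 ⟨by positivity, ?_⟩
          nlinarith [mul_le_mul hD2 hD1 hx.le (by positivity)]
        have hs : 0 < Real.sqrt (1 - u) := Real.sqrt_pos.2 hx
        rw [Real.rpow_neg hx.le, ← Real.sqrt_eq_rpow, norm_mul, norm_div, Complex.norm_real,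
          Complex.norm_real, Real.norm_of_nonneg (Real.sqrt_nonneg _),
          Real.norm_of_nonneg (Real.rpow_nonneg hu.1.le _)]
        have hp : u ^ (b - 1) ≤ 1 := Real.rpow_le_one hu.1.le hu.2 (by linarith)
        calc u ^ (b - 1) / ‖1 - u * ζ‖ * Real.sqrt ‖1 - ζ‖
            ≤ 1 / ‖1 - u * ζ‖ * Real.sqrt ‖1 - ζ‖ := by gcongr
          _ ≤ 2 * (Real.sqrt (1 - u))⁻¹ := by
            rw [← div_eq_mul_inv, one_div_mul_eq_div, div_le_div_iff₀ hD hs]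
            exact hsq
    _ = 4 := hval

/-- `F` is an analytic function on `ℂ ∖ [1, ∞)` with power series
`∑ C(a + k, a) ζ^k / (b + k)`, growing at most like `|1 - ζ|^(-a - 1/2)` at `1`. -/
def IsHypPrimitive (a : ℕ) (b : ℝ) (F : ℂ → ℂ) : Prop :=
  DifferentiableOn ℂ F hypDomain ∧
  (∀ ζ : ℂ, ‖ζ‖ < 1 →
    HasSum (fun k : ℕ => ((k + a).choose a : ℂ) * (ζ ^ k / (b + k))) (F ζ)) ∧
  ∃ C : ℝ, 0 ≤ C ∧ ∀ ζ : ℂ, ‖ζ‖ ≤ 1 → ζ ≠ 1 → ‖F ζ‖ * ‖1 - ζ‖ ^ a * Real.sqrt ‖1 - ζ‖ ≤ C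

theorem isHypPrimitive_lerchIntegral {b : ℝ} (hb : 1 ≤ b) :
    IsHypPrimitive 0 b (lerchIntegral b) :=
  ⟨differentiableOn_lerchIntegral hb, fun ζ hζ => by simpa using hasSum_lerchIntegral hb hζ,
    4, by norm_num, fun ζ hζ _ => by simpa using norm_lerchIntegral_le hb hζ⟩

theorem norm_one_sub_le_two {ζ : ℂ} (hζ : ‖ζ‖ ≤ 1) : ‖1 - ζ‖ ≤ 2 := by
  have := norm_sub_le 1 ζ
  rw [norm_one] at this
  linarith

theorem sqrt_norm_one_sub_le_two {ζ : ℂ} (hζ : ‖ζ‖ ≤ 1) : Real.sqrt ‖1 - ζ‖ ≤ 2 :=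
  Real.sqrt_le_iff.2 ⟨by norm_num, (norm_one_sub_le_two hζ).trans (by norm_num)⟩

/-- Splitting off the term k = 0 leaves ζ times the series with b + 1. This carries the construction
below b = 1, where the integral is not used. -/
theorem IsHypPrimitive.shift {b : ℝ} {F : ℂ → ℂ} (h : IsHypPrimitive 0 (b + 1) F) :
    IsHypPrimitive 0 b fun ζ => 1 / b + ζ * F ζ := by
  obtain ⟨h1, h2, C, hC, h3⟩ := h
  refine ⟨(differentiableOn_const _).add (differentiableOn_id.mul h1), fun ζ hζ => ?_,
    ‖(1 / b : ℂ)‖ * 2 + C, by positivity, fun ζ hζ hne => ?_⟩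
  · have h4 := ((h2 ζ hζ).mul_left ζ)
    refine (hasSum_nat_add_iff' 1).1 ?_
    simp only [add_zero, Nat.choose_zero_right, Nat.cast_one, one_mul, Finset.range_one,
      Finset.sum_singleton, pow_zero, Nat.cast_zero] at h4 ⊢
    rw [add_sub_cancel_left]
    refine (funext fun k => ?_ : (fun k : ℕ => _) = _) ▸ h4
    push_cast
    rw [add_right_comm, add_assoc (b : ℂ) k 1]
    ring
  · have h4 := h3 ζ hζ hne
    rw [pow_zero, mul_one] at h4 ⊢
    calc ‖(1 / b : ℂ) + ζ * F ζ‖ * Real.sqrt ‖1 - ζ‖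
        ≤ (‖(1 / b : ℂ)‖ + 1 * ‖F ζ‖) * Real.sqrt ‖1 - ζ‖ := by
          gcongr
          refine (norm_add_le _ _).trans ?_
          rw [norm_mul]
          gcongr
      _ = ‖(1 / b : ℂ)‖ * Real.sqrt ‖1 - ζ‖ + ‖F ζ‖ * Real.sqrt ‖1 - ζ‖ := by ring
      _ ≤ _ := add_le_add (mul_le_mul_of_nonneg_left (sqrt_norm_one_sub_le_two hζ)
          (norm_nonneg _)) h4

/-- Since (a+1) C(k+a+1,a+1) = (k+a+1) C(k+a,a) and (k+a+1)/(b+k) = 1 + (a+1-b)/(b+k), the new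
series is a combination of the binomial series (1-ζ)^{-a-1} and the old one. -/
theorem IsHypPrimitive.succ {a : ℕ} {b : ℝ} (hb : ∀ k : ℕ, b + k ≠ 0) {F : ℂ → ℂ}
    (h : IsHypPrimitive a b F) :
    IsHypPrimitive (a + 1) b fun ζ =>
      (((1 - ζ) ^ (a + 1))⁻¹ + (a + 1 - b) * F ζ) / (a + 1) := by
  obtain ⟨h1, h2, C, hC, h3⟩ := h
  have ha : (a : ℂ) + 1 ≠ 0 := by exact_mod_cast a.succ_ne_zero
  have hne0 {ζ : ℂ} (hζ : ζ ∈ hypDomain) : 1 - ζ ≠ 0 := Complex.slitPlane_ne_zero hζ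
  refine ⟨?_, fun ζ hζ => ?_, (2 + ‖(a + 1 - b : ℂ)‖ * (2 * C)) / ‖(a + 1 : ℂ)‖, by positivity,
    fun ζ hζ hne => ?_⟩
  · refine DifferentiableOn.div_const (DifferentiableOn.add (DifferentiableOn.inv (by fun_prop)
      fun ζ hζ => pow_ne_zero _ (hne0 hζ)) (h1.const_mul _)) _
  · have h4 := hasSum_choose_mul_geometric_of_norm_lt_one a hζ
    have h5 := (h4.add ((h2 ζ hζ).mul_left (a + 1 - b : ℂ))).div_const (a + 1 : ℂ)
    rw [one_div] at h5
    refine (funext fun k => ?_ : (fun k : ℕ => _) = _) ▸ h5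
    have hbk : (b : ℂ) + k ≠ 0 := by exact_mod_cast hb k
    have h6 := Nat.add_one_mul_choose_eq (k + a) a
    have h7 : ((k : ℂ) + a + 1) * (k + a).choose a = (k + (a + 1)).choose (a + 1) * (a + 1) := by
      exact_mod_cast h6
    field_simp
    linear_combination (-ζ ^ k) * h7
  · have hpos : 0 < ‖1 - ζ‖ := norm_pos_iff.2 (sub_ne_zero.2 (Ne.symm hne))
    have h4 := h3 ζ hζ hne
    rw [norm_div, div_mul_eq_mul_div, div_mul_eq_mul_div]
    gcongr
    calc ‖((1 - ζ) ^ (a + 1))⁻¹ + (a + 1 - b : ℂ) * F ζ‖ * ‖1 - ζ‖ ^ (a + 1) *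
          Real.sqrt ‖1 - ζ‖
        ≤ ((‖1 - ζ‖ ^ (a + 1))⁻¹ + ‖(a + 1 - b : ℂ)‖ * ‖F ζ‖) * ‖1 - ζ‖ ^ (a + 1) *
          Real.sqrt ‖1 - ζ‖ := by
          gcongr
          refine (norm_add_le _ _).trans_eq ?_
          rw [norm_mul, norm_inv, norm_pow]
      _ = Real.sqrt ‖1 - ζ‖ + ‖(a + 1 - b : ℂ)‖ *
          (‖1 - ζ‖ * (‖F ζ‖ * ‖1 - ζ‖ ^ a * Real.sqrt ‖1 - ζ‖)) := by
          rw [pow_succ]; field_simp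
      _ ≤ _ := by
          gcongr
          · exact sqrt_norm_one_sub_le_two hζ
          · exact norm_one_sub_le_two hζ

theorem exists_isHypPrimitive (a : ℕ) {b : ℝ} (hb : ∀ k : ℕ, b + k ≠ 0) :
    ∃ F, IsHypPrimitive a b F := by
  induction a with
  | zero =>
    -- The integral exists at b + M ≥ 1; M downward shifts then reach b.
    obtain ⟨M, hM⟩ : ∃ M : ℕ, 1 ≤ b + M :=
      (exists_nat_ge (1 - b)).imp fun M hM => by linarith
    clear hb
    induction M generalizing b with
    | zero => exact ⟨_, isHypPrimitive_lerchIntegral (by simpa using hM)⟩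
    | succ M ih =>
      obtain ⟨F, hF⟩ := ih (b := b + 1) (by push_cast at hM; linarith)
      exact ⟨_, hF.shift⟩
  | succ a ih =>
    obtain ⟨F, hF⟩ := ih
    exact ⟨_, hF.succ hb⟩

theorem eval_ascPochhammer_ne_zero {b : ℝ} (hb : ∀ k : ℕ, b + k ≠ 0) (k : ℕ) :
    (ascPochhammer ℂ k).eval (b : ℂ) ≠ 0 := by
  induction k with
  | zero => simp
  | succ k ih =>
    rw [ascPochhammer_succ_eval]
    exact mul_ne_zero ih (by exact_mod_cast hb k)

/-- The quotient (b)_k/(b+1)_k telescopes to b/(b+k), and (a+1)_k/k! = C(k+a,a). -/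
theorem ordinaryHypergeometricCoefficient_eq (a : ℕ) {b : ℝ} (hb : ∀ k : ℕ, b + k ≠ 0) (k : ℕ) :
    ordinaryHypergeometricCoefficient ((a + 1 : ℕ) : ℂ) (b : ℂ) (b + 1 : ℂ) k =
      ((k + a).choose a : ℂ) * (b / (b + k)) := by
  have hb' : ∀ k : ℕ, (b + 1) + k ≠ 0 := fun k => by
    have := hb (k + 1)
    push_cast at this
    rwa [add_assoc, add_comm 1]
  have h1 := eval_ascPochhammer_ne_zero hb' k
  have hbk : (b : ℂ) + k ≠ 0 := by exact_mod_cast hb k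
  have h2 : (b : ℂ) * (ascPochhammer ℂ k).eval (b + 1 : ℂ) =
      (ascPochhammer ℂ k).eval (b : ℂ) * (b + k) := by
    rw [← ascPochhammer_succ_eval, ascPochhammer_succ_left, Polynomial.eval_mul,
      Polynomial.eval_comp]
    simp
  have h3 : (ascPochhammer ℂ k).eval ((a + 1 : ℕ) : ℂ) = k.factorial * (k + a).choose a := by
    rw [← Nat.cast_ascFactorial, Nat.ascFactorial_eq_factorial_mul_choose, add_comm a k,
      ← Nat.choose_symm_add]
    push_cast; ring
  rw [ordinaryHypergeometricCoefficient, h3]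
  have hk : (k.factorial : ℂ) ≠ 0 := by exact_mod_cast k.factorial_ne_zero
  push_cast at h1
  field_simp
  linear_combination (-((k + a).choose a : ℂ)) * h2

theorem IsHypPrimitive.hasSum_smul {a : ℕ} {b : ℝ} {F : ℂ → ℂ} (h : IsHypPrimitive a b F) {ζ : ℂ}
    (hζ : ‖ζ‖ < 1) :
    HasSum (fun k : ℕ => ((k + a).choose a : ℂ) * (b / (b + k)) * ζ ^ k) (b * F ζ) := by
  refine (funext fun k => ?_ : (fun k : ℕ => _) = _) ▸ (h.2.1 ζ hζ).mul_left (b : ℂ)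
  ring

theorem IsHypPrimitive.isGaussContinuation {a : ℕ} {b : ℝ} (hb : ∀ k : ℕ, b + k ≠ 0) {F : ℂ → ℂ}
    (h : IsHypPrimitive a b F) :
    IsGaussContinuation ((a + 1 : ℕ) : ℂ) b (b + 1) fun ζ => b * F ζ := by
  refine ⟨(h.1.const_mul _).analyticOnNhd isOpen_hypDomain, fun ζ hζ => ?_⟩
  rw [ordinaryHypergeometric_eq_tsum]
  simp only [smul_eq_mul]
  rw [← (h.hasSum_smul hζ).tsum_eq]
  exact tsum_congr fun k => by rw [← ordinaryHypergeometricCoefficient_eq a hb k]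

theorem IsGaussContinuation.eqOn {a b c : ℂ} {F G : ℂ → ℂ} (hF : IsGaussContinuation a b c F)
    (hG : IsGaussContinuation a b c G) : Set.EqOn F G hypDomain := by
  refine hF.1.eqOn_of_preconnected_of_eventuallyEq hG.1 isPreconnected_hypDomain
    (z₀ := 0) (mem_hypDomain_of_norm_lt_one (by simp)) ?_
  filter_upwards [Metric.ball_mem_nhds (0 : ℂ) one_pos] with ζ hζ
  have hζ : ‖ζ‖ < 1 := by simpa using hζ
  rw [hF.2 ζ hζ, hG.2 ζ hζ]

theorem gaussHyp_eqOn {a b c : ℂ} {F : ℂ → ℂ} (hF : IsGaussContinuation a b c F) :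
    Set.EqOn (gaussHyp a b c) F hypDomain := by
  intro ζ hζ
  have h : ∃ F : ℂ → ℂ, IsGaussContinuation a b c F := ⟨F, hF⟩
  rw [gaussHyp, dif_pos h]
  exact h.choose_spec.eqOn hF hζ

theorem continuousOn_gaussHyp (a : ℕ) {b : ℝ} (hb : ∀ k : ℕ, b + k ≠ 0) :
    ContinuousOn (gaussHyp ((a + 1 : ℕ) : ℂ) b (b + 1)) hypDomain := by
  obtain ⟨F, hF⟩ := exists_isHypPrimitive a hb
  have h := hF.isGaussContinuation hb
  exact h.1.continuousOn.congr (gaussHyp_eqOn h)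

theorem hasSum_gaussHyp (a : ℕ) {b : ℝ} (hb : ∀ k : ℕ, b + k ≠ 0) {ζ : ℂ} (hζ : ‖ζ‖ < 1) :
    HasSum (fun k : ℕ => ((k + a).choose a : ℂ) * (b / (b + k)) * ζ ^ k)
      (gaussHyp ((a + 1 : ℕ) : ℂ) b (b + 1) ζ) := by
  obtain ⟨F, hF⟩ := exists_isHypPrimitive a hb
  rw [gaussHyp_eqOn (hF.isGaussContinuation hb) (mem_hypDomain_of_norm_lt_one hζ)]
  exact hF.hasSum_smul hζ

theorem exists_norm_gaussHyp_le (a : ℕ) {b : ℝ} (hb : ∀ k : ℕ, b + k ≠ 0) :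
    ∃ C : ℝ, 0 ≤ C ∧ ∀ ζ ∈ hypDomain, ‖ζ‖ ≤ 1 →
      ‖gaussHyp ((a + 1 : ℕ) : ℂ) b (b + 1) ζ‖ * ‖1 - ζ‖ ^ a * Real.sqrt ‖1 - ζ‖ ≤ C := by
  obtain ⟨F, hF⟩ := exists_isHypPrimitive a hb
  obtain ⟨C, hC, h⟩ := hF.2.2
  refine ⟨|b| * C, by positivity, fun ζ hζ hζ' => ?_⟩
  rw [gaussHyp_eqOn (hF.isGaussContinuation hb) hζ, norm_mul, Complex.norm_real,
    Real.norm_eq_abs, mul_assoc, mul_assoc, ← mul_assoc ‖F ζ‖]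
  refine mul_le_mul_of_nonneg_left (h ζ hζ' ?_) (abs_nonneg b)
  rintro rfl
  simp [hypDomain] at hζ

end

/-! ### Laplace transforms of the spherical functions -/

noncomputable section

theorem integrable_abs_pow_mul_exp_neg (m : ℕ) {ε : ℝ} (hε : 0 < ε) :
    Integrable fun l : ℝ => |l| ^ m * Real.exp (-(ε * |l|)) := by
  have h := integral_comp_abs (f := fun l : ℝ => l ^ m * Real.exp (-(ε * l)))
  have h1 := Real.integral_rpow_mul_exp_neg_mul_Ioi (a := m + 1) (by positivity) hε
  simp only [add_sub_cancel_right, Real.rpow_natCast] at h1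
  rw [h1] at h
  -- A non-integrable function has integral 0 by convention, so a nonzero Gamma value proves
  -- integrability.
  refine .of_integral_ne_zero (h ▸ ?_)
  have := Real.Gamma_pos_of_pos (s := m + 1) (by positivity)
  positivity

theorem integrableOn_pow_mul_exp_neg (m : ℕ) {P : ℂ} (hP : 0 < P.re) :
    IntegrableOn (fun l : ℝ => (l : ℂ) ^ m * Complex.exp (-(P * l))) (Set.Ioi 0) := by
  refine (integrable_abs_pow_mul_exp_neg m hP).integrableOn.mono'
    (by fun_prop) ?_
  filter_upwards [ae_restrict_mem measurableSet_Ioi] with l hl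
  have hl : 0 < l := hl
  rw [norm_mul, norm_pow, Complex.norm_real, Complex.norm_exp, Real.norm_eq_abs, abs_of_pos hl]
  simp

/-- The Laplace transform of a power. -/
theorem integral_pow_mul_exp_neg (m : ℕ) {P : ℂ} (hP : 0 < P.re) :
    ∫ l : ℝ in Set.Ioi 0, (l : ℂ) ^ m * Complex.exp (-(P * l)) = m.factorial / P ^ (m + 1) := by
  have hP0 : P ≠ 0 := fun h => by simp [h] at hP
  induction m with
  | zero =>
    have h := integral_exp_mul_complex_Ioi (a := -P) (by simpa using hP) 0
    simp only [neg_mul, Complex.ofReal_zero, mul_zero, Complex.exp_zero] at h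
    simp only [pow_zero, one_mul, h]
    simp
  | succ m ih =>
    -- The function l^{m+1} e^{-Pl} vanishes at 0 and at infinity, so the integral of its derivative
    -- is 0, which is the recursion in m.
    have hd (l : ℝ) : HasDerivAt (fun l : ℝ => (l : ℂ) ^ (m + 1) * Complex.exp (-(P * l)))
        ((m + 1) * ((l : ℂ) ^ m * Complex.exp (-(P * l))) -
          P * ((l : ℂ) ^ (m + 1) * Complex.exp (-(P * l)))) l := by
      have h1 : HasDerivAt (fun z : ℂ => z ^ (m + 1) * Complex.exp (-(P * z)))
          ((m + 1) * (l : ℂ) ^ m * Complex.exp (-(P * l)) +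
            (l : ℂ) ^ (m + 1) * (Complex.exp (-(P * l)) * -P)) (l : ℂ) := by
        have h2 : HasDerivAt (fun z : ℂ => -(P * z)) (-P) (l : ℂ) := by
          exact ((hasDerivAt_id (l : ℂ)).const_mul P).neg.congr_deriv (by simp)
        have h3 := hasDerivAt_pow (m + 1) (l : ℂ)
        rw [Nat.add_sub_cancel] at h3
        push_cast at h3
        exact h3.mul h2.cexp
      refine h1.comp_ofReal.congr_deriv ?_
      ring
    have hi := (integrableOn_pow_mul_exp_neg m hP).const_mul ((m : ℂ) + 1)
    have hi' := (integrableOn_pow_mul_exp_neg (m + 1) hP).const_mul P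
    have ht := tendsto_zero_of_hasDerivAt_of_integrableOn_Ioi (a := 0) (fun l _ => hd l)
      (hi.sub hi') (integrableOn_pow_mul_exp_neg (m + 1) hP)
    have h := integral_Ioi_of_hasDerivAt_of_tendsto' (a := 0) (fun l _ => hd l) (hi.sub hi') ht
    rw [integral_sub hi hi', integral_const_mul, integral_const_mul, ih] at h
    simp only [Complex.ofReal_zero, ne_eq, Nat.succ_ne_zero, not_false_eq_true, zero_pow, zero_mul,
      sub_zero] at h
    rw [Nat.factorial_succ]
    push_cast
    have h2 := sub_eq_zero.1 h
    rw [pow_succ P (m + 1), eq_div_iff (by positivity)]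
    have h3 : P ^ (m + 1) ≠ 0 := pow_ne_zero _ hP0
    field_simp at h2
    linear_combination -h2

open Finset in
/-- The Laplace transform of a Laguerre polynomial. -/
theorem integral_laguerre_mul_exp_neg (a k : ℕ) (q : ℝ) {P : ℂ} (hP : 0 < P.re) :
    ∫ l : ℝ in Set.Ioi 0, (l : ℂ) ^ a * Complex.exp (-(P * l)) *
      (((laguerre a k).eval (l * q) : ℝ) : ℂ) =
      ((k + a).factorial / k.factorial : ℝ) * ((P - q) ^ k / P ^ (k + a + 1)) := by
  have hP0 : P ≠ 0 := fun h => by simp [h] at hP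
  have h1 (l : ℝ) : (l : ℂ) ^ a * Complex.exp (-(P * l)) *
      (((laguerre a k).eval (l * q) : ℝ) : ℂ) = ∑ i ∈ range (k + 1),
      (laguerreCoeff a k i * q ^ i : ℂ) * ((l : ℂ) ^ (i + a) * Complex.exp (-(P * l))) := by
    rw [eval_laguerre (Nat.lt_succ_self k), Complex.ofReal_sum, mul_sum]
    refine sum_congr rfl fun i _ => ?_
    push_cast
    rw [pow_add]
    ring
  simp only [h1]
  rw [integral_finsetSum _ fun i _ => (integrableOn_pow_mul_exp_neg _ hP).const_mul _]
  simp only [integral_const_mul, integral_pow_mul_exp_neg _ hP]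
  -- The terms match those of the binomial expansion of (P-q)^k because C(k+a,i+a)(i+a)!/i! =
  -- ((k+a)!/k!) C(k,i).
  rw [sub_eq_neg_add, add_pow, sum_div, mul_sum]
  refine sum_congr rfl fun i hi => ?_
  have hi : i ≤ k := by simpa [Nat.lt_succ_iff] using hi
  have h2 : (((k + a).choose (i + a) : ℕ) : ℂ) * (i + a).factorial * (k - i).factorial =
      (k + a).factorial := by
    have := Nat.choose_mul_factorial_mul_factorial (show i + a ≤ k + a by omega)
    rw [show k + a - (i + a) = k - i by omega] at this
    exact_mod_cast this
  have h3 : (((k.choose i : ℕ) : ℂ) * i.factorial * (k - i).factorial) = k.factorial := by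
    exact_mod_cast Nat.choose_mul_factorial_mul_factorial hi
  have h4 : (i.factorial : ℂ) ≠ 0 := by exact_mod_cast i.factorial_ne_zero
  have h5 : (k.factorial : ℂ) ≠ 0 := by exact_mod_cast k.factorial_ne_zero
  have h6 : ((k - i).factorial : ℂ) ≠ 0 := by exact_mod_cast (k - i).factorial_ne_zero
  have h7 : P ^ (k + a + 1) = P ^ (i + a + 1) * P ^ (k - i) := by
    rw [← pow_add]; congr 1; omega
  rw [h7, laguerreCoeff, neg_pow]
  push_cast
  have hp1 := pow_ne_zero (i + a + 1) hP0
  have hp2 := pow_ne_zero (k - i) hP0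
  field_simp
  rw [← h2, ← h3]
  ring

variable {n : ℕ}

/-- `ε + (|z|² - 4it) / 4`. -/
def laplacePoint (ε : ℝ) (p : Heis n) : ℂ := (ε + zNormSq p / 4 : ℝ) - Complex.I * p.2

theorem laplacePoint_re (ε : ℝ) (p : Heis n) : (laplacePoint ε p).re = ε + zNormSq p / 4 := by
  simp [laplacePoint]

theorem laplacePoint_im (ε : ℝ) (p : Heis n) : (laplacePoint ε p).im = -p.2 := by
  simp [laplacePoint]

/-- The integral of `|l|^a e^{-ε|l|}` against the spherical functions. -/
def abelKernel (a k : ℕ) (ε : ℝ) (p : Heis n) : ℝ :=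
  ((k + a).factorial / k.factorial : ℝ) * (2 * ((laplacePoint ε p - (zNormSq p / 2 : ℝ)) ^ k /
    laplacePoint ε p ^ (k + a + 1)).re)

/-- The second summand serves only l = 0, where the radial function is the constant L_k^{n-1}(0). -/
theorem norm_radialExp_laguerre_le (hn : 1 ≤ n) (k : ℕ) (l : ℝ) (p : Heis n) :
    ‖radialExp l (laguerre (n - 1) k) p‖ ≤
      (2 * k + n : ℝ) ^ (n - 1) + |(laguerre (n - 1) k).eval 0| := by
  rcases eq_or_ne l 0 with rfl | hl
  · simp only [radialExp, zero_mul, Complex.ofReal_zero, mul_zero, Complex.exp_zero, abs_zero,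
      zero_div, neg_zero, Real.exp_zero, one_mul, Complex.norm_real, Real.norm_eq_abs]
    exact le_add_of_nonneg_left (by positivity)
  · rw [← sphericalFun_eq_radialExp hn hl]
    exact (norm_sphericalFun_le hn hl k p).trans (le_add_of_nonneg_right (abs_nonneg _))

/-- The weighted spherical kernel `|l|^a e^{-ε|l|} φ_{l,k}`. -/
def weightedRadial (a k : ℕ) (ε l : ℝ) (p : Heis n) : ℂ :=
  ((|l| ^ a * Real.exp (-(ε * |l|)) : ℝ) : ℂ) * radialExp l (laguerre a k) p

theorem continuous_weightedRadial (a k : ℕ) (ε : ℝ) :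
    Continuous fun q : ℝ × Heis n => weightedRadial a k ε q.1 q.2 := by
  have := continuous_zNormSq (n := n)
  have := (laguerre a k).continuous
  unfold weightedRadial radialExp
  fun_prop

theorem norm_weightedRadial_le (hn : 1 ≤ n) (k : ℕ) (ε l : ℝ) (p : Heis n) :
    ‖weightedRadial (n - 1) k ε l p‖ ≤ |l| ^ (n - 1) * Real.exp (-(ε * |l|)) *
      ((2 * k + n : ℝ) ^ (n - 1) + |(laguerre (n - 1) k).eval 0|) := by
  rw [weightedRadial, norm_mul, Complex.norm_real, Real.norm_of_nonneg (by positivity)]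
  gcongr
  exact norm_radialExp_laguerre_le hn k l p

/-- Changing the sign of l conjugates the integrand. The integral over ℝ is therefore twice the real
part of the half-line Laplace transform at P = `laplacePoint ε p`, q = |z|²/2. -/
theorem integral_weightedRadial (hn : 1 ≤ n) (k : ℕ) {ε : ℝ} (hε : 0 < ε) (p : Heis n) :
    ∫ l : ℝ, weightedRadial (n - 1) k ε l p = (abelKernel (n - 1) k ε p : ℂ) := by
  have hcont : Continuous fun l : ℝ => weightedRadial (n - 1) k ε l p :=
    (continuous_weightedRadial (n - 1) k ε).comp (by fun_prop : Continuous fun l : ℝ => (l, p))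
  have hint : Integrable fun l : ℝ => weightedRadial (n - 1) k ε l p :=
    ((integrable_abs_pow_mul_exp_neg (n - 1) hε).mul_const _).mono' hcont.aestronglyMeasurable
      (Filter.Eventually.of_forall fun l => norm_weightedRadial_le hn k ε l p)
  have hP : 0 < (laplacePoint ε p).re := by
    rw [laplacePoint_re]
    have := zNormSq_nonneg p
    positivity
  have hpos : ∫ l : ℝ in Set.Ioi 0, weightedRadial (n - 1) k ε l p =
      ((k + (n - 1)).factorial / k.factorial : ℝ) *
      ((laplacePoint ε p - (zNormSq p / 2 : ℝ)) ^ k /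
        laplacePoint ε p ^ (k + (n - 1) + 1)) := by
    rw [← integral_laguerre_mul_exp_neg (n - 1) k (zNormSq p / 2) hP]
    refine setIntegral_congr_fun measurableSet_Ioi fun l hl => ?_
    have hl : 0 < l := hl
    have h1 : Complex.exp (-(laplacePoint ε p * l)) = (Real.exp (-(ε * l)) : ℂ) *
        Complex.exp (Complex.I * ((l * p.2 : ℝ) : ℂ)) * (Real.exp (-(l * zNormSq p / 4)) : ℂ) := by
      push_cast
      rw [← Complex.exp_add, ← Complex.exp_add]
      congr 1
      rw [laplacePoint]
      push_cast
      ring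
    simp only [weightedRadial, radialExp, abs_of_pos hl, h1, mul_div_assoc]
    push_cast
    ring
  have hneg (l : ℝ) : weightedRadial (n - 1) k ε (-l) p =
      (starRingEnd ℂ) (weightedRadial (n - 1) k ε l p) := by
    simp only [weightedRadial, radialExp, abs_neg, map_mul, Complex.conj_ofReal,
      ← Complex.exp_conj, Complex.conj_I]
    push_cast
    ring_nf
  rw [← intervalIntegral.integral_Iic_add_Ioi hint.integrableOn hint.integrableOn (b := 0)]
  have h0 := integral_comp_neg_Ioi 0 (fun l => weightedRadial (n - 1) k ε l p)
  rw [neg_zero] at h0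
  simp only [hneg] at h0
  rw [← h0, integral_conj, add_comm, Complex.add_conj, hpos, Complex.re_ofReal_mul, abelKernel]
  push_cast
  ring

theorem integral_integral_weightedRadial (hn : 1 ≤ n) (k : ℕ) {ε : ℝ} (hε : 0 < ε)
    (f : 𝓢(Heis n, ℂ)) :
    ∫ l : ℝ, ((|l| ^ (n - 1) * Real.exp (-(ε * |l|)) : ℝ) : ℂ) * sphericalPairing l k f =
      ∫ p : Heis n, (abelKernel (n - 1) k ε p : ℂ) * f p := by
  have hint : Integrable (Function.uncurry fun (l : ℝ) (p : Heis n) =>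
      weightedRadial (n - 1) k ε l p * f p) (volume.prod volume) := by
    refine (((integrable_abs_pow_mul_exp_neg (n - 1) hε).mul_const
      ((2 * k + n : ℝ) ^ (n - 1) + |(laguerre (n - 1) k).eval 0|)).mul_prod
      f.integrable.norm).mono' ?_ (Filter.Eventually.of_forall fun q => ?_)
    · have h1 := continuous_weightedRadial (n := n) (n - 1) k ε
      have h2 := f.continuous
      exact (h1.mul (h2.comp continuous_snd)).aestronglyMeasurable
    · simp only [Function.uncurry, norm_mul]
      gcongr
      exact norm_weightedRadial_le hn k ε q.1 q.2
  have h := integral_integral_swap hint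
  simp only [integral_mul_const, integral_weightedRadial hn k hε] at h
  rw [← h]
  refine integral_congr_ae ?_
  filter_upwards [compl_mem_ae_iff.2 (measure_singleton (0 : ℝ))] with l hl
  have hl : l ≠ 0 := hl
  rw [sphericalPairing, sphericalFun_eq_radialExp hn hl, ← integral_const_mul]
  simp only [weightedRadial, mul_assoc]

end

/-! ### Singular weight, geometry of the kernel, and termwise formula -/

noncomputable section

open Filter Topology

/-- A singular weight on the Heisenberg group that is locally integrable. -/
def singWeight {n : ℕ} (a : ℕ) (p : Heis n) : ℝ := (‖p.1‖ ^ (2 * a + 1))⁻¹ * (Real.sqrt |p.2|)⁻¹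

theorem singWeight_nonneg {n : ℕ} (a : ℕ) (p : Heis n) : 0 ≤ singWeight a p := by
  unfold singWeight; positivity

theorem measurable_singWeight {n : ℕ} (a : ℕ) : Measurable (singWeight a : Heis n → ℝ) := by
  unfold singWeight
  fun_prop

/-- The real dimension is 2a + 2, so the polar Jacobian r^{2a+1} cancels the singularity exactly. -/
theorem integrable_inv_norm_pow (a : ℕ) :
    Integrable fun z : Fin (a + 1) → ℂ => (‖z‖ ^ (2 * a + 1))⁻¹ * (1 + ‖z‖ ^ 2)⁻¹ := by
  have hdim : Module.finrank ℝ (Fin (a + 1) → ℂ) = 2 * a + 2 := by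
    rw [Module.finrank_pi_fintype]
    simp [Complex.finrank_real_complex]
    ring
  refine (integrable_fun_norm_addHaar (volume : Measure (Fin (a + 1) → ℂ))
    (f := fun r : ℝ => (r ^ (2 * a + 1))⁻¹ * (1 + r ^ 2)⁻¹)).2 ?_
  rw [hdim]
  refine integrable_inv_one_add_sq.integrableOn.congr_fun (fun r hr => ?_) measurableSet_Ioi
  have hr : r ≠ 0 := ne_of_gt hr
  rw [show 2 * a + 2 - 1 = 2 * a + 1 by omega, smul_eq_mul, ← mul_assoc,
    mul_inv_cancel₀ (pow_ne_zero _ hr), one_mul]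

theorem integrable_inv_sqrt_abs :
    Integrable fun t : ℝ => (Real.sqrt |t|)⁻¹ * (1 + t ^ 2)⁻¹ := by
  have h := (integrable_fun_norm_addHaar (volume : Measure ℝ)
    (f := fun r : ℝ => (Real.sqrt r)⁻¹ * (1 + r ^ 2)⁻¹)).2 ?_
  · simpa using h
  have h1 : IntegrableOn (fun r : ℝ => r ^ (-(1 / 2) : ℝ)) (Set.Ioc 0 1) :=
    (intervalIntegrable_iff_integrableOn_Ioc_of_le zero_le_one).1
      (intervalIntegral.intervalIntegrable_rpow' (by norm_num))
  have hmeas : Measurable fun r : ℝ => (Real.sqrt r)⁻¹ * (1 + r ^ 2)⁻¹ := by fun_prop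
  simp only [Module.finrank_self, Nat.sub_self, pow_zero, one_smul]
  rw [← Set.Ioc_union_Ioi_eq_Ioi zero_le_one]
  refine IntegrableOn.union ?_ ?_
  · refine h1.mono' hmeas.aestronglyMeasurable ?_
    filter_upwards [ae_restrict_mem measurableSet_Ioc] with r hr
    have h2 : (1 + r ^ 2)⁻¹ ≤ 1 := inv_le_one_of_one_le₀ (by nlinarith)
    rw [Real.norm_of_nonneg (by positivity), Real.rpow_neg hr.1.le, ← Real.sqrt_eq_rpow]
    exact mul_le_of_le_one_right (by positivity) h2
  · refine integrable_inv_one_add_sq.integrableOn.mono' hmeas.aestronglyMeasurable ?_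
    filter_upwards [ae_restrict_mem measurableSet_Ioi] with r hr
    have hr : 1 < r := hr
    have h2 : (Real.sqrt r)⁻¹ ≤ 1 := inv_le_one_of_one_le₀ (Real.one_le_sqrt.2 hr.le)
    rw [Real.norm_of_nonneg (by positivity)]
    exact mul_le_of_le_one_left (by positivity) h2

/-- The Schwartz seminorm that controls integration against `singWeight`. -/
def weightSeminorm (n : ℕ) : Seminorm ℂ 𝓢(Heis n, ℂ) :=
  (Finset.Iic (4, 0)).sup (schwartzSeminormFamily ℂ (Heis n) ℂ)

/-- Order 4 splits into quadratic decay in z and quadratic decay in t; 16 = 2⁴ comes from the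
seminorm bound for (1+‖p‖)⁴. -/
theorem norm_schwartz_le {n : ℕ} (f : 𝓢(Heis n, ℂ)) (p : Heis n) :
    ‖f p‖ ≤ 16 * weightSeminorm n f * ((1 + ‖p.1‖ ^ 2)⁻¹ * (1 + p.2 ^ 2)⁻¹) := by
  have h := SchwartzMap.one_add_le_sup_seminorm_apply (𝕜 := ℂ) (m := (4, 0)) (k := 4) (n := 0)
    le_rfl le_rfl f p
  rw [norm_iteratedFDeriv_zero] at h
  have h1 : ‖p.1‖ ≤ ‖p‖ := norm_fst_le p
  have h2 : |p.2| ≤ ‖p‖ := norm_snd_le p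
  have h3 : (1 + ‖p.1‖ ^ 2) * (1 + p.2 ^ 2) ≤ (1 + ‖p‖) ^ 4 := by
    have e1 : 1 + ‖p.1‖ ^ 2 ≤ (1 + ‖p‖) ^ 2 := by nlinarith [norm_nonneg p.1]
    have e2 : 1 + p.2 ^ 2 ≤ (1 + ‖p‖) ^ 2 := by
      rw [← sq_abs p.2]; nlinarith [abs_nonneg p.2]
    calc _ ≤ (1 + ‖p‖) ^ 2 * (1 + ‖p‖) ^ 2 := mul_le_mul e1 e2 (by positivity) (by positivity)
      _ = _ := by ring
  rw [← mul_inv, ← div_eq_mul_inv, le_div_iff₀ (by positivity), mul_comm]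
  refine (mul_le_mul_of_nonneg_right h3 (norm_nonneg _)).trans (h.trans_eq ?_)
  change (2 : ℝ) ^ 4 * weightSeminorm n f = 16 * weightSeminorm n f
  norm_num

theorem singWeight_mul_norm_le {n : ℕ} (a : ℕ) (f : 𝓢(Heis n, ℂ)) (p : Heis n) :
    singWeight a p * ‖f p‖ ≤ 16 * weightSeminorm n f *
      (((‖p.1‖ ^ (2 * a + 1))⁻¹ * (1 + ‖p.1‖ ^ 2)⁻¹) *
        ((Real.sqrt |p.2|)⁻¹ * (1 + p.2 ^ 2)⁻¹)) := by
  refine (mul_le_mul_of_nonneg_left (norm_schwartz_le f p) (singWeight_nonneg a p)).trans_eq ?_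
  unfold singWeight
  ring

theorem integrable_singWeight_bound (a : ℕ) : Integrable fun p : Heis (a + 1) =>
    ((‖p.1‖ ^ (2 * a + 1))⁻¹ * (1 + ‖p.1‖ ^ 2)⁻¹) *
      ((Real.sqrt |p.2|)⁻¹ * (1 + p.2 ^ 2)⁻¹) :=
  (integrable_inv_norm_pow a).mul_prod integrable_inv_sqrt_abs

theorem integrable_singWeight_mul (a : ℕ) (f : 𝓢(Heis (a + 1), ℂ)) :
    Integrable fun p => singWeight a p * ‖f p‖ := by
  refine ((integrable_singWeight_bound a).const_mul (16 * weightSeminorm (a + 1) f)).mono'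
    ((measurable_singWeight a).aestronglyMeasurable.mul f.continuous.norm.aestronglyMeasurable)
    (Eventually.of_forall fun p => ?_)
  rw [Real.norm_of_nonneg (mul_nonneg (singWeight_nonneg a p) (norm_nonneg _))]
  exact singWeight_mul_norm_le a f p

theorem integral_singWeight_mul_le (a : ℕ) (f : 𝓢(Heis (a + 1), ℂ)) :
    ∫ p, singWeight a p * ‖f p‖ ≤ 16 * (∫ p : Heis (a + 1),
      ((‖p.1‖ ^ (2 * a + 1))⁻¹ * (1 + ‖p.1‖ ^ 2)⁻¹) *
        ((Real.sqrt |p.2|)⁻¹ * (1 + p.2 ^ 2)⁻¹)) * weightSeminorm (a + 1) f := by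
  refine (integral_mono (integrable_singWeight_mul a f)
    ((integrable_singWeight_bound a).const_mul (16 * weightSeminorm (a + 1) f))
    fun p => singWeight_mul_norm_le a f p).trans_eq ?_
  rw [integral_const_mul]
  ring

theorem norm_fst_sq_le_zNormSq {n : ℕ} (p : Heis n) : ‖p.1‖ ^ 2 ≤ zNormSq p := by
  have h : ‖p.1‖ ≤ Real.sqrt (zNormSq p) := by
    refine (pi_norm_le_iff_of_nonneg (Real.sqrt_nonneg _)).2 fun j => Real.le_sqrt_of_sq_le ?_
    rw [← Complex.normSq_eq_norm_sq]
    exact Finset.single_le_sum (f := fun j => Complex.normSq (p.1 j))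
      (fun _ _ => Complex.normSq_nonneg _) (Finset.mem_univ j)
  calc _ ≤ Real.sqrt (zNormSq p) ^ 2 := pow_le_pow_left₀ (norm_nonneg _) h 2
    _ = _ := Real.sq_sqrt (zNormSq_nonneg p)

theorem ae_ne_zero (a : ℕ) : ∀ᵐ p : Heis (a + 1), p.1 ≠ 0 ∧ p.2 ≠ 0 := by
  have h1 : ∀ᵐ z : Fin (a + 1) → ℂ, z ≠ 0 := compl_mem_ae_iff.2 (measure_singleton 0)
  have h2 : ∀ᵐ t : ℝ, t ≠ 0 := compl_mem_ae_iff.2 (measure_singleton 0)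
  exact (Measure.quasiMeasurePreserving_fst.ae h1).and (Measure.quasiMeasurePreserving_snd.ae h2)

theorem zNormSq_pos {n : ℕ} {p : Heis n} (h : p.1 ≠ 0) : 0 < zNormSq p :=
  lt_of_lt_of_le (by have := norm_pos_iff.2 h; positivity) (norm_fst_sq_le_zNormSq p)

/-- The complex coordinate `|z|² + 4it`. -/
def kernelPoint {n : ℕ} (p : Heis n) : ℂ := (zNormSq p : ℂ) + 4 * Complex.I * (p.2 : ℂ)

theorem kernelPoint_re {n : ℕ} (p : Heis n) : (kernelPoint p).re = zNormSq p := by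
  simp [kernelPoint]

theorem kernelPoint_im {n : ℕ} (p : Heis n) : (kernelPoint p).im = 4 * p.2 := by
  simp [kernelPoint]

theorem normSq_kernelPoint {n : ℕ} (p : Heis n) :
    Complex.normSq (kernelPoint p) = zNormSq p ^ 2 + 16 * p.2 ^ 2 := by
  rw [Complex.normSq_apply, kernelPoint_re, kernelPoint_im]
  ring

theorem zNormSq_le_norm {n : ℕ} (p : Heis n) : zNormSq p ≤ ‖kernelPoint p‖ := by
  rw [← kernelPoint_re]
  exact Complex.re_le_norm _

theorem abs_snd_le_norm {n : ℕ} (p : Heis n) : |p.2| ≤ ‖kernelPoint p‖ := by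
  have h := Complex.abs_im_le_norm (kernelPoint p)
  rw [kernelPoint_im, abs_mul, abs_of_pos (by norm_num : (0 : ℝ) < 4)] at h
  linarith [abs_nonneg p.2]

/-- The left side is |z|^{-(2a+1)} |w|^{-1/2}. The weight replaces |z| by the smaller sup norm and
|w| by the smaller |t|. -/
theorem singWeight_bound {n : ℕ} (a : ℕ) {p : Heis n} (h : p.1 ≠ 0 ∧ p.2 ≠ 0) :
    (zNormSq p ^ a * Real.sqrt (zNormSq p) * Real.sqrt ‖kernelPoint p‖)⁻¹ ≤ singWeight a p := by
  have h1 := norm_pos_iff.2 h.1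
  have h2 := abs_pos.2 h.2
  have h3 := zNormSq_pos h.1
  rw [singWeight, ← mul_inv]
  refine inv_anti₀ (by positivity) ?_
  rw [pow_succ, pow_mul]
  gcongr
  · exact norm_fst_sq_le_zNormSq p
  · exact Real.le_sqrt_of_sq_le (norm_fst_sq_le_zNormSq p)
  · exact abs_snd_le_norm p

theorem inv_norm_kernelPoint_pow_le {n : ℕ} (a : ℕ) {p : Heis n} (h : p.1 ≠ 0 ∧ p.2 ≠ 0) :
    (‖kernelPoint p‖ ^ (a + 1))⁻¹ ≤ singWeight a p := by
  refine le_trans ?_ (singWeight_bound a h)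
  have h1 := zNormSq_pos h.1
  have h2 := zNormSq_le_norm p
  have h3 := h1.trans_le h2
  refine inv_anti₀ (by positivity) ?_
  calc zNormSq p ^ a * Real.sqrt (zNormSq p) * Real.sqrt ‖kernelPoint p‖
      ≤ ‖kernelPoint p‖ ^ a * Real.sqrt ‖kernelPoint p‖ * Real.sqrt ‖kernelPoint p‖ := by gcongr
    _ = ‖kernelPoint p‖ ^ (a + 1) := by
      rw [mul_assoc, Real.mul_self_sqrt h3.le, pow_succ]

/-- The argument of the hypergeometric function in the kernel. -/
def hypArg {n : ℕ} (p : Heis n) : ℂ :=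
  -(kernelPoint p ^ 2 / ((zNormSq p ^ 2 + 16 * p.2 ^ 2 : ℝ) : ℂ))

theorem norm_hypArg_le {n : ℕ} (p : Heis n) : ‖hypArg p‖ ≤ 1 := by
  rw [hypArg, ← normSq_kernelPoint, norm_neg, norm_div, norm_pow, Complex.norm_real,
    Complex.normSq_eq_norm_sq, Real.norm_of_nonneg (by positivity)]
  exact div_self_le_one _

/-- 1 + w²/|w|² = w(w̄ + w)/|w|² with w + w̄ = 2|z|². Thus the branch point 1 is avoided as long as
z ≠ 0. -/
theorem one_sub_hypArg {n : ℕ} {p : Heis n} (h : p.1 ≠ 0) :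
    1 - hypArg p = ((2 * zNormSq p / ‖kernelPoint p‖ ^ 2 : ℝ) : ℂ) * kernelPoint p := by
  have h1 := (zNormSq_pos h).trans_le (zNormSq_le_norm p)
  have h2 : ((‖kernelPoint p‖ ^ 2 : ℝ) : ℂ) ≠ 0 := by
    exact_mod_cast (pow_pos h1 2).ne'
  have h3 : ((‖kernelPoint p‖ ^ 2 : ℝ) : ℂ) = kernelPoint p * (starRingEnd ℂ) (kernelPoint p) := by
    rw [Complex.mul_conj, Complex.normSq_eq_norm_sq]
  have h4 : ((2 * zNormSq p : ℝ) : ℂ) = kernelPoint p + (starRingEnd ℂ) (kernelPoint p) := by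
    rw [Complex.add_conj, kernelPoint_re]
  rw [hypArg, ← normSq_kernelPoint, Complex.normSq_eq_norm_sq, Complex.ofReal_div, h4, sub_neg_eq_add]
  field_simp
  rw [h3]
  ring

theorem mul_hypArg_mem_hypDomain {n : ℕ} {p : Heis n} (h : p.1 ≠ 0) {r : ℝ} (hr0 : 0 ≤ r)
    (hr1 : r ≤ 1) : (r : ℂ) * hypArg p ∈ hypDomain := by
  have hs := zNormSq_pos h
  have h1 := hs.trans_le (zNormSq_le_norm p)
  have h2 : (1 : ℂ) - r * hypArg p = ((1 - r : ℝ) : ℂ) + (r : ℂ) * (1 - hypArg p) := by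
    push_cast; ring
  refine Or.inl ?_
  rw [h2, one_sub_hypArg h, Complex.add_re, Complex.ofReal_re, Complex.re_ofReal_mul,
    Complex.re_ofReal_mul, kernelPoint_re]
  have h3 : 0 < 2 * zNormSq p / ‖kernelPoint p‖ ^ 2 * zNormSq p := by positivity
  rcases hr0.eq_or_lt with rfl | hr
  · simp
  · have := mul_pos hr h3
    linarith

/-- |1-rζ| is at least 1 - r and at least |1-ζ| - (1-r). Averaging removes r and leaves |1-ζ|/2 =
|z|²/|w|. -/
theorem le_norm_one_sub_mul_hypArg {n : ℕ} {p : Heis n} (h : p.1 ≠ 0) {r : ℝ} (hr0 : 0 ≤ r)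
    (hr1 : r ≤ 1) : zNormSq p / ‖kernelPoint p‖ ≤ ‖1 - (r : ℂ) * hypArg p‖ := by
  have hs := zNormSq_pos h
  have h1 := hs.trans_le (zNormSq_le_norm p)
  have h2 : ‖1 - hypArg p‖ = 2 * (zNormSq p / ‖kernelPoint p‖) := by
    rw [one_sub_hypArg h, norm_mul, Complex.norm_real, Real.norm_of_nonneg (by positivity)]
    field_simp
  have h3 : ‖((1 - r : ℝ) : ℂ) * hypArg p‖ ≤ 1 - r := by
    rw [norm_mul, Complex.norm_real, Real.norm_of_nonneg (by linarith)]
    exact mul_le_of_le_one_right (by linarith) (norm_hypArg_le p)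
  have h4 : ‖(r : ℂ) * hypArg p‖ ≤ r := by
    rw [norm_mul, Complex.norm_real, Real.norm_of_nonneg hr0]
    exact mul_le_of_le_one_right hr0 (norm_hypArg_le p)
  have h5 := norm_sub_norm_le (1 : ℂ) ((r : ℂ) * hypArg p)
  have h6 := norm_sub_le (1 - (r : ℂ) * hypArg p) (((1 - r : ℝ) : ℂ) * hypArg p)
  have h7 : 1 - (r : ℂ) * hypArg p - ((1 - r : ℝ) : ℂ) * hypArg p = 1 - hypArg p := by
    push_cast; ring
  rw [h7, h2] at h6
  rw [norm_one] at h5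
  linarith

theorem laplacePoint_zero {n : ℕ} (p : Heis n) :
    laplacePoint 0 p = (starRingEnd ℂ) (kernelPoint p) / 4 := by
  apply Complex.ext
  · rw [laplacePoint_re, Complex.div_ofNat_re, Complex.conj_re, kernelPoint_re]; simp
  · rw [laplacePoint_im, Complex.div_ofNat_im, Complex.conj_im, kernelPoint_im]; ring

theorem laplacePoint_zero_sub {n : ℕ} (p : Heis n) :
    laplacePoint 0 p - ((zNormSq p / 2 : ℝ) : ℂ) = -kernelPoint p / 4 := by
  rw [laplacePoint, kernelPoint]
  push_cast
  ring

/-- At ε = 0, P = w̄/4 and P - |z|²/2 = -w/4, so the Laplace transform is 4^{a+1} w̄^{-(a+1)}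
(-w/w̄)^k. Here 1/w̄ = w/|w|² and -w/w̄ is `hypArg p`. -/
theorem abelKernel_zero {n : ℕ} (a k : ℕ) {p : Heis n} (h : p.1 ≠ 0) :
    abelKernel a k 0 p = 2 * 4 ^ (a + 1) * a.factorial * ((k + a).choose a *
      ((kernelPoint p / ((zNormSq p ^ 2 + 16 * p.2 ^ 2 : ℝ) : ℂ)) ^ (a + 1) *
        hypArg p ^ k).re) := by
  have h1 := (zNormSq_pos h).trans_le (zNormSq_le_norm p)
  have hw : kernelPoint p ≠ 0 := norm_pos_iff.1 h1
  have hw' : (starRingEnd ℂ) (kernelPoint p) ≠ 0 := by simpa using hw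
  have hd : ((zNormSq p ^ 2 + 16 * p.2 ^ 2 : ℝ) : ℂ) =
      kernelPoint p * (starRingEnd ℂ) (kernelPoint p) := by
    rw [Complex.mul_conj, normSq_kernelPoint]
  have h2 : (laplacePoint 0 p - ((zNormSq p / 2 : ℝ) : ℂ)) ^ k / laplacePoint 0 p ^ (k + a + 1) =
      ((4 ^ (a + 1) : ℝ) : ℂ) *
      ((kernelPoint p / ((zNormSq p ^ 2 + 16 * p.2 ^ 2 : ℝ) : ℂ)) ^ (a + 1) * hypArg p ^ k) := by
    have e1 : kernelPoint p / ((zNormSq p ^ 2 + 16 * p.2 ^ 2 : ℝ) : ℂ) =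
        1 / (starRingEnd ℂ) (kernelPoint p) := by rw [hd]; field_simp
    have e2 : hypArg p = -kernelPoint p / (starRingEnd ℂ) (kernelPoint p) := by
      rw [hypArg, hd]; field_simp
    rw [e1, e2, laplacePoint_zero_sub, laplacePoint_zero, add_assoc, pow_add _ k]
    generalize (starRingEnd ℂ) (kernelPoint p) = c at *
    push_cast
    simp only [div_pow, one_pow]
    field_simp
  rw [abelKernel, h2, Complex.re_ofReal_mul]
  have h3 : ((k + a).choose a : ℝ) = (k + a).factorial / (k.factorial * a.factorial) := by
    rw [add_comm k a, Nat.cast_add_choose ℝ, mul_comm (a.factorial : ℝ)]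
  rw [h3]
  have : (a.factorial : ℝ) ≠ 0 := by positivity
  field_simp

/-- P and P - |z|²/2 share their imaginary part and have real parts ε ± |z|²/4, so the quotient has
modulus at most 1. With |P| ≥ |w|/4 the bound is uniform in ε ≥ 0. -/
theorem abs_abelKernel_le {n : ℕ} (a k : ℕ) {ε : ℝ} (hε : 0 ≤ ε) {p : Heis n} (h : p.1 ≠ 0) :
    |abelKernel a k ε p| ≤ (k + a).factorial / k.factorial * (2 * 4 ^ (a + 1)) *
      (‖kernelPoint p‖ ^ (a + 1))⁻¹ := by
  have hs := zNormSq_pos h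
  have h1 := hs.trans_le (zNormSq_le_norm p)
  have h2 : ‖kernelPoint p‖ / 4 ≤ ‖laplacePoint ε p‖ := by
    refine (sq_le_sq₀ (by positivity) (by positivity)).1 ?_
    rw [div_pow, ← Complex.normSq_eq_norm_sq, ← Complex.normSq_eq_norm_sq, normSq_kernelPoint,
      Complex.normSq_apply, laplacePoint_re, laplacePoint_im]
    nlinarith [mul_nonneg hε hs.le]
  have h3 : ‖laplacePoint ε p - ((zNormSq p / 2 : ℝ) : ℂ)‖ ≤ ‖laplacePoint ε p‖ := by
    refine (sq_le_sq₀ (by positivity) (by positivity)).1 ?_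
    rw [← Complex.normSq_eq_norm_sq, ← Complex.normSq_eq_norm_sq,
      Complex.normSq_apply, Complex.normSq_apply, Complex.sub_re, Complex.sub_im,
      Complex.ofReal_re, Complex.ofReal_im, laplacePoint_re, laplacePoint_im]
    nlinarith [mul_nonneg hε hs.le]
  have h4 : 0 < ‖laplacePoint ε p‖ := lt_of_lt_of_le (by positivity) h2
  rw [abelKernel, abs_mul, abs_mul, abs_of_nonneg (by positivity :
    (0 : ℝ) ≤ (k + a).factorial / k.factorial), abs_two, mul_assoc, mul_assoc]
  gcongr
  refine (Complex.abs_re_le_norm _).trans ?_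
  rw [norm_div, norm_pow, norm_pow, add_assoc, pow_add]
  calc ‖laplacePoint ε p - ((zNormSq p / 2 : ℝ) : ℂ)‖ ^ k /
        (‖laplacePoint ε p‖ ^ k * ‖laplacePoint ε p‖ ^ (a + 1))
      ≤ ‖laplacePoint ε p‖ ^ k / (‖laplacePoint ε p‖ ^ k * ‖laplacePoint ε p‖ ^ (a + 1)) := by
        gcongr
    _ = (‖laplacePoint ε p‖ ^ (a + 1))⁻¹ := by field_simp
    _ ≤ ((‖kernelPoint p‖ / 4) ^ (a + 1))⁻¹ := by gcongr
    _ = 4 ^ (a + 1) * (‖kernelPoint p‖ ^ (a + 1))⁻¹ := by rw [div_pow]; field_simp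

theorem measurable_abelKernel {n : ℕ} (a k : ℕ) (ε : ℝ) :
    Measurable (abelKernel a k ε : Heis n → ℝ) := by
  have := (continuous_zNormSq (n := n)).measurable
  unfold abelKernel laplacePoint
  fun_prop

theorem norm_abelKernel_mul_le (a k : ℕ) {ε : ℝ} (hε : 0 ≤ ε) (f : 𝓢(Heis (a + 1), ℂ))
    {p : Heis (a + 1)} (h : p.1 ≠ 0 ∧ p.2 ≠ 0) : ‖(abelKernel a k ε p : ℂ) * f p‖ ≤
      (k + a).factorial / k.factorial * (2 * 4 ^ (a + 1)) * (singWeight a p * ‖f p‖) := by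
  rw [norm_mul, Complex.norm_real, Real.norm_eq_abs, ← mul_assoc]
  gcongr
  refine (abs_abelKernel_le a k hε h.1).trans ?_
  gcongr
  exact inv_norm_kernelPoint_pow_le a h

/-- The terms of the spherical expansion as integrals over the Heisenberg group. -/
theorem integral_phiIntegrand (a k : ℕ) (α : ℝ) (f : 𝓢(Heis (a + 1), ℂ)) :
    ∫ l : ℝ, phiIntegrand α k f l = ∫ p, ((-(1 / (2 * k + (a + 1 : ℕ) - α)) *
      abelKernel a k 0 p : ℝ) : ℂ) * f p := by
  have hn : 1 ≤ a + 1 := by omega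
  have hm (ε : ℝ) : AEStronglyMeasurable (fun p : Heis (a + 1) => (abelKernel a k ε p : ℂ) * f p) :=
    (Complex.measurable_ofReal.comp (measurable_abelKernel a k ε)).aestronglyMeasurable.mul
      f.continuous.aestronglyMeasurable
  -- The factor e^{-ε|l|} justifies Fubini. The limit ε → 0 is dominated by the integrable
  -- `phiIntegrand` in l, and by `singWeight` times |f| on the group.
  have hL : Tendsto (fun ε : ℝ => ∫ l : ℝ, (Real.exp (-(ε * |l|)) : ℂ) * phiIntegrand α k f l)
      (𝓝[>] 0) (𝓝 (∫ l : ℝ, phiIntegrand α k f l)) := by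
    refine tendsto_integral_filter_of_dominated_convergence (fun l => ‖phiIntegrand α k f l‖)
      (Eventually.of_forall fun ε => ?_) ?_ (integrable_phiIntegrand hn α k f).norm
      (Eventually.of_forall fun l => ?_)
    · exact (by fun_prop : Continuous fun l : ℝ => (Real.exp (-(ε * |l|)) : ℂ)).aestronglyMeasurable.mul
        (aestronglyMeasurable_phiIntegrand hn α k f)
    · filter_upwards [self_mem_nhdsWithin] with ε hε
      have hε : 0 < ε := hε
      refine Eventually.of_forall fun l => ?_
      rw [norm_mul, Complex.norm_real, Real.norm_eq_abs, Real.abs_exp]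
      refine mul_le_of_le_one_left (norm_nonneg _) (Real.exp_le_one_iff.2 ?_)
      have : 0 ≤ ε * |l| := by positivity
      linarith
    · have h : Continuous fun ε : ℝ => (Real.exp (-(ε * |l|)) : ℂ) * phiIntegrand α k f l := by
        fun_prop
      exact (h.tendsto' 0 _ (by simp)).mono_left nhdsWithin_le_nhds
  have hR : Tendsto (fun ε : ℝ => ∫ p, (abelKernel a k ε p : ℂ) * f p)
      (𝓝[>] 0) (𝓝 (∫ p, (abelKernel a k 0 p : ℂ) * f p)) := by
    refine tendsto_integral_filter_of_dominated_convergence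
      (fun p => (k + a).factorial / k.factorial * (2 * 4 ^ (a + 1)) * (singWeight a p * ‖f p‖))
      (Eventually.of_forall hm) ?_ ((integrable_singWeight_mul a f).const_mul _) ?_
    · filter_upwards [self_mem_nhdsWithin] with ε hε
      filter_upwards [ae_ne_zero a] with p hp
      exact norm_abelKernel_mul_le a k (le_of_lt hε) f hp
    · filter_upwards [ae_ne_zero a] with p hp
      have hP : laplacePoint 0 p ≠ 0 := fun h => by
        have h1 := laplacePoint_re 0 p
        rw [h, Complex.zero_re] at h1
        linarith [zNormSq_pos hp.1]
      have h1 : ContinuousAt (fun ε : ℝ => laplacePoint ε p) 0 := by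
        unfold laplacePoint; fun_prop
      have h2 : ContinuousAt (fun ε : ℝ => (abelKernel a k ε p : ℂ) * f p) 0 := by
        refine (Complex.continuous_ofReal.continuousAt.comp (continuousAt_const.mul
          (continuousAt_const.mul (Complex.continuous_re.continuousAt.comp ?_)))).mul
          continuousAt_const
        exact ((h1.sub continuousAt_const).pow k).div (h1.pow _) (pow_ne_zero _ hP)
      exact h2.continuousWithinAt (s := Set.Ioi 0)
  have hR' := hR.const_mul ((-(1 / (2 * k + (a + 1 : ℕ) - α)) : ℝ) : ℂ)
  rw [← integral_const_mul] at hR'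
  simp only [Complex.ofReal_mul, mul_assoc]
  refine tendsto_nhds_unique (hL.congr' ?_) hR'
  filter_upwards [self_mem_nhdsWithin] with ε hε
  have h := integral_integral_weightedRadial hn k hε f
  rw [Nat.add_sub_cancel] at h
  rw [← h, ← integral_const_mul]
  refine integral_congr_ae ?_
  filter_upwards [compl_mem_ae_iff.2 (measure_singleton (0 : ℝ))] with l hl
  have hl : |l| ≠ 0 := abs_ne_zero.2 hl
  have h1 : 1 / (-|l| * (2 * k + (a + 1 : ℕ) - α)) * |l| ^ (a + 1) =
      -(1 / (2 * k + (a + 1 : ℕ) - α)) * |l| ^ a := by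
    rw [pow_succ, neg_mul, div_neg, one_div, mul_inv]
    field_simp
  have h2 := congrArg (fun x : ℝ => (x : ℂ)) h1
  simp only [phiIntegrand]
  push_cast at h2 ⊢
  linear_combination (Complex.exp (-(ε * |l|)) * sphericalPairing l k f) * h2

end

/-! ### Abel summation and the boundary limit -/

noncomputable section

open Filter Topology

/-- The kernel with the argument of the hypergeometric function scaled by `r`. -/
def scaledKernel {n : ℕ} (α r : ℝ) (p : Heis n) : ℝ :=
  ((kernelPoint p / ((zNormSq p ^ 2 + 16 * p.2 ^ 2 : ℝ) : ℂ)) ^ n *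
    gaussHyp (n : ℂ) ((((n : ℝ) - α) / 2 : ℝ) : ℂ) ((((n : ℝ) - α) / 2 : ℝ) + 1)
      (r * hypArg p)).re

theorem scaledKernel_one {n : ℕ} (α : ℝ) (p : Heis n) : scaledKernel α 1 p = kernelRe α p := by
  rw [scaledKernel, Complex.ofReal_one, one_mul]
  rfl

theorem half_sub_add_ne_zero {n : ℕ} {α : ℝ} (hα : ∀ k : ℕ, α ≠ 2 * (k : ℝ) + n) (k : ℕ) :
    ((n : ℝ) - α) / 2 + k ≠ 0 := fun h => hα k (by linarith)

theorem continuousOn_scaledKernel {a : ℕ} {α : ℝ} (hα : ∀ k : ℕ, α ≠ 2 * (k : ℝ) + (a + 1 : ℕ))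
    {r : ℝ} (hr0 : 0 ≤ r) (hr1 : r ≤ 1) :
    ContinuousOn (scaledKernel α r : Heis (a + 1) → ℝ) {p | p.1 ≠ 0} := by
  have hs := continuous_zNormSq (n := a + 1)
  have hw : Continuous (kernelPoint : Heis (a + 1) → ℂ) := by unfold kernelPoint; fun_prop
  have hd : Continuous fun p : Heis (a + 1) => ((zNormSq p ^ 2 + 16 * p.2 ^ 2 : ℝ) : ℂ) := by
    fun_prop
  have hd0 : ∀ p ∈ {p : Heis (a + 1) | p.1 ≠ 0}, ((zNormSq p ^ 2 + 16 * p.2 ^ 2 : ℝ) : ℂ) ≠ 0 := by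
    intro p hp
    have := zNormSq_pos hp
    exact_mod_cast (by positivity : zNormSq p ^ 2 + 16 * p.2 ^ 2 ≠ 0)
  have hζ : ContinuousOn (hypArg : Heis (a + 1) → ℂ) {p | p.1 ≠ 0} :=
    ((hw.pow 2).continuousOn.div hd.continuousOn hd0).neg
  refine Complex.continuous_re.comp_continuousOn
    (((hw.continuousOn.div hd.continuousOn hd0).pow _).mul ?_)
  exact (continuousOn_gaussHyp a (half_sub_add_ne_zero hα)).comp (continuousOn_const.mul hζ)
    fun p hp => mul_hypArg_mem_hypDomain hp hr0 hr1

theorem aestronglyMeasurable_scaledKernel {a : ℕ} {α : ℝ}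
    (hα : ∀ k : ℕ, α ≠ 2 * (k : ℝ) + (a + 1 : ℕ)) {r : ℝ} (hr0 : 0 ≤ r) (hr1 : r ≤ 1) :
    AEStronglyMeasurable (scaledKernel α r : Heis (a + 1) → ℝ) := by
  have ho : IsOpen {p : Heis (a + 1) | p.1 ≠ 0} := isOpen_ne_fun continuous_fst continuous_const
  have h := (continuousOn_scaledKernel hα hr0 hr1).aestronglyMeasurable (μ := volume)
    ho.measurableSet
  have hae : ∀ᵐ p : Heis (a + 1), p ∈ {p : Heis (a + 1) | p.1 ≠ 0} :=
    (ae_ne_zero a).mono fun p hp => hp.1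
  rwa [Measure.restrict_eq_self_of_ae_mem hae] at h

theorem norm_kernelPoint_div {n : ℕ} {p : Heis n} (h : p.1 ≠ 0) :
    ‖kernelPoint p / ((zNormSq p ^ 2 + 16 * p.2 ^ 2 : ℝ) : ℂ)‖ = ‖kernelPoint p‖⁻¹ := by
  have h1 := (zNormSq_pos h).trans_le (zNormSq_le_norm p)
  rw [← normSq_kernelPoint, norm_div, Complex.norm_real, Complex.normSq_eq_norm_sq,
    Real.norm_of_nonneg (by positivity)]
  field_simp

/-- With x = |z|²/|w| ≤ |1-rζ|, the growth bound gives |w|^{-(a+1)} x^{-a-1/2} = |z|^{-(2a+1)}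
|w|^{-1/2}, with a constant independent of r. -/
theorem exists_abs_scaledKernel_le {a : ℕ} {α : ℝ}
    (hα : ∀ k : ℕ, α ≠ 2 * (k : ℝ) + (a + 1 : ℕ)) :
    ∃ C : ℝ, 0 ≤ C ∧ ∀ (r : ℝ) (p : Heis (a + 1)), 0 ≤ r → r ≤ 1 → p.1 ≠ 0 ∧ p.2 ≠ 0 →
      |scaledKernel α r p| ≤ C * singWeight a p := by
  obtain ⟨C, hC, h⟩ := exists_norm_gaussHyp_le a (half_sub_add_ne_zero hα)
  refine ⟨C, hC, fun r p hr0 hr1 hp => ?_⟩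
  have hs := zNormSq_pos hp.1
  have hw := hs.trans_le (zNormSq_le_norm p)
  have h1 := h _ (mul_hypArg_mem_hypDomain hp.1 hr0 hr1) (by
    rw [norm_mul, Complex.norm_real, Real.norm_of_nonneg hr0]
    exact mul_le_one₀ hr1 (norm_nonneg _) (norm_hypArg_le p))
  have h2 := le_norm_one_sub_mul_hypArg hp.1 hr0 hr1
  rw [scaledKernel]
  refine (Complex.abs_re_le_norm _).trans ?_
  rw [norm_mul, norm_pow, norm_kernelPoint_div hp.1]
  generalize gaussHyp ((a + 1 : ℕ) : ℂ) ((((a + 1 : ℕ) - α) / 2 : ℝ) : ℂ)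
    ((((a + 1 : ℕ) - α) / 2 : ℝ) + 1) (r * hypArg p) = G at *
  set x := zNormSq p / ‖kernelPoint p‖ with hx
  have hx0 : 0 < x := by positivity
  have h3 : ‖G‖ * (x ^ a * Real.sqrt x) ≤ C := by
    refine le_trans ?_ h1
    rw [mul_assoc]
    gcongr
  have h4 : ‖kernelPoint p‖ ^ (a + 1) * (x ^ a * Real.sqrt x) =
      zNormSq p ^ a * Real.sqrt (zNormSq p) * Real.sqrt ‖kernelPoint p‖ := by
    rw [hx, Real.sqrt_div hs.le, div_pow, pow_succ]
    have h5 := Real.mul_self_sqrt hw.le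
    have h6 : Real.sqrt ‖kernelPoint p‖ ≠ 0 := by positivity
    field_simp
    rw [sq, h5]
  calc ‖kernelPoint p‖⁻¹ ^ (a + 1) * ‖G‖
      ≤ ‖kernelPoint p‖⁻¹ ^ (a + 1) * (C / (x ^ a * Real.sqrt x)) := by
        gcongr
        exact (le_div_iff₀ (by positivity)).2 h3
    _ = C * (zNormSq p ^ a * Real.sqrt (zNormSq p) * Real.sqrt ‖kernelPoint p‖)⁻¹ := by
        rw [← h4, inv_pow]
        field_simp
    _ ≤ C * singWeight a p := by
        gcongr
        exact singWeight_bound a hp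

theorem norm_scaledKernel_mul_le {a : ℕ} {α C r : ℝ} {p : Heis (a + 1)}
    (h : |scaledKernel α r p| ≤ C * singWeight a p) (f : 𝓢(Heis (a + 1), ℂ)) :
    ‖(scaledKernel α r p : ℂ) * f p‖ ≤ C * (singWeight a p * ‖f p‖) := by
  rw [norm_mul, Complex.norm_real, Real.norm_eq_abs, ← mul_assoc]
  gcongr

theorem aestronglyMeasurable_scaledKernel_mul {a : ℕ} {α : ℝ}
    (hα : ∀ k : ℕ, α ≠ 2 * (k : ℝ) + (a + 1 : ℕ)) {r : ℝ} (hr0 : 0 ≤ r) (hr1 : r ≤ 1)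
    (f : 𝓢(Heis (a + 1), ℂ)) :
    AEStronglyMeasurable fun p : Heis (a + 1) => (scaledKernel α r p : ℂ) * f p :=
  (Complex.continuous_ofReal.comp_aestronglyMeasurable
    (aestronglyMeasurable_scaledKernel hα hr0 hr1)).mul f.continuous.aestronglyMeasurable

theorem integrable_scaledKernel_mul {a : ℕ} {α : ℝ}
    (hα : ∀ k : ℕ, α ≠ 2 * (k : ℝ) + (a + 1 : ℕ)) {r : ℝ} (hr0 : 0 ≤ r) (hr1 : r ≤ 1)
    (f : 𝓢(Heis (a + 1), ℂ)) : Integrable fun p => (scaledKernel α r p : ℂ) * f p := by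
  obtain ⟨C, -, h⟩ := exists_abs_scaledKernel_le hα
  refine ((integrable_singWeight_mul a f).const_mul C).mono'
    (aestronglyMeasurable_scaledKernel_mul hα hr0 hr1 f) ?_
  filter_upwards [ae_ne_zero a] with p hp
  exact norm_scaledKernel_mul_le (h r p hr0 hr1 hp) f

/-- The constant in front of the kernel. -/
def kernelConst (n : ℕ) (α : ℝ) : ℝ := -(2 * 4 ^ n * (n - 1).factorial) / (n - α)

/-- With b = (n-α)/2, 1/(2k+n-α) = (n-α)⁻¹ · b/(b+k), so the terms are those of the hypergeometric
series at rζ; `kernelConst` collects what does not depend on k. -/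
theorem hasSum_scaledKernel {a : ℕ} {α : ℝ} (hα : ∀ k : ℕ, α ≠ 2 * (k : ℝ) + (a + 1 : ℕ)) {r : ℝ}
    (hr0 : 0 ≤ r) (hr1 : r < 1) {p : Heis (a + 1)} (hp : p.1 ≠ 0) :
    HasSum (fun k : ℕ => r ^ k * (-(1 / (2 * k + (a + 1 : ℕ) - α)) * abelKernel a k 0 p))
      (kernelConst (a + 1) α * scaledKernel α r p) := by
  have hb := half_sub_add_ne_zero hα
  have hζ : ‖(r : ℂ) * hypArg p‖ < 1 := by
    rw [norm_mul, Complex.norm_real, Real.norm_of_nonneg hr0]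
    exact (mul_le_of_le_one_right hr0 (norm_hypArg_le p)).trans_lt hr1
  have h := Complex.hasSum_re ((hasSum_gaussHyp a hb hζ).mul_left
    ((kernelPoint p / ((zNormSq p ^ 2 + 16 * p.2 ^ 2 : ℝ) : ℂ)) ^ (a + 1)))
  refine (funext fun k => ?_ : (fun k : ℕ => _) = _) ▸ h.mul_left (kernelConst (a + 1) α)
  have h1 : (kernelPoint p / ((zNormSq p ^ 2 + 16 * p.2 ^ 2 : ℝ) : ℂ)) ^ (a + 1) *
      (((k + a).choose a : ℂ) * (((((a + 1 : ℕ) - α) / 2 : ℝ) : ℂ) /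
        (((((a + 1 : ℕ) - α) / 2 : ℝ) : ℂ) + k)) * ((r : ℂ) * hypArg p) ^ k) =
      (((k + a).choose a * ((((a + 1 : ℕ) - α) / 2) / (((a + 1 : ℕ) - α) / 2 + k)) * r ^ k : ℝ) : ℂ) *
      ((kernelPoint p / ((zNormSq p ^ 2 + 16 * p.2 ^ 2 : ℝ) : ℂ)) ^ (a + 1) * hypArg p ^ k) := by
    push_cast
    ring
  rw [h1, Complex.re_ofReal_mul, abelKernel_zero a k hp, kernelConst, Nat.add_sub_cancel]
  have h2 : ((a + 1 : ℕ) : ℝ) - α ≠ 0 := fun h => by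
    have := hb 0
    rw [h] at this
    simp at this
  have h3 : 2 * (k : ℝ) + (a + 1 : ℕ) - α ≠ 0 := fun h => hα k (by linarith)
  have h4 := hb k
  have h5 : (((a + 1 : ℕ) : ℝ) - α) / 2 / ((((a + 1 : ℕ) : ℝ) - α) / 2 + k) =
      (((a + 1 : ℕ) : ℝ) - α) / (2 * k + (a + 1 : ℕ) - α) := by
    rw [div_eq_div_iff h4 h3]
    ring
  rw [h5]
  generalize ((a + 1 : ℕ) : ℝ) = N at *
  field_simp

/-- Up to a constant factor these are the absolute values of the terms of the hypergeometric series
at ζ = r. -/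
theorem summable_abel_coeff {a : ℕ} {α : ℝ} (hα : ∀ k : ℕ, α ≠ 2 * (k : ℝ) + (a + 1 : ℕ)) {r : ℝ}
    (hr0 : 0 ≤ r) (hr1 : r < 1) : Summable fun k : ℕ =>
      r ^ k * |1 / (2 * k + (a + 1 : ℕ) - α)| * ((k + a).factorial / k.factorial : ℝ) := by
  have hb := half_sub_add_ne_zero hα
  have hr : ‖(r : ℂ)‖ < 1 := by rwa [Complex.norm_real, Real.norm_of_nonneg hr0]
  have h := ((hasSum_gaussHyp a hb hr).summable.norm).mul_left
    (a.factorial / |((a + 1 : ℕ) : ℝ) - α|)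
  refine (funext fun k => ?_ : (fun k : ℕ => _) = _) ▸ h
  have h2 : |((a + 1 : ℕ) : ℝ) - α| ≠ 0 := abs_ne_zero.2 fun h => by
    have := hb 0
    rw [h] at this
    simp at this
  have h3 : 2 * (k : ℝ) + (a + 1 : ℕ) - α ≠ 0 := fun h => hα k (by linarith)
  have h5 : (((a + 1 : ℕ) : ℝ) - α) / 2 / ((((a + 1 : ℕ) : ℝ) - α) / 2 + k) =
      (((a + 1 : ℕ) : ℝ) - α) / (2 * k + (a + 1 : ℕ) - α) := by
    rw [div_eq_div_iff (hb k) h3]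
    ring
  have h6 : ((k + a).choose a : ℝ) = (k + a).factorial / (k.factorial * a.factorial) := by
    rw [add_comm k a, Nat.cast_add_choose ℝ, mul_comm (a.factorial : ℝ)]
  have h7 : ((k + a).choose a : ℂ) * (((((a + 1 : ℕ) - α) / 2 : ℝ) : ℂ) /
        (((((a + 1 : ℕ) - α) / 2 : ℝ) : ℂ) + k)) * (r : ℂ) ^ k =
      (((k + a).choose a * ((((a + 1 : ℕ) - α) / 2) / (((a + 1 : ℕ) - α) / 2 + k)) * r ^ k : ℝ) : ℂ) := by
    push_cast
    ring
  rw [h7, Complex.norm_real, Real.norm_eq_abs, h5, abs_mul, abs_mul, abs_div, abs_div, abs_one,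
    abs_of_nonneg (pow_nonneg hr0 k), Nat.abs_cast, h6]
  have h8 := abs_ne_zero.2 h3
  have : (a.factorial : ℝ) ≠ 0 := by positivity
  generalize ((a + 1 : ℕ) : ℝ) = N at *
  field_simp

/-- For r < 1 the majorants sum geometrically, so sum and integral over the group commute. At r = 1
they grow like k^{a-1} and this argument fails. -/
theorem hasSum_abel {a : ℕ} {α : ℝ} (hα : ∀ k : ℕ, α ≠ 2 * (k : ℝ) + (a + 1 : ℕ)) {r : ℝ}
    (hr0 : 0 ≤ r) (hr1 : r < 1) (f : 𝓢(Heis (a + 1), ℂ)) :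
    HasSum (fun k : ℕ => (r : ℂ) ^ k * ∫ l : ℝ, phiIntegrand α k f l)
      (kernelConst (a + 1) α * ∫ p, (scaledKernel α r p : ℂ) * f p) := by
  set F : ℕ → Heis (a + 1) → ℂ := fun k p =>
    ((r ^ k * (-(1 / (2 * k + (a + 1 : ℕ) - α)) * abelKernel a k 0 p) : ℝ) : ℂ) * f p with hF
  have hbound (k : ℕ) {p : Heis (a + 1)} (hp : p.1 ≠ 0 ∧ p.2 ≠ 0) : ‖F k p‖ ≤
      r ^ k * |1 / (2 * k + (a + 1 : ℕ) - α)| * ((k + a).factorial / k.factorial : ℝ) *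
        (2 * 4 ^ (a + 1) * (singWeight a p * ‖f p‖)) := by
    have h := norm_abelKernel_mul_le a k le_rfl f hp
    rw [norm_mul, Complex.norm_real, Real.norm_eq_abs] at h
    simp only [hF]
    rw [norm_mul, Complex.norm_real, Real.norm_eq_abs, abs_mul, abs_mul, abs_neg,
      abs_of_nonneg (pow_nonneg hr0 k)]
    calc _ = r ^ k * |1 / (2 * k + (a + 1 : ℕ) - α)| * (|abelKernel a k 0 p| * ‖f p‖) := by ring
      _ ≤ r ^ k * |1 / (2 * k + (a + 1 : ℕ) - α)| *
          ((k + a).factorial / k.factorial * (2 * 4 ^ (a + 1)) * (singWeight a p * ‖f p‖)) := by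
        gcongr
      _ = _ := by ring
  have hint (k : ℕ) : Integrable (F k) := by
    refine (((integrable_singWeight_mul a f).const_mul (2 * 4 ^ (a + 1))).const_mul
      (r ^ k * |1 / (2 * k + (a + 1 : ℕ) - α)| * ((k + a).factorial / k.factorial : ℝ))).mono' ?_
      ((ae_ne_zero a).mono fun p hp => hbound k hp)
    exact (Complex.measurable_ofReal.comp (((measurable_abelKernel a k 0).const_mul _).const_mul
      _)).aestronglyMeasurable.mul f.continuous.aestronglyMeasurable
  have hsum : Summable fun k => ∫ p, ‖F k p‖ := by
    refine Summable.of_nonneg_of_le (fun k => integral_nonneg fun p => norm_nonneg _) (fun k => ?_)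
      ((summable_abel_coeff hα hr0 hr1).mul_right
        (∫ p : Heis (a + 1), 2 * 4 ^ (a + 1) * (singWeight a p * ‖f p‖)))
    rw [← integral_const_mul]
    exact integral_mono_ae (hint k).norm
      (((integrable_singWeight_mul a f).const_mul _).const_mul _)
      ((ae_ne_zero a).mono fun p hp => hbound k hp)
  have h := hasSum_integral_of_summable_integral_norm hint hsum
  have h1 : ∫ p, ∑' k, F k p = kernelConst (a + 1) α * ∫ p, (scaledKernel α r p : ℂ) * f p := by
    rw [← integral_const_mul]
    refine integral_congr_ae ?_
    filter_upwards [ae_ne_zero a] with p hp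
    have h2 := (Complex.hasSum_ofReal.2 (hasSum_scaledKernel hα hr0 hr1 hp.1)).mul_right (f p)
    rw [h2.tsum_eq]
    push_cast
    ring
  rw [h1] at h
  refine (funext fun k => ?_ : (fun k : ℕ => _) = _) ▸ h
  rw [integral_phiIntegrand, ← integral_const_mul]
  congr 1
  ext p
  simp only [hF]
  push_cast
  ring

/-- Both sides are limits of the same Abel means as r → 1 from below. Off z = 0 the point ζ is
interior to the domain of the continuation, so the kernels converge pointwise there. -/
theorem phiFunctional_eq {a : ℕ} {α : ℝ} (hα : ∀ k : ℕ, α ≠ 2 * (k : ℝ) + (a + 1 : ℕ))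
    (f : 𝓢(Heis (a + 1), ℂ)) :
    phiFunctional α f = kernelConst (a + 1) α * ∫ p, (kernelRe α p : ℂ) * f p := by
  have hmem : ∀ᶠ r : ℝ in 𝓝[<] 1, 0 ≤ r ∧ r < 1 := by
    filter_upwards [Ico_mem_nhdsLT (zero_lt_one' ℝ)] with r hr using hr
  have hL : Tendsto (fun r : ℝ => ∑' k : ℕ, (r : ℂ) ^ k * ∫ l : ℝ, phiIntegrand α k f l)
      (𝓝[<] 1) (𝓝 (∑' k : ℕ, ∫ l : ℝ, phiIntegrand α k f l)) := by
    refine tendsto_tsum_of_dominated_convergence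
      (summable_integral_norm_phiIntegrand (by omega) α f) (fun k => ?_) ?_
    · have h : Continuous fun r : ℝ => (r : ℂ) ^ k * ∫ l : ℝ, phiIntegrand α k f l := by fun_prop
      exact (h.tendsto' 1 _ (by simp)).mono_left nhdsWithin_le_nhds
    · filter_upwards [hmem] with r hr k
      rw [norm_mul, norm_pow, Complex.norm_real, Real.norm_of_nonneg hr.1]
      exact (mul_le_of_le_one_left (norm_nonneg _) (pow_le_one₀ hr.1 hr.2.le)).trans
        (norm_integral_le_integral_norm _)
  have hR : Tendsto (fun r : ℝ => ∫ p : Heis (a + 1), (scaledKernel α r p : ℂ) * f p)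
      (𝓝[<] 1) (𝓝 (∫ p, (kernelRe α p : ℂ) * f p)) := by
    obtain ⟨C, hC, h⟩ := exists_abs_scaledKernel_le hα
    refine tendsto_integral_filter_of_dominated_convergence
      (fun p => C * (singWeight a p * ‖f p‖)) ?_ ?_ ((integrable_singWeight_mul a f).const_mul C) ?_
    · filter_upwards [hmem] with r hr
      exact aestronglyMeasurable_scaledKernel_mul hα hr.1 hr.2.le f
    · filter_upwards [hmem] with r hr
      filter_upwards [ae_ne_zero a] with p hp
      exact norm_scaledKernel_mul_le (h r p hr.1 hr.2.le hp) f
    · filter_upwards [ae_ne_zero a] with p hp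
      have h1 := (continuousOn_gaussHyp a (half_sub_add_ne_zero hα)).continuousAt
        (isOpen_hypDomain.mem_nhds (mul_hypArg_mem_hypDomain hp.1 zero_le_one le_rfl))
      have h2 : ContinuousAt (fun r : ℝ => (r : ℂ) * hypArg p) 1 := by fun_prop
      have h3 : ContinuousAt (fun r : ℝ => scaledKernel α r p) 1 := by
        unfold scaledKernel
        exact Complex.continuous_re.continuousAt.comp
          (continuousAt_const.mul (ContinuousAt.comp (f := fun r : ℝ => (r : ℂ) * hypArg p) h1 h2))
      rw [← scaledKernel_one]
      exact (((Complex.continuous_ofReal.continuousAt.comp h3).mul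
        continuousAt_const).tendsto).mono_left nhdsWithin_le_nhds
  refine tendsto_nhds_unique hL ((hR.const_mul (kernelConst (a + 1) α : ℂ)).congr' ?_)
  filter_upwards [hmem] with r hr
  exact (hasSum_abel hα hr.1 hr.2 f).tsum_eq.symm

/-- Integration against the kernel as a continuous linear functional on Schwartz space. -/
theorem exists_kernel_clm {a : ℕ} {α : ℝ} (hα : ∀ k : ℕ, α ≠ 2 * (k : ℝ) + (a + 1 : ℕ)) :
    ∃ Ψ : 𝓢(Heis (a + 1), ℂ) →L[ℂ] ℂ, ∀ f : 𝓢(Heis (a + 1), ℂ),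
      Ψ f = ∫ p, (kernelRe α p : ℂ) * f p := by
  have hint (f : 𝓢(Heis (a + 1), ℂ)) : Integrable fun p => (kernelRe α p : ℂ) * f p := by
    simpa only [scaledKernel_one] using integrable_scaledKernel_mul hα zero_le_one le_rfl f
  obtain ⟨C, hC, h⟩ := exists_abs_scaledKernel_le hα
  refine ⟨SchwartzMap.mkCLMtoNormedSpace (𝕜 := ℂ) (σ := RingHom.id ℂ)
    (fun f => ∫ p, (kernelRe α p : ℂ) * f p)
    (fun f g => ?_) (fun c f => ?_) ⟨Finset.Iic (4, 0), C * (16 * (∫ p : Heis (a + 1),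
      ((‖p.1‖ ^ (2 * a + 1))⁻¹ * (1 + ‖p.1‖ ^ 2)⁻¹) *
        ((Real.sqrt |p.2|)⁻¹ * (1 + p.2 ^ 2)⁻¹))), ?_, fun f => ?_⟩, fun f => rfl⟩
  · simp only [add_apply, mul_add]
    exact integral_add (hint f) (hint g)
  · simp only [smul_apply, smul_eq_mul, RingHom.id_apply]
    rw [← integral_const_mul]
    congr 1; ext p; ring
  · have : 0 ≤ ∫ p : Heis (a + 1), ((‖p.1‖ ^ (2 * a + 1))⁻¹ * (1 + ‖p.1‖ ^ 2)⁻¹) *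
        ((Real.sqrt |p.2|)⁻¹ * (1 + p.2 ^ 2)⁻¹) := integral_nonneg fun p => by positivity
    positivity
  · rw [mul_assoc]
    refine le_trans ?_ (mul_le_mul_of_nonneg_left (integral_singWeight_mul_le a f) hC)
    rw [← integral_const_mul]
    refine norm_integral_le_of_norm_le ((integrable_singWeight_mul a f).const_mul C) ?_
    filter_upwards [ae_ne_zero a] with p hp
    rw [← scaledKernel_one]
    exact norm_scaledKernel_mul_le (h 1 p zero_le_one le_rfl hp) f

end

theorem theorem1p1 (n : ℕ) (hn : 1 ≤ n) (α : ℝ) (hα : ∀ k : ℕ, α ≠ 2 * (k : ℝ) + n) :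
    -- the expansion defining `Φ_α` converges absolutely on every Schwartz function
    (∀ f : 𝓢(Heis n, ℂ),
      (∀ (k : ℕ) (l : ℝ), l ≠ 0 → Integrable (fun p : Heis n => sphericalFun l k p * f p)) ∧
      (∀ k : ℕ, Integrable (fun l : ℝ => phiIntegrand α k f l)) ∧
      Summable (fun k : ℕ => ∫ l : ℝ, ‖phiIntegrand α k f l‖)) ∧
    -- it defines a tempered distribution, given by integration against the explicit kernel
    ∃ Φ : 𝓢'(Heis n, ℂ),
      (∀ f : 𝓢(Heis n, ℂ), Φ f = phiFunctional α f) ∧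
      ∀ f : 𝓢(Heis n, ℂ),
        Integrable (fun p : Heis n => (kernelRe α p : ℂ) * f p) ∧
        Φ f = ((-(2 * 4 ^ n * (n - 1).factorial) / (n - α) : ℝ) : ℂ) *
          ∫ p : Heis n, (kernelRe α p : ℂ) * f p := by
  obtain ⟨a, rfl⟩ : ∃ a, n = a + 1 := ⟨n - 1, by omega⟩
  refine ⟨fun f => ⟨fun k l hl => integrable_sphericalFun_mul hn hl k f,
    fun k => integrable_phiIntegrand hn α k f, summable_integral_norm_phiIntegrand hn α f⟩, ?_⟩
  obtain ⟨Ψ, hΨ⟩ := exists_kernel_clm hα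
  -- The distribution is built from the kernel, whose continuity is known; agreement with the
  -- spectral expansion is then `phiFunctional_eq`.
  have hΦ (f : 𝓢(Heis (a + 1), ℂ)) :
      ContinuousLinearMap.toPointwiseConvergenceCLM _ _ _ _ ((kernelConst (a + 1) α : ℂ) • Ψ) f =
        kernelConst (a + 1) α * ∫ p, (kernelRe α p : ℂ) * f p := by
    rw [← hΨ f]
    rfl
  refine ⟨_, fun f => (hΦ f).trans (phiFunctional_eq hα f).symm, fun f => ⟨?_, hΦ f⟩⟩
  simpa only [scaledKernel_one] using integrable_scaledKernel_mul hα zero_le_one le_rfl f
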